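/- **Setting.** Let $L>0$, $\mathbb T=\mathbb R/L\mathbb Z$, and let $H^k(\mathbb T,\mathbb R^2)$ be the completion of $C^\infty(\mathbb T,\mathbb R^2)$ in the norm $\|u\|_{H^k}=\bigl(\sum_{\ell=0}^k\int_{\mathbb T}|\partial_x^\ell u|^2\,dx\bigr)^{1/2}$. For $0\le\sigma<1$ let $\phi(u)=u(1+u^2)^{-\sigma/2}$, a bijection of $\mathbb R$, let $$B(u)=\begin{pmatrix}-\frac{u}{\sqrt{1+u^2}} & -\frac{1}{(1+u^2)^{\frac{1-\sigma}{2}}(1+(1-\sigma)u^2)}\\[1mm] -\frac{\sigma}{(1+u^2)^{\frac{1+\sigma}{2}}} & \frac{(2\sigma-1-(1-\sigma)u^2)u}{\sqrt{1+u^2}\,(1+(1-\sigma)u^2)}\end{pmatrix},$$ $\mathtt B(t,w)=B\bigl(\phi^{-1}(t^{1-3\sigma}w)\bigr)$ for $t\in(0,1]$, and $\pi^\perp=\begin{pmatrix}1&0\\0&0\end{pmatrix}$. Writing $W=(z,w)^{\mathrm{tr}}$, consider the nonlinear equation $$\partial_tW+\mathtt B(t,w)\,\partial_xW=\tfrac{3\sigma-1}{t}\pi^\perp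 W\quad\text{in }(0,1]\times\mathbb T,\qquad(1)$$ and its linearisation $$\partial_t\tilde W+\tilde{\mathtt B}\,\partial_x\tilde W=\tfrac{3\sigma-1}{t}\pi^\perp\tilde W\quad\text{in }(0,1]\times\mathbb T,\qquad \tilde{\mathtt B}=\mathtt B(t,0)=\begin{pmatrix}0&-1\\-\sigma&0\end{pmatrix}.\qquad(2)$$ Solutions of (1) and (2) are always understood in the class $C^0((0,1],H^k(\mathbb T,\mathbb R^2))\cap C^1((0,1],H^{k-1}(\mathbb T,\mathbb R^2))$. **Proposition 7.1.** Let $k\ge2$ be an integer and $\frac13<\sigma<\frac{k+1}{3k}$. There are constants $C_s,C_0,\delta_0,C_1>0$, depending only on $L,k,\sigma$ ($\delta_0$ being the smallness threshold on the data of (1), and $C_1$ depending on the choice of $\delta_0$), such that the following holds for every $\tilde W_1\in H^k(\mathbb T,\mathbb R^2)$. 1. There is a unique solution $\tilde W$ of (2) with $\tilde W(1)=\tilde W_1$, and for all $t\in(0,1]$ $$\|\tilde W(t)\|_{C^{k-1,\frac12}}\le C_s\|\tilde W(t)\|_{H^k},\qquad \|\tilde W(t)\|_{H^k}\le C_0\|\tilde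 W(1)\|_{H^k}.$$ 2. $\tilde W(t)$ converges in $H^{k-1}(\mathbb T,\mathbb R^2)$ as $t\searrow0$; denote the limit by $\tilde W(0)$. 3. Let $0<\delta<\delta_0$ and let $W$ be a solution of (1) with $\|W(1)\|_{H^k}\le\delta$. Then $W(t)$ converges in $H^{k-1}(\mathbb T,\mathbb R^2)$ as $t\searrow0$ to a limit, denoted $W(0)$, and for all $t\in[0,1]$ $$\|W(t)-\tilde W(t)\|_{C^{k-2,\frac12}}\le C_s\|W(t)-\tilde W(t)\|_{H^{k-1}},\qquad \|W(t)-\tilde W(t)\|_{H^{k-1}}\le C_1\bigl(\|W(1)-\tilde W(1)\|_{H^{k-1}}+\delta^2\bigr).$$ -/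

import Mathlib

open MeasureTheory Filter Topology Set
open scoped ENNReal NNReal ContDiff

noncomputable section

/-! ## The circle `𝕋 = ℝ / Lℤ` and Sobolev spaces on it -/

/-- The value space `ℝ²` with its Euclidean norm; a vector is `(z, w)`. -/
abbrev Vec2 : Type := EuclideanSpace ℝ (Fin 2)

/-- The derivative `∂ₓ v` of a function on the circle. -/
def circleDeriv {L : ℝ} (v : AddCircle L → Vec2) : AddCircle L → Vec2 :=
  fun x => deriv (fun h : ℝ => v (x + (h : AddCircle L))) 0

/-- `v` is of class `C^n` on the circle (its periodic lift to `ℝ` is of class `C^n`). -/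
def CircleContDiff {L : ℝ} (n : WithTop ℕ∞) (v : AddCircle L → Vec2) : Prop :=
  ContDiff ℝ n (fun s : ℝ => v (s : AddCircle L))

/-- `L²(𝕋, ℝ²)`, with respect to Lebesgue measure `dx` (of total mass `L`). -/
abbrev CircleL2 (L : ℝ) [Fact (0 < L)] : Type :=
  Lp Vec2 2 (volume : Measure (AddCircle L))

/-- Tuples `(u₀, …, u_k)` in `L²(𝕋, ℝ²)` with the norm `(∑ ‖u_ℓ‖²_{L²})^{1/2}`. -/
abbrev JetL2 (L : ℝ) [Fact (0 < L)] (k : ℕ) : Type :=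
  PiLp 2 (fun _ : Fin (k + 1) => CircleL2 L)

/-- The jets `(v, ∂ₓ v, …, ∂ₓ^k v)` of smooth functions `v` on the circle
(these form a linear subspace). -/
def smoothJets (L : ℝ) [Fact (0 < L)] (k : ℕ) : Set (JetL2 L k) :=
  {U | ∃ v : AddCircle L → Vec2, CircleContDiff ∞ v ∧
    ∀ ℓ : Fin (k + 1), (U ℓ : AddCircle L → Vec2) =ᵐ[volume] circleDeriv^[(ℓ : ℕ)] v}

/-- `H^k(𝕋, ℝ²)`: the completion of `C^∞(𝕋, ℝ²)` for the norm
`(∑_{ℓ ≤ k} ∫ |∂ₓ^ℓ u|² dx)^{1/2}`, realised as the closure of the smooth jets in `L²`.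
A function `u` is stored as `(u, ∂ₓ u, …, ∂ₓ^k u)`. -/
def sobolev (L : ℝ) [Fact (0 < L)] (k : ℕ) : Submodule ℝ (JetL2 L k) :=
  (Submodule.span ℝ (smoothJets L k)).topologicalClosure

/-- The function underlying an element of `H^k`. -/
def sobolevFun {L : ℝ} [Fact (0 < L)] {k : ℕ} (u : sobolev L k) : AddCircle L → Vec2 :=
  (u : JetL2 L k) 0

/-- The (weak) derivative `∂ₓ u` of an element of `H^k`, `k ≥ 1`. -/
def sobolevDx {L : ℝ} [Fact (0 < L)] {k : ℕ} (hk : 1 ≤ k) (u : sobolev L k) :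
    AddCircle L → Vec2 :=
  (u : JetL2 L k) ⟨1, Nat.lt_succ_of_le hk⟩

/-- Truncation of jets. -/
def jetTruncate (L : ℝ) [Fact (0 < L)] {j k : ℕ} (h : j ≤ k) : JetL2 L k →L[ℝ] JetL2 L j :=
  (PiLp.continuousLinearEquiv 2 ℝ (fun _ : Fin (j + 1) => CircleL2 L)).symm.toContinuousLinearMap ∘L
    ContinuousLinearMap.pi fun i : Fin (j + 1) =>
      PiLp.proj 2 (fun _ : Fin (k + 1) => CircleL2 L) (Fin.castLE (Nat.succ_le_succ h) i)

theorem jetTruncate_mem (L : ℝ) [Fact (0 < L)] {j k : ℕ} (h : j ≤ k) (U : JetL2 L k)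
    (hU : U ∈ sobolev L k) : jetTruncate L h U ∈ sobolev L j := by
  have hle : sobolev L k ≤ (sobolev L j).comap (jetTruncate L h).toLinearMap := by
    refine Submodule.topologicalClosure_minimal _ (Submodule.span_le.2 ?_) ?_
    · rintro V ⟨v, hv, hV⟩
      refine Submodule.le_topologicalClosure _ (Submodule.subset_span ⟨v, hv, fun ℓ => ?_⟩)
      exact hV (Fin.castLE (Nat.succ_le_succ h) ℓ)
    · exact (Submodule.isClosed_topologicalClosure _).preimage (jetTruncate L h).continuous
  exact hle hU

/-- The inclusion `H^k ⊆ H^j` for `j ≤ k`. -/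
def sobolevIncl {L : ℝ} [Fact (0 < L)] {j k : ℕ} (h : j ≤ k) : sobolev L k →L[ℝ] sobolev L j :=
  ((jetTruncate L h).comp (sobolev L k).subtypeL).codRestrict (sobolev L j)
    (fun u => jetTruncate_mem L h u u.2)

/-- The `C^{m,α}` norm of a class `f` of functions on the circle: the norm
`∑_{ℓ ≤ m} sup |∂ₓ^ℓ v| + [∂ₓ^m v]_α` of its (unique) representative `v` of class `C^m`,
and `∞` if there is no such representative. -/
def holderENorm {L : ℝ} [Fact (0 < L)] (m : ℕ) (α : ℝ≥0) (f : AddCircle L → Vec2) : ℝ≥0∞ :=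
  ⨅ (v : AddCircle L → Vec2) (_ : CircleContDiff m v) (_ : f =ᵐ[volume] v),
    (∑ ℓ ∈ Finset.range (m + 1), ⨆ x, ‖(circleDeriv^[ℓ] v) x‖ₑ) +
      eHolderNorm α (circleDeriv^[m] v)

/-! ## The coefficients of the equations -/

/-- The change of the velocity variable `w = φ(u) = u / (1 + u²)^{σ/2}`. -/
def velocityMap (σ u : ℝ) : ℝ := u / (1 + u ^ 2) ^ (σ / 2)

/-- The inverse `u = φ⁻¹(w)`; `φ` is a bijection of `ℝ` for `0 ≤ σ < 1`,
see `velocityMap_bijective`. -/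
def velocityInv (σ : ℝ) : ℝ → ℝ := Function.invFun (velocityMap σ)

/-- The matrix `B` as a function of `u`. -/
def matrixB (σ u : ℝ) : Matrix (Fin 2) (Fin 2) ℝ :=
  !![-(u / √(1 + u ^ 2)),
      -(1 / ((1 + u ^ 2) ^ ((1 - σ) / 2) * (1 + (1 - σ) * u ^ 2)));
    -(σ / (1 + u ^ 2) ^ ((1 + σ) / 2)),
      (2 * σ - 1 - (1 - σ) * u ^ 2) * u / (√(1 + u ^ 2) * (1 + (1 - σ) * u ^ 2))]

/-- The rescaled coefficient `𝙱(t, 𝚠) = B(u)` at `u = φ⁻¹(t^{1-3σ} 𝚠)`. -/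
def fuchsianB (σ t w : ℝ) : Matrix (Fin 2) (Fin 2) ℝ :=
  matrixB σ (velocityInv σ (t ^ (1 - 3 * σ) * w))

/-- The projection `π^⊥` onto the first component. -/
def piPerp : Matrix (Fin 2) (Fin 2) ℝ := !![1, 0; 0, 0]

/-- `W ∈ C⁰((0,1], H^k) ∩ C¹((0,1], H^{k-1})` solves
`∂ₜ W + M(t, w) ∂ₓ W = ((3σ - 1)/t) π^⊥ W` on `(0,1] × 𝕋`, where `W = (z, w)`. -/
def SolvesFuchsian {L : ℝ} [Fact (0 < L)] {k : ℕ} (hk : 1 ≤ k) (σ : ℝ)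
    (M : ℝ → ℝ → Matrix (Fin 2) (Fin 2) ℝ) (W : ℝ → sobolev L k) : Prop :=
  ContinuousOn W (Ioc 0 1) ∧
  ∃ W' : ℝ → sobolev L (k - 1),
    ContinuousOn W' (Ioc 0 1) ∧
    (∀ t ∈ Ioc (0 : ℝ) 1,
      HasDerivWithinAt (fun s => sobolevIncl (Nat.sub_le k 1) (W s)) (W' t) (Ioc 0 1) t) ∧
    ∀ t ∈ Ioc (0 : ℝ) 1, ∀ᵐ x : AddCircle L,
      sobolevFun (W' t) x + (M t (sobolevFun (W t) x 1)).toEuclideanLin (sobolevDx hk (W t) x) =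
        ((3 * σ - 1) / t) • piPerp.toEuclideanLin (sobolevFun (W t) x)

/-- Solutions of the nonlinear equation `∂ₜ W + 𝙱(t, w) ∂ₓ W = ((3σ - 1)/t) π^⊥ W`. -/
def SolvesNonlinear {L : ℝ} [Fact (0 < L)] {k : ℕ} (hk : 1 ≤ k) (σ : ℝ)
    (W : ℝ → sobolev L k) : Prop :=
  SolvesFuchsian hk σ (fuchsianB σ) W

/-- Solutions of the linearised equation `∂ₜ W + 𝙱(t, 0) ∂ₓ W = ((3σ - 1)/t) π^⊥ W`. -/
def SolvesLinearised {L : ℝ} [Fact (0 < L)] {k : ℕ} (hk : 1 ≤ k) (σ : ℝ)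
    (W : ℝ → sobolev L k) : Prop :=
  SolvesFuchsian hk σ (fun t _ => fuchsianB σ t 0) W

end

theorem velocityMap_bijective {σ : ℝ} (h0 : 0 ≤ σ) (h1 : σ < 1) :
    Function.Bijective (velocityMap σ) := by
  have hpos : ∀ u : ℝ, 0 < 1 + u ^ 2 := fun u => by positivity
  have hd : ∀ u : ℝ, HasDerivAt (velocityMap σ)
      ((1 * (1 + u ^ 2) ^ (σ / 2) - u * (2 * u * (σ / 2) * (1 + u ^ 2) ^ (σ / 2 - 1))) /
        ((1 + u ^ 2) ^ (σ / 2)) ^ 2) u := by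
    intro u
    have h2 : HasDerivAt (fun u : ℝ => 1 + u ^ 2) (2 * u) u := by
      simpa using (hasDerivAt_pow 2 u).const_add 1
    exact (hasDerivAt_id u).div (h2.rpow_const (Or.inl (hpos u).ne'))
      (Real.rpow_pos_of_pos (hpos u) _).ne'
  have hmono : StrictMono (velocityMap σ) := by
    refine strictMono_of_deriv_pos fun u => ?_
    rw [(hd u).deriv]
    have hp := Real.rpow_pos_of_pos (hpos u) (σ / 2)
    refine div_pos ?_ (pow_pos hp 2)
    rw [Real.rpow_sub_one (hpos u).ne']
    have : 1 * (1 + u ^ 2) ^ (σ / 2) - u * (2 * u * (σ / 2) * ((1 + u ^ 2) ^ (σ / 2) / (1 + u ^ 2)))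
        = (1 + u ^ 2) ^ (σ / 2) * ((1 + (1 - σ) * u ^ 2) / (1 + u ^ 2)) := by
      have := (hpos u).ne'
      field_simp
      ring
    rw [this]
    have : 0 ≤ (1 - σ) * u ^ 2 := mul_nonneg (by linarith) (sq_nonneg u)
    exact mul_pos hp (div_pos (by linarith) (hpos u))
  have hcont : Continuous (velocityMap σ) :=
    continuous_iff_continuousAt.2 fun u => (hd u).continuousAt
  have hodd : ∀ u, velocityMap σ (-u) = -velocityMap σ u := fun u => by
    simp [velocityMap, neg_div]
  have htop : Tendsto (velocityMap σ) atTop atTop := by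
    have hlow : ∀ u : ℝ, 1 ≤ u → u ^ (1 - σ) / 2 ^ (σ / 2) ≤ velocityMap σ u := by
      intro u hu
      have hu0 : 0 < u := by linarith
      have hle : (1 + u ^ 2) ^ (σ / 2) ≤ 2 ^ (σ / 2) * u ^ σ := by
        have h3 : u ^ σ = (u ^ 2) ^ (σ / 2) := by
          rw [← Real.rpow_natCast, ← Real.rpow_mul hu0.le]
          congr 1
          push_cast
          ring
        rw [h3, ← Real.mul_rpow (by norm_num) (sq_nonneg u)]
        exact Real.rpow_le_rpow (hpos u).le (by nlinarith) (by linarith)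
      have hB := Real.rpow_pos_of_pos (hpos u) (σ / 2)
      have hC : (0 : ℝ) < 2 ^ (σ / 2) := by positivity
      have hD := Real.rpow_pos_of_pos hu0 σ
      rw [velocityMap, Real.rpow_sub hu0, Real.rpow_one, div_div]
      exact div_le_div_of_nonneg_left hu0.le hB (by linarith)
    have hlim : Tendsto (fun u : ℝ => u ^ (1 - σ) / 2 ^ (σ / 2)) atTop atTop :=
      (tendsto_rpow_atTop (by linarith)).atTop_div_const (by positivity)
    exact tendsto_atTop_mono' _ (eventually_atTop.2 ⟨1, hlow⟩) hlim
  have hbot : Tendsto (velocityMap σ) atBot atBot := by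
    have := (tendsto_neg_atTop_atBot.comp (htop.comp tendsto_neg_atBot_atTop))
    refine this.congr fun u => ?_
    simp [hodd]
  exact ⟨hmono.injective, hcont.surjective htop hbot⟩

/-- The coefficient of the linearised equation is the constant matrix `(0, -1; -σ, 0)`. -/
theorem fuchsianB_zero {σ : ℝ} (h0 : 0 ≤ σ) (h1 : σ < 1) (t : ℝ) :
    fuchsianB σ t 0 = !![0, -1; -σ, 0] := by
  have h : velocityInv σ 0 = 0 := by
    have := Function.leftInverse_invFun (velocityMap_bijective h0 h1).1 0
    simpa [velocityInv, velocityMap] using this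
  simp [fuchsianB, h, matrixB]

/-! Put p = 3σ − 1 > 0 and a = t^(−p), so that a ≥ 1 on (0,1] and the coefficients of (1) are b_ij(a
w). The entries b_ij and all their derivatives are bounded functions of y = φ(u); the danger as t ↘
0 is that each x-derivative falling on b_ij(a w) costs a factor a. At the level of H^k the loss is
a^k = t^(−kp), and σ < (k+1)/(3k) says exactly that kp < 1, so that this loss is integrable at 0.
Everything is estimated backwards from t = 1, where the source (p/t)π^⊥W has a favourable sign.

Linearised equation. The energy σ‖z‖² + ‖w‖² of every x-derivative is nondecreasing in t, which
gives the bound and uniqueness. Existence comes from the explicit wave group together with a bounded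
linear ODE in log-time (`exists_solvesLinearised`).

Nonlinear equation. The system is symmetrised by diag(s(a w), 1) with s b₀₁ = b₁₀. Here s grows like
(1+u²)^(1−σ), so the energy is not bounded above by the H^k norm uniformly in t. Three pointwise
facts make the estimate close nevertheless. First, 2s − y s' ≥ 0 (`mul_deriv_symmetrizer_le`): the
singular term in ∂ₜ s(a w) is absorbed by the singular source. Second, s' and (s b₀₀)' are O(s)
(`exists_abs_deriv_le_symmetrizer`). Third, b_ij' is O(s^(−1/2)) (`weightedSymbol_deriv_coeffB`), so
commutators remain bounded after multiplication by √s (`WeightedSymbol.exists_iterDx_commutator`).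
These facts follow from a calculus of symbols in u in which d/dy lowers the order by 1 − σ. The
result is E' ≥ −C t^(−kp) E while ‖W‖ ≤ 1 (in integrated form, `exists_sobEnergy_le_add_integral`);
Grönwall and a continuity argument then keep small solutions of size O(δ)
(`exists_norm_le_of_nonlinear`).

The solution is C¹ in time only with values in H^(k−1). The top order energy is therefore computed
for difference quotients of ∂ₓ^(k−1)W, and the integrated inequality is passed to the limit by
dominated convergence.

Comparison. Since b(a w) − b(0) = O(a|w|), W solves (2) up to an error whose derivative of order ℓ
is O(a^(ℓ+1) δ²) (`exists_error_of_nonlinear`). For ℓ ≤ k − 1 this is integrable in time, and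
`constant_coeff_energy` bounds W − W̃ in H^(k−1). For the limits at t = 0, the derivatives of w have
integrable velocity, and those of z vanish because t^(−p) z converges. -/

noncomputable section

variable {L : ℝ} [Fact (0 < L)]

/-! ## Scalar `L²` and continuous functions on the circle -/

/-- Real-valued `L²` functions on the circle. -/
abbrev ScalarL2 (L : ℝ) [Fact (0 < L)] : Type := Lp ℝ 2 (volume : Measure (AddCircle L))

/-- Continuous real-valued functions on the circle. -/
abbrev CircleC (L : ℝ) : Type := C(AddCircle L, ℝ)

/-- The class in `L²` of a continuous function. -/
def toL2 : CircleC L →L[ℝ] ScalarL2 L := ContinuousMap.toLp 2 volume ℝ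

theorem toL2_ae (c : CircleC L) : (toL2 c : AddCircle L → ℝ) =ᵐ[volume] c :=
  ContinuousMap.coeFn_toLp volume c

theorem toL2_injective : Function.Injective (toL2 : CircleC L → ScalarL2 L) :=
  ContinuousMap.toLp_injective volume

/-- Multiplication of an `L²` function by a continuous function. -/
def cmul : CircleC L →L[ℝ] ScalarL2 L →L[ℝ] ScalarL2 L :=
  ((ContinuousLinearMap.mul ℝ ℝ).holderL (volume : Measure (AddCircle L)) ∞ 2 2).comp
    (ContinuousMap.toLp ∞ volume ℝ)

theorem cmul_ae (c : CircleC L) (f : ScalarL2 L) :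
    (cmul c f : AddCircle L → ℝ) =ᵐ[volume] fun x => c x * f x := by
  have h1 := (ContinuousLinearMap.mul ℝ ℝ).coeFn_holder (r := 2)
    (ContinuousMap.toLp ∞ (volume : Measure (AddCircle L)) ℝ c) f
  have h2 := ContinuousMap.coeFn_toLp (p := ∞) (𝕜 := ℝ) (volume : Measure (AddCircle L)) c
  filter_upwards [h1, h2] with x hx hx2
  rw [← hx2]
  exact hx

attribute [irreducible] cmul toL2

theorem norm_cmul_le (c : CircleC L) (f : ScalarL2 L) : ‖cmul c f‖ ≤ ‖c‖ * ‖f‖ := by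
  refine Lp.norm_le_mul_norm_of_ae_le_mul ?_
  filter_upwards [cmul_ae c f] with x hx
  rw [hx, norm_mul]
  gcongr
  exact c.norm_coe_le_norm x

theorem cmul_toL2 (c d : CircleC L) : cmul c (toL2 d) = toL2 (c * d) := by
  refine Lp.ext ?_
  filter_upwards [cmul_ae c (toL2 d), toL2_ae d, toL2_ae (c * d)] with x h1 h2 h3
  rw [h1, h2, h3]; rfl

theorem cmul_mul (c d : CircleC L) (f : ScalarL2 L) : cmul (c * d) f = cmul c (cmul d f) := by
  refine Lp.ext ?_
  filter_upwards [cmul_ae c (cmul d f), cmul_ae d f, cmul_ae (c * d) f] with x h1 h2 h3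
  rw [h1, h2, h3, ContinuousMap.mul_apply, mul_assoc]

theorem cmul_one (f : ScalarL2 L) : cmul 1 f = f := by
  refine Lp.ext ?_
  filter_upwards [cmul_ae 1 f] with x h1
  rw [h1]; simp

theorem inner_eq_integral (f g : ScalarL2 L) : inner ℝ f g = ∫ x, g x * f x := by
  rw [L2.inner_def]; rfl

theorem inner_cmul_left (c : CircleC L) (f g : ScalarL2 L) :
    inner ℝ (cmul c f) g = inner ℝ f (cmul c g) := by
  rw [inner_eq_integral, inner_eq_integral]
  refine integral_congr_ae ?_
  filter_upwards [cmul_ae c f, cmul_ae c g] with x h1 h2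
  rw [h1, h2]; ring

theorem inner_cmul_self_nonneg {c : CircleC L} (hc : ∀ x, 0 ≤ c x) (f : ScalarL2 L) :
    0 ≤ inner ℝ (cmul c f) f := by
  rw [inner_eq_integral]
  refine integral_nonneg_of_ae ?_
  filter_upwards [cmul_ae c f] with x h1
  rw [h1]
  have := mul_nonneg (hc x) (mul_self_nonneg (f x))
  simp only [Pi.zero_apply]
  linarith

theorem inner_cmul_self_mono {c d : CircleC L} (hc : ∀ x, c x ≤ d x) (f : ScalarL2 L) :
    inner ℝ (cmul c f) f ≤ inner ℝ (cmul d f) f := by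
  have h := inner_cmul_self_nonneg (c := d - c) (fun x => by simpa using hc x) f
  rw [map_sub, sub_apply, inner_sub_left] at h
  linarith

theorem norm_cmul_le_norm_cmul {c d : CircleC L} {M : ℝ} (hc : ∀ x, |c x| ≤ M * |d x|)
    (f : ScalarL2 L) : ‖cmul c f‖ ≤ M * ‖cmul d f‖ := by
  refine Lp.norm_le_mul_norm_of_ae_le_mul ?_
  filter_upwards [cmul_ae c f, cmul_ae d f] with x h1 h2
  rw [h1, h2, norm_mul, norm_mul, ← mul_assoc]
  gcongr
  exact hc x

theorem norm_cmul_le_of_le {c : CircleC L} {M : ℝ} (hc : ∀ x, |c x| ≤ M)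
    (f : ScalarL2 L) : ‖cmul c f‖ ≤ M * ‖f‖ := by
  have := norm_cmul_le_norm_cmul (c := c) (d := 1) (M := M) (fun x => by simpa using hc x) f
  rwa [cmul_one] at this

/-! ## Translations -/

/-- Translation of continuous functions. -/
def shiftC (h : ℝ) : CircleC L →L[ℝ] CircleC L :=
  LinearMap.mkContinuous
    { toFun := fun c => c.comp ⟨fun x => x + (h : AddCircle L), by fun_prop⟩
      map_add' := fun _ _ => rfl
      map_smul' := fun _ _ => rfl } 1 fun c => by
    rw [one_mul]
    exact (ContinuousMap.norm_le _ (norm_nonneg _)).2 fun x => c.norm_coe_le_norm _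

@[simp] theorem shiftC_apply (h : ℝ) (c : CircleC L) (x : AddCircle L) :
    shiftC h c x = c (x + (h : AddCircle L)) := rfl

theorem measurePreserving_shift (h : ℝ) :
    MeasurePreserving (fun x : AddCircle L => x + (h : AddCircle L)) volume volume :=
  measurePreserving_add_right volume _

/-- Translation of `L²` functions. -/
def shiftLp {E : Type*} [NormedAddCommGroup E] [NormedSpace ℝ E] (h : ℝ) :
    Lp E 2 (volume : Measure (AddCircle L)) →ₗᵢ[ℝ] Lp E 2 (volume : Measure (AddCircle L)) :=
  Lp.compMeasurePreservingₗᵢ ℝ (fun x => x + (h : AddCircle L)) (measurePreserving_shift h)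

section
variable {E : Type*} [NormedAddCommGroup E] [NormedSpace ℝ E]

theorem shiftLp_ae (h : ℝ) (f : Lp E 2 (volume : Measure (AddCircle L))) :
    (shiftLp h f : AddCircle L → E) =ᵐ[volume] fun x => f (x + (h : AddCircle L)) :=
  Lp.coeFn_compMeasurePreserving f (measurePreserving_shift h)

theorem shiftLp_zero (f : Lp E 2 (volume : Measure (AddCircle L))) : shiftLp 0 f = f := by
  refine Lp.ext ?_
  filter_upwards [shiftLp_ae 0 f] with x h1
  rw [h1]; simp

theorem shiftLp_add (a b : ℝ) (f : Lp E 2 (volume : Measure (AddCircle L))) :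
    shiftLp (a + b) f = shiftLp a (shiftLp b f) := by
  refine Lp.ext ?_
  filter_upwards [shiftLp_ae (a + b) f, shiftLp_ae a (shiftLp b f),
    (measurePreserving_shift a).quasiMeasurePreserving.ae (shiftLp_ae b f)] with x h1 h2 h3
  rw [h1, h2, h3, AddCircle.coe_add, add_assoc]

theorem continuous_shiftLp (f : Lp E 2 (volume : Measure (AddCircle L))) :
    Continuous fun h : ℝ => shiftLp h f := by
  have hg : Continuous fun h : ℝ =>
      (⟨fun x => x + (h : AddCircle L), by fun_prop⟩ : C(AddCircle L, AddCircle L)) := by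
    refine ContinuousMap.continuous_of_continuous_uncurry _ ?_
    have : Continuous fun p : ℝ × AddCircle L => p.2 + ((p.1 : ℝ) : AddCircle L) :=
      continuous_snd.add ((AddCircle.continuous_mk' L).comp continuous_fst)
    exact this
  exact Continuous.compMeasurePreservingLp (f := fun _ : ℝ => f) continuous_const hg
    (fun h => measurePreserving_shift h) (by norm_num)

end

theorem shiftLp_toL2 (h : ℝ) (c : CircleC L) : shiftLp h (toL2 c) = toL2 (shiftC h c) := by
  refine Lp.ext ?_
  filter_upwards [shiftLp_ae h (toL2 c), toL2_ae (shiftC h c),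
    (measurePreserving_shift h).quasiMeasurePreserving.ae (toL2_ae c)] with x h1 h2 h3
  rw [h1, h2, h3]; rfl

theorem shiftLp_cmul (h : ℝ) (c : CircleC L) (f : ScalarL2 L) :
    shiftLp h (cmul c f) = cmul (shiftC h c) (shiftLp h f) := by
  refine Lp.ext ?_
  filter_upwards [shiftLp_ae h (cmul c f), shiftLp_ae h f, cmul_ae (shiftC h c) (shiftLp h f),
    (measurePreserving_shift h).quasiMeasurePreserving.ae (cmul_ae c f)] with x h1 h2 h3 h4
  rw [h1, h4, h3, h2]; rfl

theorem shiftC_zero (c : CircleC L) : shiftC 0 c = c := by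
  ext x; simp

theorem shiftC_add (a b : ℝ) (c : CircleC L) : shiftC (a + b) c = shiftC a (shiftC b c) := by
  ext x; simp [add_assoc]

theorem norm_shiftC (h : ℝ) (c : CircleC L) : ‖shiftC h c‖ = ‖c‖ := by
  have h1 : ∀ (h : ℝ) (c : CircleC L), ‖shiftC h c‖ ≤ ‖c‖ := fun h c =>
    (ContinuousMap.norm_le _ (norm_nonneg _)).2 fun x => c.norm_coe_le_norm _
  refine le_antisymm (h1 h c) ?_
  have := h1 (-h) (shiftC h c)
  rwa [← shiftC_add, neg_add_cancel, shiftC_zero] at this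

theorem continuous_shiftC (c : CircleC L) : Continuous fun h : ℝ => shiftC h c := by
  refine ContinuousMap.continuous_of_continuous_uncurry _ ?_
  have : Continuous fun p : ℝ × AddCircle L => c (p.2 + ((p.1 : ℝ) : AddCircle L)) :=
    c.continuous.comp (continuous_snd.add ((AddCircle.continuous_mk' L).comp continuous_fst))
  exact this

end

noncomputable section

variable {L : ℝ} [Fact (0 < L)]

set_option linter.unusedSectionVars false

/-! ## The Sobolev space `H¹` of scalar functions, as a relation -/

/-- Pairs `(v, v')` with `v` smooth on the circle. -/
def smoothGraph (L : ℝ) [Fact (0 < L)] : Submodule ℝ (ScalarL2 L × ScalarL2 L) where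
  carrier := {p | ∃ c d : CircleC L, ContDiff ℝ ∞ (fun s : ℝ => c (s : AddCircle L)) ∧
    (∀ s : ℝ, HasDerivAt (fun s : ℝ => c (s : AddCircle L)) (d (s : AddCircle L)) s) ∧
    p = (toL2 c, toL2 d)}
  add_mem' := by
    rintro _ _ ⟨c, d, h1, h2, rfl⟩ ⟨c', d', h1', h2', rfl⟩
    exact ⟨c + c', d + d', h1.add h1', fun s => (h2 s).add (h2' s), by simp⟩
  zero_mem' := ⟨0, 0, contDiff_const, fun s => by simpa using hasDerivAt_const s (0 : ℝ), by simp; rfl⟩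
  smul_mem' := by
    rintro a _ ⟨c, d, h1, h2, rfl⟩
    exact ⟨a • c, a • d, contDiff_const.mul h1, fun s => (h2 s).const_mul a, by simp⟩

/-- `f ∈ H¹` with weak derivative `g`. -/
def InH1 (f g : ScalarL2 L) : Prop := (f, g) ∈ (smoothGraph L).topologicalClosure

theorem InH1.add {f g f' g' : ScalarL2 L} (h : InH1 f g) (h' : InH1 f' g') :
    InH1 (f + f') (g + g') := Submodule.add_mem _ h h'

theorem InH1.smul {f g : ScalarL2 L} (a : ℝ) (h : InH1 f g) : InH1 (a • f) (a • g) :=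
  Submodule.smul_mem _ a h

theorem InH1.sub {f g f' g' : ScalarL2 L} (h : InH1 f g) (h' : InH1 f' g') :
    InH1 (f - f') (g - g') := Submodule.sub_mem _ h h'

theorem InH1.zero : InH1 (0 : ScalarL2 L) 0 := Submodule.zero_mem _

theorem InH1.of_tendsto {ι : Type*} {l : Filter ι} [l.NeBot] {f g : ι → ScalarL2 L}
    {f₀ g₀ : ScalarL2 L} (hf : Tendsto f l (𝓝 f₀)) (hg : Tendsto g l (𝓝 g₀))
    (h : ∀ i, InH1 (f i) (g i)) : InH1 f₀ g₀ :=
  (Submodule.isClosed_topologicalClosure (smoothGraph L)).mem_of_tendsto (hf.prodMk_nhds hg)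
    (Eventually.of_forall h)

theorem continuous_lift (c : CircleC L) : Continuous fun s : ℝ => c (s : AddCircle L) :=
  c.continuous.comp (AddCircle.continuous_mk' L)

theorem norm_toL2_sq (c : CircleC L) (a : ℝ) :
    ‖toL2 c‖ ^ 2 = ∫ s in a..a + L, c (s : AddCircle L) ^ 2 := by
  rw [AddCircle.intervalIntegral_preimage L a (fun x => c x ^ 2), ← real_inner_self_eq_norm_sq,
    inner_eq_integral]
  refine integral_congr_ae ?_
  filter_upwards [toL2_ae c] with x hx
  rw [hx]; ring

/-- This is the Cauchy–Schwarz inequality against the constant 1, read off from ∫ (f − m)² ≥ 0 with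
m the mean of f. -/
theorem sq_integral_le {f : ℝ → ℝ} (hf : Continuous f) {a h : ℝ} (hh : 0 ≤ h) :
    (∫ s in a..a + h, f s) ^ 2 ≤ h * ∫ s in a..a + h, f s ^ 2 := by
  rcases hh.eq_or_lt with rfl | hpos
  · simp
  set m := (∫ s in a..a + h, f s) / h with hm
  have h0 : 0 ≤ ∫ s in a..a + h, (f s - m) ^ 2 :=
    intervalIntegral.integral_nonneg (by linarith) fun s _ => sq_nonneg _
  have h1 : ∫ s in a..a + h, (f s - m) ^ 2 =
      (∫ s in a..a + h, f s ^ 2) - 2 * m * (∫ s in a..a + h, f s) + h * m ^ 2 := by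
    have : ∀ s, (f s - m) ^ 2 = f s ^ 2 - 2 * m * f s + m ^ 2 := fun s => by ring
    simp only [this]
    rw [intervalIntegral.integral_add, intervalIntegral.integral_sub,
      intervalIntegral.integral_const_mul, intervalIntegral.integral_const]
    · simp
    all_goals exact Continuous.intervalIntegrable (by fun_prop) _ _
  have h2 : (∫ s in a..a + h, f s) = m * h := by rw [hm]; field_simp
  rw [h1] at h0
  rw [h2] at h0 ⊢
  nlinarith

/-- Hölder estimate for smooth functions. -/
theorem smooth_sub_sq_le {c d : CircleC L}
    (hd : ∀ s : ℝ, HasDerivAt (fun s : ℝ => c (s : AddCircle L)) (d (s : AddCircle L)) s)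
    {a h : ℝ} (hh : 0 ≤ h) (hL : h ≤ L) :
    (c ((a + h : ℝ) : AddCircle L) - c (a : AddCircle L)) ^ 2 ≤ h * ‖toL2 d‖ ^ 2 := by
  have h1 := intervalIntegral.integral_eq_sub_of_hasDerivAt (a := a) (b := a + h)
    (fun s _ => hd s) ((continuous_lift d).intervalIntegrable _ _)
  rw [← h1]
  refine (sq_integral_le (continuous_lift d) hh).trans ?_
  rw [norm_toL2_sq d a]
  gcongr
  refine intervalIntegral.integral_mono_interval le_rfl (by linarith) (by linarith) ?_ ?_
  · exact Eventually.of_forall fun s => sq_nonneg _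
  · exact Continuous.intervalIntegrable (by have := continuous_lift d; fun_prop) _ _

/-- Lifting to a shortest arc turns estimates on the circle into integrals over an interval of
length `dist x y`. Which point comes first depends on the sign of the signed distance, hence the
disjunction. -/
theorem exists_lift_shift (x y : AddCircle L) :
    ∃ a h : ℝ, 0 ≤ h ∧ h = dist x y ∧ h ≤ L ∧
      ((x = a ∧ y = (a + h : ℝ)) ∨ (y = a ∧ x = (a + h : ℝ))) := by
  have hL : (0 : ℝ) < L := Fact.out
  obtain ⟨a, rfl⟩ := QuotientAddGroup.mk_surjective x
  obtain ⟨b, rfl⟩ := QuotientAddGroup.mk_surjective y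
  have hn : dist ((a : ℝ) : AddCircle L) ((b : ℝ) : AddCircle L) =
      |(b - a) - round (L⁻¹ * (b - a)) * L| := by
    rw [dist_comm, dist_eq_norm, ← AddCircle.coe_sub, AddCircle.norm_eq]
  set r := (b - a) - round (L⁻¹ * (b - a)) * L with hr
  have hr' : ((a + r : ℝ) : AddCircle L) = (b : AddCircle L) := by
    have : (a + r : ℝ) = b - (round (L⁻¹ * (b - a)) : ℤ) • L := by
      rw [hr]; simp; ring
    rw [this, AddCircle.coe_sub]
    rw [AddCircle.coe_zsmul, AddCircle.coe_period]; simp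
  have hle : |r| ≤ L := by
    have := AddCircle.norm_le_half_period L hL.ne' (x := ((b - a : ℝ) : AddCircle L))
    rw [AddCircle.norm_eq, ← hr, abs_of_pos hL] at this
    linarith
  refine ⟨if 0 ≤ r then a else b, |r|, abs_nonneg _, hn.symm, hle, ?_⟩
  split_ifs with h0
  · left
    refine ⟨rfl, ?_⟩
    rw [abs_of_nonneg h0]; exact hr'.symm
  · right
    refine ⟨rfl, ?_⟩
    rw [abs_of_neg (not_le.1 h0), AddCircle.coe_add, ← hr', ← AddCircle.coe_add]
    congr 1; ring

theorem smooth_holder {c d : CircleC L}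
    (hd : ∀ s : ℝ, HasDerivAt (fun s : ℝ => c (s : AddCircle L)) (d (s : AddCircle L)) s)
    (x y : AddCircle L) : (c x - c y) ^ 2 ≤ dist x y * ‖toL2 d‖ ^ 2 := by
  obtain ⟨a, h, h0, hd', hL, ⟨rfl, rfl⟩ | ⟨rfl, rfl⟩⟩ := exists_lift_shift x y
  · rw [← hd', ← neg_sq, neg_sub]
    exact smooth_sub_sq_le hd h0 hL
  · rw [← hd']
    exact smooth_sub_sq_le hd h0 hL

theorem dist_le_period (x y : AddCircle L) : dist x y ≤ L := by
  obtain ⟨a, h, h0, hd', hL, -⟩ := exists_lift_shift x y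
  rwa [← hd']

/-- The constant of the embedding `H¹ ⊆ C⁰`. -/
def supConst (L : ℝ) : ℝ := √(2 / L + 2 * L)

/-- The Hölder bound gives c(x)² ≤ 2c(y)² + 2L‖d‖² for all y. Averaging over y yields the square of
`supConst`, namely 2/L + 2L. -/
theorem smooth_sup {c d : CircleC L}
    (hd : ∀ s : ℝ, HasDerivAt (fun s : ℝ => c (s : AddCircle L)) (d (s : AddCircle L)) s) :
    ‖c‖ ≤ supConst L * (‖toL2 c‖ + ‖toL2 d‖) := by
  have hL : (0 : ℝ) < L := Fact.out
  refine (ContinuousMap.norm_le _ (by unfold supConst; positivity)).2 fun x => ?_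
  have h1 : ∀ y, c x ^ 2 ≤ 2 * c y ^ 2 + 2 * (L * ‖toL2 d‖ ^ 2) := fun y => by
    have h2 := smooth_holder hd x y
    have h3 := mul_le_mul_of_nonneg_right (dist_le_period x y) (sq_nonneg ‖toL2 d‖)
    nlinarith [sq_nonneg (c x - 2 * c y)]
  have h2 : ∫ s in (0 : ℝ)..0 + L, c x ^ 2 ≤
      ∫ s in (0 : ℝ)..0 + L, (2 * c (s : AddCircle L) ^ 2 + 2 * (L * ‖toL2 d‖ ^ 2)) := by
    refine intervalIntegral.integral_mono_on (by linarith) (by simp) ?_ fun s _ => h1 s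
    exact Continuous.intervalIntegrable (by have := continuous_lift c; fun_prop) _ _
  rw [intervalIntegral.integral_add, intervalIntegral.integral_const_mul, ← norm_toL2_sq c 0] at h2
  · simp only [zero_add, intervalIntegral.integral_const, sub_zero, smul_eq_mul] at h2
    have h3 : c x ^ 2 ≤ (2 / L + 2 * L) * (‖toL2 c‖ + ‖toL2 d‖) ^ 2 := by
      have h4 : c x ^ 2 ≤ 2 / L * ‖toL2 c‖ ^ 2 + 2 * L * ‖toL2 d‖ ^ 2 := by
        have : c x ^ 2 = L * c x ^ 2 / L := by field_simp
        rw [this, div_le_iff₀ hL]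
        refine h2.trans (le_of_eq ?_)
        field_simp
      have h5 := norm_nonneg (toL2 c)
      have h6 := norm_nonneg (toL2 d)
      have h7 : (0 : ℝ) < 2 / L := by positivity
      nlinarith [mul_nonneg h5 h6, mul_nonneg h7.le (sq_nonneg ‖toL2 d‖),
        mul_nonneg hL.le (sq_nonneg ‖toL2 c‖), mul_nonneg h7.le (mul_nonneg h5 h6),
        mul_nonneg hL.le (mul_nonneg h5 h6)]
    rw [supConst, Real.norm_eq_abs, ← Real.sqrt_sq (add_nonneg (norm_nonneg (toL2 c))
      (norm_nonneg (toL2 d))), ← Real.sqrt_mul (by positivity), ← Real.sqrt_sq_eq_abs]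
    exact Real.sqrt_le_sqrt h3
  · exact Continuous.intervalIntegrable (by have := continuous_lift c; fun_prop) _ _
  · simp

theorem supConst_nonneg (L : ℝ) : 0 ≤ supConst L := Real.sqrt_nonneg _

/-- Approximation of `H¹` functions by smooth functions, uniformly and in `H¹`. -/
theorem InH1.exists_approx {f g : ScalarL2 L} (h : InH1 f g) :
    ∃ (c : CircleC L) (cn dn : ℕ → CircleC L), toL2 c = f ∧ Tendsto cn atTop (𝓝 c) ∧
      Tendsto (fun n => toL2 (dn n)) atTop (𝓝 g) ∧
      (∀ n, ContDiff ℝ ∞ (fun s : ℝ => cn n (s : AddCircle L))) ∧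
      ∀ n, ∀ s : ℝ, HasDerivAt (fun s : ℝ => cn n (s : AddCircle L)) (dn n (s : AddCircle L)) s := by
  obtain ⟨u, hu, hlim⟩ := mem_closure_iff_seq_limit.1 h
  choose cn dn h1 h2 h3 using hu
  have hf : Tendsto (fun n => toL2 (cn n)) atTop (𝓝 f) :=
    ((continuous_fst.tendsto _).comp hlim).congr fun n => by simp [h3]
  have hg : Tendsto (fun n => toL2 (dn n)) atTop (𝓝 g) :=
    ((continuous_snd.tendsto _).comp hlim).congr fun n => by simp [h3]
  -- The sup bound on differences upgrades convergence in H¹ to uniform convergence.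
  have hb : ∀ m n, ‖cn m - cn n‖ ≤
      supConst L * (‖toL2 (cn m) - toL2 (cn n)‖ + ‖toL2 (dn m) - toL2 (dn n)‖) := fun m n => by
    rw [← map_sub, ← map_sub]
    exact smooth_sup fun s => (h2 m s).sub (h2 n s)
  have hC : CauchySeq cn := by
    have e1 := hf.cauchySeq
    have e2 := hg.cauchySeq
    rw [Metric.cauchySeq_iff] at e1 e2 ⊢
    intro ε hε
    have hpos : 0 < supConst L + 1 := by linarith [supConst_nonneg L]
    obtain ⟨N1, hN1⟩ := e1 (ε / (2 * (supConst L + 1))) (by positivity)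
    obtain ⟨N2, hN2⟩ := e2 (ε / (2 * (supConst L + 1))) (by positivity)
    refine ⟨max N1 N2, fun m hm n hn => ?_⟩
    have a1 := hN1 m (le_trans (le_max_left _ _) hm) n (le_trans (le_max_left _ _) hn)
    have a2 := hN2 m (le_trans (le_max_right _ _) hm) n (le_trans (le_max_right _ _) hn)
    rw [dist_eq_norm] at a1 a2 ⊢
    have a3 : (supConst L + 1) * (ε / (2 * (supConst L + 1))) = ε / 2 := by field_simp
    have h0 := norm_nonneg (toL2 (cn m) - toL2 (cn n))
    have h0' := norm_nonneg (toL2 (dn m) - toL2 (dn n))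
    calc ‖cn m - cn n‖ ≤ supConst L * (‖toL2 (cn m) - toL2 (cn n)‖ + ‖toL2 (dn m) - toL2 (dn n)‖) :=
          hb m n
      _ ≤ (supConst L + 1) * (‖toL2 (cn m) - toL2 (cn n)‖ + ‖toL2 (dn m) - toL2 (dn n)‖) := by
          gcongr; linarith
      _ < (supConst L + 1) * (ε / (2 * (supConst L + 1)) + ε / (2 * (supConst L + 1))) := by
          gcongr
      _ = ε := by rw [mul_add, a3]; ring
  obtain ⟨c, hc⟩ := cauchySeq_tendsto_of_complete hC
  refine ⟨c, cn, dn, ?_, hc, hg, h1, h2⟩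
  exact tendsto_nhds_unique ((toL2.continuous.tendsto c).comp hc) hf

theorem InH1.exists_toL2 {f g : ScalarL2 L} (h : InH1 f g) : ∃ c : CircleC L, toL2 c = f := by
  obtain ⟨c, -, -, hc, -⟩ := h.exists_approx
  exact ⟨c, hc⟩

theorem InH1.approx {c : CircleC L} {g : ScalarL2 L} (h : InH1 (toL2 c) g) :
    ∃ (cn dn : ℕ → CircleC L), Tendsto cn atTop (𝓝 c) ∧
      Tendsto (fun n => toL2 (dn n)) atTop (𝓝 g) ∧
      (∀ n, ContDiff ℝ ∞ (fun s : ℝ => cn n (s : AddCircle L))) ∧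
      ∀ n, ∀ s : ℝ, HasDerivAt (fun s : ℝ => cn n (s : AddCircle L)) (dn n (s : AddCircle L)) s := by
  obtain ⟨c', cn, dn, hc, h'⟩ := h.exists_approx
  obtain rfl := toL2_injective hc
  exact ⟨cn, dn, h'⟩

theorem InH1.of_smooth {c d : CircleC L} (h1 : ContDiff ℝ ∞ (fun s : ℝ => c (s : AddCircle L)))
    (h2 : ∀ s : ℝ, HasDerivAt (fun s : ℝ => c (s : AddCircle L)) (d (s : AddCircle L)) s) :
    InH1 (toL2 c) (toL2 d) := Submodule.le_topologicalClosure _ ⟨c, d, h1, h2, rfl⟩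

theorem InH1.norm_le {c : CircleC L} {g : ScalarL2 L} (h : InH1 (toL2 c) g) :
    ‖c‖ ≤ supConst L * (‖toL2 c‖ + ‖g‖) := by
  obtain ⟨cn, dn, h1, h2, -, h4⟩ := h.approx
  refine le_of_tendsto_of_tendsto h1.norm
    (((((toL2.continuous.tendsto c).comp h1).norm).add h2.norm).const_mul (supConst L)) ?_
  exact Eventually.of_forall fun n => smooth_sup (h4 n)

theorem InH1.holder {c : CircleC L} {g : ScalarL2 L} (h : InH1 (toL2 c) g) (x y : AddCircle L) :
    (c x - c y) ^ 2 ≤ dist x y * ‖g‖ ^ 2 := by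
  obtain ⟨cn, dn, h1, h2, -, h4⟩ := h.approx
  have hev : ∀ x, Tendsto (fun n => cn n x) atTop (𝓝 (c x)) := fun x =>
    ((continuous_eval_const x).tendsto c).comp h1
  refine le_of_tendsto_of_tendsto (((hev x).sub (hev y)).pow 2) ((h2.norm.pow 2).const_mul _) ?_
  exact Eventually.of_forall fun n => smooth_holder (h4 n) x y

theorem tendsto_cmul {ι : Type*} {l : Filter ι} {a : ι → CircleC L} {f : ι → ScalarL2 L}
    {a₀ : CircleC L} {f₀ : ScalarL2 L} (ha : Tendsto a l (𝓝 a₀)) (hf : Tendsto f l (𝓝 f₀)) :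
    Tendsto (fun i => cmul (a i) (f i)) l (𝓝 (cmul a₀ f₀)) := by
  have h : Continuous fun p : CircleC L × ScalarL2 L => cmul p.1 p.2 :=
    (cmul.continuous.comp continuous_fst).clm_apply continuous_snd
  exact (h.tendsto (a₀, f₀)).comp (ha.prodMk_nhds hf)

theorem InH1.mul {c d : CircleC L} {f g : ScalarL2 L} (hc : InH1 (toL2 c) f)
    (hd : InH1 (toL2 d) g) : InH1 (toL2 (c * d)) (cmul c g + cmul d f) := by
  obtain ⟨cn, c'n, h1, h2, h3, h4⟩ := hc.approx
  obtain ⟨dn, d'n, k1, k2, k3, k4⟩ := hd.approx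
  have e1 : Tendsto (fun n => toL2 (cn n * dn n)) atTop (𝓝 (toL2 (c * d))) :=
    (toL2.continuous.tendsto _).comp (h1.mul k1)
  have e2 : Tendsto (fun n => cmul (cn n) (toL2 (d'n n)) + cmul (dn n) (toL2 (c'n n))) atTop
      (𝓝 (cmul c g + cmul d f)) :=
    (tendsto_cmul h1 k2).add (tendsto_cmul k1 h2)
  refine InH1.of_tendsto e1 e2 fun n => ?_
  rw [cmul_toL2, cmul_toL2, ← map_add]
  refine InH1.of_smooth ((h3 n).mul (k3 n)) fun s => ?_
  refine ((h4 n s).mul (k4 n s)).congr_deriv ?_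
  change _ = cn n s * d'n n s + dn n s * c'n n s
  ring

/-- Composition with a continuous function of one variable. -/
def compC (b : ℝ → ℝ) (hb : Continuous b) (c : CircleC L) : CircleC L := ⟨fun x => b (c x), by fun_prop⟩

@[simp] theorem compC_apply (b : ℝ → ℝ) (hb : Continuous b) (c : CircleC L) (x : AddCircle L) :
    compC b hb c x = b (c x) := rfl

theorem continuous_compC (b : ℝ → ℝ) (hb : Continuous b) :
    Continuous (compC b hb : CircleC L → CircleC L) :=
  ContinuousMap.continuous_postcomp (⟨b, hb⟩ : C(ℝ, ℝ))

theorem InH1.comp {b b' : ℝ → ℝ} (hb : ContDiff ℝ ∞ b) (hb' : Continuous b')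
    (hd : ∀ y, HasDerivAt b (b' y) y) {c : CircleC L} {g : ScalarL2 L} (hc : InH1 (toL2 c) g) :
    InH1 (toL2 (compC b hb.continuous c)) (cmul (compC b' hb' c) g) := by
  obtain ⟨cn, dn, h1, h2, h3, h4⟩ := hc.approx
  have e1 : Tendsto (fun n => toL2 (compC b hb.continuous (cn n))) atTop
      (𝓝 (toL2 (compC b hb.continuous c))) :=
    (toL2.continuous.tendsto _).comp (((continuous_compC b hb.continuous).tendsto _).comp h1)
  have e2 : Tendsto (fun n => cmul (compC b' hb' (cn n)) (toL2 (dn n))) atTop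
      (𝓝 (cmul (compC b' hb' c) g)) :=
    tendsto_cmul (((continuous_compC b' hb').tendsto _).comp h1) h2
  refine InH1.of_tendsto e1 e2 fun n => ?_
  rw [cmul_toL2]
  exact InH1.of_smooth (hb.comp (h3 n)) fun s => (hd _).comp s (h4 n s)

end

noncomputable section

variable {L : ℝ} [Fact (0 < L)]

set_option linter.unusedSectionVars false

/-! ## Translations and weak derivatives -/

theorem shiftC_eq_add_integral_of_hasDerivAt {c d : CircleC L}
    (hd : ∀ s : ℝ, HasDerivAt (fun s : ℝ => c (s : AddCircle L)) (d (s : AddCircle L)) s) (h : ℝ) :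
    shiftC h c = c + ∫ s in (0 : ℝ)..h, shiftC s d := by
  ext x
  obtain ⟨a, rfl⟩ := QuotientAddGroup.mk_surjective x
  have h1 := (ContinuousMap.evalCLM ℝ ((a : ℝ) : AddCircle L)).intervalIntegral_comp_comm
    (μ := volume) ((continuous_shiftC d).intervalIntegrable 0 h)
  have h2 : (∫ s in (0 : ℝ)..h, shiftC s d) ((a : ℝ) : AddCircle L) =
      ∫ s in (0 : ℝ)..h, d ((a + s : ℝ) : AddCircle L) := by
    refine Eq.trans h1.symm ?_
    refine intervalIntegral.integral_congr fun s _ => ?_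
    simp
  have h3 := intervalIntegral.integral_eq_sub_of_hasDerivAt (a := 0) (b := h)
    (f := fun s : ℝ => c ((a + s : ℝ) : AddCircle L)) (f' := fun s => d ((a + s : ℝ) : AddCircle L))
    (fun s _ => (hd (a + s)).comp_const_add a s)
    (((continuous_lift d).comp (by fun_prop : Continuous fun s : ℝ => a + s)).intervalIntegrable _ _)
  change c ((a : AddCircle L) + (h : AddCircle L)) = c (a : AddCircle L) + _
  erw [h2]
  rw [h3]
  simp

/-- The fundamental theorem of calculus along translations passes to the H¹ limit because
translations are isometries. It makes a weak derivative the genuine derivative of the orbit h ↦ f(·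
+ h) in L², which is the source of uniqueness, of the difference quotient bounds and of integration
by parts. -/
theorem shiftLp_eq_add_integral {f g : ScalarL2 L} (hf : InH1 f g) (h : ℝ) :
    shiftLp h f = f + ∫ s in (0 : ℝ)..h, shiftLp s g := by
  obtain ⟨c, cn, dn, rfl, h1, h2, -, h4⟩ := hf.exists_approx
  have e0 : Tendsto (fun n => toL2 (cn n)) atTop (𝓝 (toL2 c)) := (toL2.continuous.tendsto c).comp h1
  have e1 : Tendsto (fun n => shiftLp h (toL2 (cn n))) atTop (𝓝 (shiftLp h (toL2 c))) :=
    ((shiftLp h).continuous.tendsto _).comp e0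
  have e2 : Tendsto (fun n => ∫ s in (0 : ℝ)..h, shiftLp s (toL2 (dn n))) atTop
      (𝓝 (∫ s in (0 : ℝ)..h, shiftLp s g)) := by
    rw [tendsto_iff_norm_sub_tendsto_zero] at h2 ⊢
    refine squeeze_zero (fun _ => norm_nonneg _) (fun n => ?_)
      (by simpa using h2.mul_const |h|)
    rw [← intervalIntegral.integral_sub ((continuous_shiftLp _).intervalIntegrable _ _)
      ((continuous_shiftLp _).intervalIntegrable _ _)]
    refine (intervalIntegral.norm_integral_le_of_norm_le_const fun s _ => ?_).trans_eq
      (by rw [sub_zero])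
    rw [← map_sub, (shiftLp s).norm_map]
  refine tendsto_nhds_unique e1 ((e0.add e2).congr fun n => ?_)
  rw [shiftLp_toL2, shiftC_eq_add_integral_of_hasDerivAt (h4 n) h, map_add]
  congr 1
  rw [← toL2.intervalIntegral_comp_comm ((continuous_shiftC (dn n)).intervalIntegrable 0 h)]
  exact intervalIntegral.integral_congr fun s _ => shiftLp_toL2 s (dn n)

theorem InH1.hasDerivAt_shift {f g : ScalarL2 L} (hf : InH1 f g) (h : ℝ) :
    HasDerivAt (fun h : ℝ => shiftLp h f) (shiftLp h g) h := by
  have h1 := ((continuous_shiftLp g).integral_hasStrictDerivAt 0 h).hasDerivAt.const_add f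
  exact h1.congr_of_eventuallyEq (Eventually.of_forall fun h => shiftLp_eq_add_integral hf h)

theorem InH1.norm_shift_sub_le {f g : ScalarL2 L} (hf : InH1 f g) (h : ℝ) :
    ‖shiftLp h f - f‖ ≤ |h| * ‖g‖ := by
  rw [shiftLp_eq_add_integral hf, add_sub_cancel_left]
  refine (intervalIntegral.norm_integral_le_of_norm_le_const (C := ‖g‖) fun s _ => ?_).trans_eq
      (by rw [sub_zero, mul_comm])
  rw [(shiftLp s).norm_map]

/-- Both candidates are the derivative at 0 of the same translation orbit. -/
theorem InH1.unique {f g g' : ScalarL2 L} (h : InH1 f g) (h' : InH1 f g') : g = g' := by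
  have := (h.hasDerivAt_shift 0).unique (h'.hasDerivAt_shift 0)
  rwa [shiftLp_zero, shiftLp_zero] at this

theorem shiftC_eq_add_integral {c d : CircleC L} (hc : InH1 (toL2 c) (toL2 d)) (h : ℝ) :
    shiftC h c = c + ∫ s in (0 : ℝ)..h, shiftC s d := by
  apply toL2_injective
  rw [← shiftLp_toL2, shiftLp_eq_add_integral hc, map_add,
    ← toL2.intervalIntegral_comp_comm ((continuous_shiftC d).intervalIntegrable 0 h)]
  congr 1
  exact intervalIntegral.integral_congr fun s _ => shiftLp_toL2 s d

theorem InH1.hasDerivAt_shiftC {c d : CircleC L} (hc : InH1 (toL2 c) (toL2 d)) (h : ℝ) :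
    HasDerivAt (fun h : ℝ => shiftC h c) (shiftC h d) h := by
  have h1 := ((continuous_shiftC d).integral_hasStrictDerivAt 0 h).hasDerivAt.const_add c
  exact h1.congr_of_eventuallyEq (Eventually.of_forall fun h => shiftC_eq_add_integral hc h)

theorem InH1.hasDerivAt_lift {c d : CircleC L} (hc : InH1 (toL2 c) (toL2 d)) (s : ℝ) :
    HasDerivAt (fun s : ℝ => c (s : AddCircle L)) (d (s : AddCircle L)) s := by
  have h := (ContinuousMap.evalCLM ℝ (0 : AddCircle L)).hasFDerivAt.comp_hasDerivAt s
    (hc.hasDerivAt_shiftC s)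
  refine (h.congr_deriv ?_).congr_of_eventuallyEq (Eventually.of_forall fun r => ?_)
  · change d (0 + s) = d s
    rw [zero_add]
  · change c r = c (0 + r)
    rw [zero_add]

theorem InH1.norm_shiftC_sub_le {c d : CircleC L} (hc : InH1 (toL2 c) (toL2 d)) (h : ℝ) :
    ‖shiftC h c - c‖ ≤ |h| * ‖d‖ := by
  rw [shiftC_eq_add_integral hc, add_sub_cancel_left]
  refine (intervalIntegral.norm_integral_le_of_norm_le_const (C := ‖d‖) fun s _ => ?_).trans_eq
      (by rw [sub_zero, mul_comm])
  rw [norm_shiftC]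

theorem InH1.shift {f g : ScalarL2 L} (hf : InH1 f g) (h : ℝ) :
    InH1 (shiftLp h f) (shiftLp h g) := by
  obtain ⟨c, cn, dn, rfl, h1, h2, h3, h4⟩ := hf.exists_approx
  refine InH1.of_tendsto (((shiftLp h).continuous.tendsto _).comp
    ((toL2.continuous.tendsto c).comp h1)) (((shiftLp h).continuous.tendsto _).comp h2) fun n => ?_
  change InH1 (shiftLp h (toL2 (cn n))) (shiftLp h (toL2 (dn n)))
  rw [shiftLp_toL2, shiftLp_toL2]
  refine InH1.of_smooth ?_ fun s => ?_
  · have : (fun s : ℝ => shiftC h (cn n) (s : AddCircle L)) =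
        (fun s : ℝ => cn n (s : AddCircle L)) ∘ fun s : ℝ => s + h := by
      funext s; simp
    rw [this]
    exact (h3 n).comp (contDiff_id.add contDiff_const)
  · exact ((h4 n (s + h)).comp_add_const s h).congr_of_eventuallyEq
      (Eventually.of_forall fun r => by simp)|>.congr_deriv (by simp)

/-! ## Difference quotients -/

/-- The difference quotient of an `L²` function. -/
def diffQuot (h : ℝ) : ScalarL2 L →L[ℝ] ScalarL2 L :=
  h⁻¹ • ((shiftLp h).toContinuousLinearMap - ContinuousLinearMap.id ℝ _)

theorem diffQuot_apply (h : ℝ) (f : ScalarL2 L) : diffQuot h f = h⁻¹ • (shiftLp h f - f) := rfl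

/-- The difference quotient of a continuous function. -/
def diffQuotC (h : ℝ) (c : CircleC L) : CircleC L := h⁻¹ • (shiftC h c - c)

theorem diffQuot_cmul (h : ℝ) (c : CircleC L) (f : ScalarL2 L) :
    diffQuot h (cmul c f) = cmul c (diffQuot h f) + cmul (diffQuotC h c) (shiftLp h f) := by
  rw [diffQuot_apply, diffQuot_apply, diffQuotC, shiftLp_cmul, map_smul, map_smul, map_sub, map_sub,
    smul_apply, sub_apply, ← smul_add]
  congr 1
  abel

theorem InH1.diffQuot {f g : ScalarL2 L} (hf : InH1 f g) (h : ℝ) :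
    InH1 (diffQuot h f) (diffQuot h g) := ((hf.shift h).sub hf).smul h⁻¹

/-- The value h = 0 is covered by 0⁻¹ = 0, so the bounds on difference quotients hold for every h.
-/
theorem abs_inv_mul_abs_le (h : ℝ) {a : ℝ} (ha : 0 ≤ a) : |h⁻¹| * (|h| * a) ≤ a := by
  rcases eq_or_ne h 0 with rfl | hh
  · simpa
  · rw [← mul_assoc, ← abs_mul, inv_mul_cancel₀ hh, abs_one, one_mul]

theorem InH1.norm_diffQuot_le {f g : ScalarL2 L} (hf : InH1 f g) (h : ℝ) :
    ‖_root_.diffQuot h f‖ ≤ ‖g‖ := by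
  rw [diffQuot_apply, norm_smul, Real.norm_eq_abs]
  exact (mul_le_mul_of_nonneg_left (hf.norm_shift_sub_le h) (abs_nonneg _)).trans
    (abs_inv_mul_abs_le h (norm_nonneg g))

theorem InH1.norm_diffQuotC_le {c d : CircleC L} (hc : InH1 (toL2 c) (toL2 d)) (h : ℝ) :
    ‖diffQuotC h c‖ ≤ ‖d‖ := by
  rw [diffQuotC, norm_smul, Real.norm_eq_abs]
  exact (mul_le_mul_of_nonneg_left (hc.norm_shiftC_sub_le h) (abs_nonneg _)).trans
    (abs_inv_mul_abs_le h (norm_nonneg d))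

theorem InH1.tendsto_diffQuot {f g : ScalarL2 L} (hf : InH1 f g) :
    Tendsto (fun h => _root_.diffQuot h f) (𝓝[≠] 0) (𝓝 g) := by
  have h := (hf.hasDerivAt_shift 0).tendsto_slope_zero
  simp only [zero_add, shiftLp_zero] at h
  exact h

theorem InH1.tendsto_diffQuotC {c d : CircleC L} (hc : InH1 (toL2 c) (toL2 d)) :
    Tendsto (fun h => diffQuotC h c) (𝓝[≠] 0) (𝓝 d) := by
  have h := (hc.hasDerivAt_shiftC 0).tendsto_slope_zero
  simp only [zero_add, shiftC_zero] at h
  exact h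

/-! ## Integration by parts -/

theorem HasDerivWithinAt.cmul {a : ℝ → CircleC L} {f : ℝ → ScalarL2 L} {a' : CircleC L}
    {f' : ScalarL2 L} {s : Set ℝ} {t : ℝ} (ha : HasDerivWithinAt a a' s t)
    (hf : HasDerivWithinAt f f' s t) :
    HasDerivWithinAt (fun r => _root_.cmul (a r) (f r))
      (_root_.cmul a' (f t) + _root_.cmul (a t) f') s t := by
  have h1 : HasDerivWithinAt (fun r => _root_.cmul (a r)) (_root_.cmul a') s t :=
    HasFDerivAt.comp_hasDerivWithinAt t
      (ContinuousLinearMap.hasFDerivAt (_root_.cmul : CircleC L →L[ℝ] _)) ha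
  exact h1.clm_apply hf

/-- Translation invariance makes ⟨q(·+h) f(·+h), g(·+h)⟩ constant in h; its derivative at h = 0 is
the identity. -/
theorem inner_integration_by_parts {q d : CircleC L} (hq : InH1 (toL2 q) (toL2 d))
    {f f' g g' : ScalarL2 L} (hf : InH1 f f') (hg : InH1 g g') :
    inner ℝ (cmul q f) g' + inner ℝ (cmul q f') g = -inner ℝ (cmul d f) g := by
  have h0 := ((hq.hasDerivAt_shiftC 0).hasDerivWithinAt (s := univ)).cmul
    ((hf.hasDerivAt_shift 0).hasDerivWithinAt (s := univ))
  rw [hasDerivWithinAt_univ] at h0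
  have h1 := h0.inner ℝ (hg.hasDerivAt_shift 0)
  have h2 : (fun t : ℝ => inner ℝ (cmul (shiftC t q) (shiftLp t f)) (shiftLp t g)) =
      fun _ => inner ℝ (cmul q f) g := by
    funext t
    rw [← shiftLp_cmul]
    exact (shiftLp (E := ℝ) t).inner_map_map _ _
  rw [h2] at h1
  have h3 := h1.unique (hasDerivAt_const _ _)
  simp only [shiftC_zero, shiftLp_zero, inner_add_left] at h3
  linarith

theorem InH1.one : InH1 (toL2 (1 : CircleC L)) (toL2 0) :=
  InH1.of_smooth contDiff_const fun s => hasDerivAt_const s (1 : ℝ)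

theorem inner_integration_by_parts_one {f f' g g' : ScalarL2 L} (hf : InH1 f f') (hg : InH1 g g') :
    inner ℝ f g' + inner ℝ f' g = 0 := by
  have := inner_integration_by_parts InH1.one hf hg
  simpa [cmul_one] using this

/-! ## Composition operators are differentiable -/

/-- Uniform continuity of b' on the ball of radius ‖c‖ + 1 makes the remainder small uniformly in x.
This is what allows s(a w) to be differentiated in time in the sup norm. -/
theorem hasFDerivAt_compC {b b' : ℝ → ℝ} (hb' : Continuous b') (hd : ∀ y, HasDerivAt b (b' y) y)
    (hb : Continuous b) (c : CircleC L) :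
    HasFDerivAt (compC b hb : CircleC L → CircleC L)
      (ContinuousLinearMap.mul ℝ (CircleC L) (compC b' hb' c)) c := by
  refine HasFDerivAt.of_isLittleO (Asymptotics.isLittleO_iff.2 fun ε hε => ?_)
  have hK : IsCompact (Metric.closedBall (0 : ℝ) (‖c‖ + 1)) := isCompact_closedBall _ _
  have huc := hK.uniformContinuousOn_of_continuous hb'.continuousOn
  rw [Metric.uniformContinuousOn_iff] at huc
  obtain ⟨δ, hδ, hδ'⟩ := huc ε hε
  filter_upwards [Metric.ball_mem_nhds c (lt_min hδ one_pos)] with e he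
  rw [Metric.mem_ball, dist_eq_norm, lt_min_iff] at he
  refine (ContinuousMap.norm_le _ (by positivity)).2 fun x => ?_
  have hx : ‖e x - c x‖ ≤ ‖e - c‖ := (e - c).norm_coe_le_norm x
  have hcx : ‖c x‖ ≤ ‖c‖ := c.norm_coe_le_norm x
  have key : ‖b (e x) - b (c x) - b' (c x) * (e x - c x)‖ ≤ ε * ‖e x - c x‖ := by
    have hseg : ∀ y ∈ segment ℝ (c x) (e x), ‖b' y - b' (c x)‖ ≤ ε := by
      intro y hy
      have hy1 : ‖y - c x‖ ≤ ‖e x - c x‖ := norm_sub_le_of_mem_segment hy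
      have hy2 : ‖y‖ ≤ ‖c‖ + 1 := by
        calc ‖y‖ = ‖c x + (y - c x)‖ := by congr 1; ring
          _ ≤ ‖c x‖ + ‖y - c x‖ := norm_add_le _ _
          _ ≤ ‖c‖ + 1 := by linarith
      have := hδ' y (by simpa using hy2) (c x) (by simpa using hcx.trans (by linarith))
        (by rw [dist_eq_norm]; linarith)
      rw [dist_eq_norm] at this
      exact this.le
    have := (convex_segment (c x) (e x)).norm_image_sub_le_of_norm_hasDerivWithin_le
      (f := fun y => b y - b' (c x) * y) (f' := fun y => b' y - b' (c x)) (C := ε)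
      (fun y _ =>
        (((hd y).sub ((hasDerivAt_id y).const_mul (b' (c x)))).congr_deriv
          (by rw [mul_one])).hasDerivWithinAt)
      hseg (left_mem_segment ℝ _ _) (right_mem_segment ℝ _ _)
    refine le_trans (le_of_eq ?_) this
    congr 1; ring
  refine le_trans ?_ (key.trans (mul_le_mul_of_nonneg_left hx hε.le))
  exact le_of_eq rfl

theorem HasDerivWithinAt.compC {b b' : ℝ → ℝ} (hb : Continuous b) (hb' : Continuous b')
    (hd : ∀ y, HasDerivAt b (b' y) y) {γ : ℝ → CircleC L} {γ' : CircleC L} {s : Set ℝ} {t : ℝ}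
    (hγ : HasDerivWithinAt γ γ' s t) :
    HasDerivWithinAt (fun r => _root_.compC b hb (γ r)) (_root_.compC b' hb' (γ t) * γ') s t :=
  (hasFDerivAt_compC hb' hd hb (γ t)).comp_hasDerivWithinAt t hγ

end

noncomputable section

variable {L : ℝ} [Fact (0 < L)]

set_option linter.unusedSectionVars false

/-! ## Scalar Sobolev bounds and iterated weak derivatives -/

/-- `f ∈ H^m`, and all weak derivatives of order at most `m` have `L²` norm at most `N`. -/
def SobLe : ℕ → ScalarL2 L → ℝ → Prop
  | 0, f, N => ‖f‖ ≤ N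
  | m + 1, f, N => ‖f‖ ≤ N ∧ ∃ g, InH1 f g ∧ SobLe m g N

theorem SobLe.norm_le {m : ℕ} {f : ScalarL2 L} {N : ℝ} (h : SobLe m f N) : ‖f‖ ≤ N := by
  cases m with
  | zero => exact h
  | succ m => exact h.1

theorem SobLe.nonneg {m : ℕ} {f : ScalarL2 L} {N : ℝ} (h : SobLe m f N) : 0 ≤ N :=
  (norm_nonneg f).trans h.norm_le

theorem SobLe.mono {m : ℕ} : ∀ {f : ScalarL2 L} {N N' : ℝ}, SobLe m f N → N ≤ N' → SobLe m f N' := by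
  induction m with
  | zero => exact fun h h' => le_trans (α := ℝ) h h'
  | succ m ih =>
    rintro f N N' ⟨h1, g, h2, h3⟩ h'
    exact ⟨h1.trans h', g, h2, ih h3 h'⟩

theorem SobLe.pred {m : ℕ} : ∀ {f : ScalarL2 L} {N : ℝ}, SobLe (m + 1) f N → SobLe m f N := by
  induction m with
  | zero => exact fun h => h.1
  | succ m ih => exact fun h => ⟨h.1, h.2.imp fun g hg => ⟨hg.1, ih hg.2⟩⟩

theorem SobLe.of_le {m n : ℕ} {f : ScalarL2 L} {N : ℝ} (h : SobLe n f N) (hmn : m ≤ n) :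
    SobLe m f N := by
  induction n, hmn using Nat.le_induction with
  | base => exact h
  | succ n _ ih => exact ih h.pred

theorem SobLe.add {m : ℕ} : ∀ {f g : ScalarL2 L} {A B : ℝ}, SobLe m f A → SobLe m g B →
    SobLe m (f + g) (A + B) := by
  induction m with
  | zero => exact fun h1 h2 => (norm_add_le _ _).trans (add_le_add h1 h2)
  | succ m ih =>
    rintro f g A B ⟨h1, f', h2, h3⟩ ⟨k1, g', k2, k3⟩
    exact ⟨(norm_add_le _ _).trans (add_le_add h1 k1), _, h2.add k2, ih h3 k3⟩

theorem SobLe.norm_le_of_toL2 {m : ℕ} {c : CircleC L} {N : ℝ} (h : SobLe (m + 1) (toL2 c) N) :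
    ‖c‖ ≤ 2 * supConst L * N := by
  obtain ⟨h1, g, h2, h3⟩ := h
  refine h2.norm_le.trans ?_
  have := mul_le_mul_of_nonneg_left (add_le_add h1 h3.norm_le) (supConst_nonneg L)
  linarith

/-- `H^{m+1} · H^m ⊆ H^m`. -/
theorem exists_sobLe_cmul (m : ℕ) : ∃ K, 0 ≤ K ∧ ∀ (c : CircleC L) (g : ScalarL2 L) (A B : ℝ),
    SobLe (m + 1) (toL2 c) A → SobLe m g B → SobLe m (cmul c g) (K * A * B) := by
  have hnorm : ∀ (n : ℕ) (c : CircleC L) (g : ScalarL2 L) (A B : ℝ),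
      SobLe (n + 1) (toL2 c) A → ‖g‖ ≤ B → ‖cmul c g‖ ≤ 2 * supConst L * A * B := by
    intro n c g A B hc hg
    exact (norm_cmul_le c g).trans (mul_le_mul hc.norm_le_of_toL2 hg (norm_nonneg _)
      (mul_nonneg (mul_nonneg zero_le_two (supConst_nonneg L)) hc.nonneg))
  induction m with
  | zero =>
    exact ⟨2 * supConst L, mul_nonneg zero_le_two (supConst_nonneg L), fun c g A B hc hg =>
      hnorm _ c g A B hc hg⟩
  | succ m ih =>
    obtain ⟨K, hK, hK'⟩ := ih
    have hS := supConst_nonneg L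
    refine ⟨2 * supConst L + 2 * K, by positivity, fun c g A B hc hg => ?_⟩
    have hA := hc.nonneg
    have hB := hg.nonneg
    obtain ⟨-, f', hf', hf''⟩ := id hc
    obtain ⟨hg0, g', hg', hg''⟩ := id hg
    obtain ⟨d, rfl⟩ := hg'.exists_toL2
    obtain ⟨-, f'', hff, -⟩ := id hf''
    obtain ⟨c', rfl⟩ := hff.exists_toL2
    have hAB := mul_nonneg hA hB
    have hKAB := mul_nonneg hK hAB
    refine ⟨(hnorm _ c _ A B hc hg0).trans (by nlinarith), cmul c g' + cmul c' (toL2 d), ?_, ?_⟩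
    · have := hf'.mul hg'
      rwa [cmul_toL2 d c', mul_comm d c', ← cmul_toL2, ← cmul_toL2] at this
    -- Both Leibniz terms are again products in H^{m+1} · H^m: in c g' the derivative is taken from
    -- g, and in c' g the factor c' still lies in H^{m+1}.
    · refine ((hK' c g' A B hc.pred hg'').add (hK' c' (toL2 d) A B hf'' hg.pred)).mono ?_
      have : 0 ≤ supConst L * (A * B) := mul_nonneg hS hAB
      nlinarith

/-- `H^m` is an algebra for `m ≥ 1`. -/
theorem exists_sobLe_mul (m : ℕ) : ∃ K, 0 ≤ K ∧ ∀ (c : CircleC L) (g : ScalarL2 L) (A B : ℝ),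
    SobLe (m + 1) (toL2 c) A → SobLe (m + 1) g B → SobLe (m + 1) (cmul c g) (K * A * B) := by
  obtain ⟨K, hK, hK'⟩ := exists_sobLe_cmul (L := L) m
  refine ⟨2 * K, by positivity, fun c g A B hc hg => ?_⟩
  have hA := hc.nonneg
  have hB := hg.nonneg
  have h0 := (hK' c g A B hc hg.pred).norm_le
  obtain ⟨-, f', hf', hf''⟩ := id hc
  obtain ⟨hg0, g', hg', hg''⟩ := id hg
  obtain ⟨d, rfl⟩ := hg'.exists_toL2
  have hKAB : 0 ≤ K * A * B := by positivity
  refine ⟨h0.trans (by linarith), cmul c g' + cmul d f', ?_, ?_⟩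
  · have := hf'.mul hg'
    rwa [← cmul_toL2] at this
  · exact ((hK' c g' A B hc hg'').add (hK' d f' B A hg hf'')).mono (le_of_eq (by ring))

/-- `F` is the weak derivative of order `j` of `f`. -/
def IterDx : ℕ → ScalarL2 L → ScalarL2 L → Prop
  | 0, f, F => f = F
  | j + 1, f, F => ∃ g, InH1 f g ∧ IterDx j g F

theorem IterDx.add {j : ℕ} : ∀ {f g F G : ScalarL2 L}, IterDx j f F → IterDx j g G →
    IterDx j (f + g) (F + G) := by
  induction j with
  | zero => rintro f g _ _ rfl rfl; rfl
  | succ j ih =>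
    rintro f g F G ⟨f', h1, h2⟩ ⟨g', k1, k2⟩
    exact ⟨_, h1.add k1, ih h2 k2⟩

theorem IterDx.smul {j : ℕ} (a : ℝ) : ∀ {f F : ScalarL2 L}, IterDx j f F →
    IterDx j (a • f) (a • F) := by
  induction j with
  | zero => rintro f _ rfl; rfl
  | succ j ih =>
    rintro f F ⟨f', h1, h2⟩
    exact ⟨_, h1.smul a, ih h2⟩

theorem IterDx.sub {j : ℕ} {f g F G : ScalarL2 L} (hf : IterDx j f F) (hg : IterDx j g G) :
    IterDx j (f - g) (F - G) := by
  have := hf.add (hg.smul (-1))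
  simpa [sub_eq_add_neg] using this

theorem IterDx.unique {j : ℕ} : ∀ {f F G : ScalarL2 L}, IterDx j f F → IterDx j f G → F = G := by
  induction j with
  | zero => rintro f _ _ rfl rfl; rfl
  | succ j ih =>
    rintro f F G ⟨f', h1, h2⟩ ⟨g', k1, k2⟩
    obtain rfl := h1.unique k1
    exact ih h2 k2

theorem IterDx.of_forall {u : ℕ → ScalarL2 L} : ∀ {j : ℕ} {m : ℕ},
    (∀ i, i < j → InH1 (u (m + i)) (u (m + i + 1))) → IterDx j (u m) (u (m + j)) := by
  intro j
  induction j with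
  | zero => intro m _; rfl
  | succ j ih =>
    intro m h
    refine ⟨u (m + 1), h 0 (Nat.succ_pos j), ?_⟩
    have := ih (m := m + 1) fun i hi => by
      have := h (i + 1) (Nat.succ_lt_succ hi)
      rwa [show m + (i + 1) = m + 1 + i by ring] at this
    rwa [show m + (j + 1) = m + 1 + j by ring]

theorem SobLe.of_forall {u : ℕ → ScalarL2 L} {N : ℝ} : ∀ {j : ℕ} {m : ℕ},
    (∀ i, i < j → InH1 (u (m + i)) (u (m + i + 1))) → (∀ i, i ≤ j → ‖u (m + i)‖ ≤ N) →
    SobLe j (u m) N := by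
  intro j
  induction j with
  | zero => intro m _ h; exact h 0 le_rfl
  | succ j ih =>
    intro m h h'
    refine ⟨h' 0 (Nat.zero_le _), u (m + 1), h 0 (Nat.succ_pos j), ih (fun i hi => ?_) fun i hi => ?_⟩
    · have := h (i + 1) (Nat.succ_lt_succ hi)
      rwa [show m + (i + 1) = m + 1 + i by ring] at this
    · have := h' (i + 1) (Nat.succ_le_succ hi)
      rwa [show m + (i + 1) = m + 1 + i by ring] at this

/-! ## Compositions `b(a w)` with large parameter `a` -/

/-- `b` is smooth and all its derivatives are `O(1 / ρ)`. -/
structure WeightedSymbol (ρ b : ℝ → ℝ) : Prop where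
  contDiff : ContDiff ℝ ∞ b
  bound : ∀ i : ℕ, ∃ C, ∀ y, |ρ y * iteratedDeriv i b y| ≤ C

theorem WeightedSymbol.deriv {ρ b : ℝ → ℝ} (h : WeightedSymbol ρ b) :
    WeightedSymbol ρ (deriv b) :=
  ⟨(contDiff_infty_iff_deriv.1 h.contDiff).2, fun i => by
    simpa only [← iteratedDeriv_succ'] using h.bound (i + 1)⟩

theorem hasDerivAt_of_contDiff {b : ℝ → ℝ} (hb : ContDiff ℝ ∞ b) (y : ℝ) :
    HasDerivAt b (deriv b y) y :=
  ((hb.differentiable (by simp)) y).hasDerivAt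

theorem continuous_deriv_of_contDiff {b : ℝ → ℝ} (hb : ContDiff ℝ ∞ b) :
    Continuous (deriv b) := (contDiff_infty_iff_deriv.1 hb).2.continuous

theorem inH1_comp_smul {b : ℝ → ℝ} (hb : ContDiff ℝ ∞ b) (a : ℝ) {w w₁ : CircleC L}
    (hw : InH1 (toL2 w) (toL2 w₁)) :
    InH1 (toL2 (compC b hb.continuous (a • w)))
      (toL2 (a • (compC (deriv b) (continuous_deriv_of_contDiff hb) (a • w) * w₁))) := by
  have h1 : InH1 (toL2 (a • w)) (toL2 (a • w₁)) := by
    rw [map_smul, map_smul]; exact hw.smul a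
  have h2 := h1.comp hb (continuous_deriv_of_contDiff hb) (hasDerivAt_of_contDiff hb)
  rwa [cmul_toL2, mul_smul_comm] at h2

theorem inH1_cmul_comp {b : ℝ → ℝ} (hb : ContDiff ℝ ∞ b) (a : ℝ) {w w₁ : CircleC L}
    (hw : InH1 (toL2 w) (toL2 w₁)) {v v' : ScalarL2 L} (hv : InH1 v v') :
    InH1 (cmul (compC b hb.continuous (a • w)) v)
      (cmul (compC b hb.continuous (a • w)) v' +
        a • cmul (compC (deriv b) (continuous_deriv_of_contDiff hb) (a • w)) (cmul w₁ v)) := by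
  obtain ⟨d, rfl⟩ := hv.exists_toL2
  have h := (inH1_comp_smul hb a hw).mul hv
  rw [cmul_toL2 d, mul_comm d, smul_mul_assoc, mul_assoc, map_smul, ← cmul_toL2, ← cmul_toL2,
    ← cmul_toL2] at h
  exact h

/-- By Leibniz, ∂(b(aw) v) = b(aw) v' + a b'(aw) w₁ v, and b' is again a symbol with the same
weight. Each derivative therefore costs at most one factor a, and the weight ρ is only used at the
very end, on an undifferentiated symbol. -/
theorem WeightedSymbol.exists_iterDx {ρ : ℝ → ℝ} (hρ : Continuous ρ) (j : ℕ) : ∀ {b : ℝ → ℝ}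
    (hb : WeightedSymbol ρ b), ∃ K, 0 ≤ K ∧ ∀ (a : ℝ) (w w₁ : CircleC L) (N : ℝ)
      (v : ScalarL2 L) (M : ℝ), 1 ≤ a → InH1 (toL2 w) (toL2 w₁) → SobLe j (toL2 w₁) N → N ≤ 1 →
      SobLe j v M → ∃ F, IterDx j (cmul (compC b hb.contDiff.continuous (a • w)) v) F ∧
        ‖cmul (compC ρ hρ (a • w)) F‖ ≤ K * a ^ j * M := by
  induction j with
  | zero =>
    intro b hb
    obtain ⟨C, hC⟩ := hb.bound 0
    have hC0 : 0 ≤ C := (abs_nonneg _).trans (hC 0)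
    refine ⟨C, hC0, fun a w w₁ N v M _ _ _ _ hv => ⟨_, rfl, ?_⟩⟩
    rw [← cmul_mul, pow_zero, mul_one]
    refine (norm_cmul_le_of_le (M := C) (fun x => ?_) v).trans (mul_le_mul_of_nonneg_left hv hC0)
    simpa using hC ((a • w) x)
  | succ j ih =>
    intro b hb
    obtain ⟨K₁, hK₁, h₁⟩ := ih hb
    obtain ⟨K₂, hK₂, h₂⟩ := ih hb.deriv
    obtain ⟨K₃, hK₃, h₃⟩ := exists_sobLe_cmul (L := L) j
    refine ⟨K₁ + K₂ * K₃, by positivity, fun a w w₁ N v M ha hw hw₁ hN hv => ?_⟩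
    have hM := hv.nonneg
    have hN0 := hw₁.nonneg
    obtain ⟨-, v', hv', hv''⟩ := id hv
    obtain ⟨F₁, hF₁, hF₁'⟩ := h₁ a w w₁ N v' M ha hw hw₁.pred hN hv''
    obtain ⟨F₂, hF₂, hF₂'⟩ := h₂ a w w₁ N (cmul w₁ v) _ ha hw hw₁.pred hN (h₃ w₁ v N M hw₁ hv.pred)
    refine ⟨F₁ + a • F₂, ⟨_, inH1_cmul_comp hb.contDiff a hw hv', hF₁.add (hF₂.smul a)⟩, ?_⟩
    have ha0 : 0 ≤ a := by linarith
    rw [map_add, map_smul]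
    refine (norm_add_le _ _).trans ?_
    rw [norm_smul, Real.norm_of_nonneg ha0]
    have e1 : K₁ * a ^ j * M ≤ K₁ * a ^ (j + 1) * M := by
      gcongr
      omega
    have e2 : a * (K₂ * a ^ j * (K₃ * N * M)) ≤ K₂ * K₃ * a ^ (j + 1) * M := by
      calc a * (K₂ * a ^ j * (K₃ * N * M)) ≤ a * (K₂ * a ^ j * (K₃ * 1 * M)) := by gcongr
        _ = _ := by ring
    calc _ ≤ K₁ * a ^ j * M + a * (K₂ * a ^ j * (K₃ * N * M)) := by gcongr
      _ ≤ K₁ * a ^ (j + 1) * M + K₂ * K₃ * a ^ (j + 1) * M := by gcongr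
      _ = _ := by ring

/-- With F = ∂^j(bv), V = ∂^j v and R = ∂(F − bV), the sum R + (∂b)V is formally the commutator
∂^{j+1}(bv) − b ∂^{j+1}v, written without differentiating V, which need only be in L². Only
derivatives of b occur in it, so only b' has to be controlled by 1/ρ, and every term contains w₁,
which gives the factor N. -/
theorem WeightedSymbol.exists_iterDx_commutator {ρ : ℝ → ℝ} (hρ : Continuous ρ) {m : ℕ}
    (hm : 1 ≤ m) (j : ℕ) (hj : j ≤ m) : ∀ {b : ℝ → ℝ} (hb : ContDiff ℝ ∞ b)
    (hb' : WeightedSymbol ρ (_root_.deriv b)), ∃ K, 0 ≤ K ∧ ∀ (a : ℝ) (w w₁ : CircleC L) (N : ℝ)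
      (v : ScalarL2 L) (M : ℝ), 1 ≤ a → InH1 (toL2 w) (toL2 w₁) → SobLe m (toL2 w₁) N → N ≤ 1 →
      SobLe j v M → ∃ F V R, IterDx j (cmul (compC b hb.continuous (a • w)) v) F ∧ IterDx j v V ∧
        InH1 (F - cmul (compC b hb.continuous (a • w)) V) R ∧
        ‖cmul (compC ρ hρ (a • w)) (R + a • cmul (compC (_root_.deriv b)
          hb'.contDiff.continuous (a • w)) (cmul w₁ V))‖ ≤ K * a ^ (j + 1) * N * M := by
  induction j with
  | zero =>
    intro b hb hb'
    obtain ⟨C, hC⟩ := hb'.bound 0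
    have hC0 : 0 ≤ C := (abs_nonneg _).trans (hC 0)
    have hS := supConst_nonneg L
    refine ⟨C * (2 * supConst L), by positivity, fun a w w₁ N v M ha _ hw₁ _ hv =>
      ⟨_, v, 0, rfl, rfl, by rw [sub_self]; exact InH1.zero, ?_⟩⟩
    have ha0 : 0 ≤ a := by linarith
    have hN0 := hw₁.nonneg
    rw [zero_add, map_smul, norm_smul, Real.norm_of_nonneg ha0, ← cmul_mul]
    have e1 := norm_cmul_le_of_le (M := C) (c := compC ρ hρ (a • w) * compC (_root_.deriv b)
      hb'.contDiff.continuous (a • w)) (fun x => by simpa using hC ((a • w) x)) (cmul w₁ v)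
    have e2 : ‖w₁‖ ≤ 2 * supConst L * N := by
      obtain ⟨n, rfl⟩ := Nat.exists_eq_add_of_le' hm
      exact hw₁.norm_le_of_toL2
    calc _ ≤ a * (C * (‖w₁‖ * ‖v‖)) := by
          refine mul_le_mul_of_nonneg_left (e1.trans ?_) ha0
          exact mul_le_mul_of_nonneg_left (norm_cmul_le _ _) hC0
      _ ≤ a * (C * ((2 * supConst L * N) * M)) := by
          gcongr
          exact hv
      _ = _ := by ring
  | succ j ih =>
    intro b hb hb'
    obtain ⟨K₁, hK₁, h₁⟩ := ih (by omega) hb hb'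
    obtain ⟨K₂, hK₂, h₂⟩ := hb'.exists_iterDx (L := L) hρ (j + 1)
    obtain ⟨K₃, hK₃, h₃⟩ := exists_sobLe_mul (L := L) j
    refine ⟨K₁ + K₂ * K₃, by positivity, fun a w w₁ N v M ha hw hw₁ hN hv => ?_⟩
    have hM := hv.nonneg
    have hN0 := hw₁.nonneg
    have ha0 : 0 ≤ a := by linarith
    obtain ⟨-, v', hv', hv''⟩ := id hv
    obtain ⟨F₁, V, R, hF₁, hV, hR, hR'⟩ := h₁ a w w₁ N v' M ha hw hw₁ hN hv''
    have hwj : SobLe (j + 1) (toL2 w₁) N := hw₁.of_le hj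
    obtain ⟨F₃, ⟨g, hg, hgF⟩, hF₃'⟩ :=
      h₂ a w w₁ N (cmul w₁ v) _ ha hw hwj hN (h₃ w₁ v N M hwj hv)
    obtain ⟨F₂, hF₂, hF₂₃⟩ : ∃ F₂, IterDx j (cmul (compC (_root_.deriv b)
        hb'.contDiff.continuous (a • w)) (cmul w₁ v)) F₂ ∧ InH1 F₂ F₃ := by
      -- `IterDx` peels off the innermost derivative, whereas the commutator needs the outermost one
      -- as an `InH1` relation; this exchanges the two.
      have key : ∀ (j : ℕ) (f g F : ScalarL2 L), InH1 f g → IterDx j g F →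
          ∃ G, IterDx j f G ∧ InH1 G F := by
        intro j
        induction j with
        | zero => rintro f g _ h rfl; exact ⟨f, rfl, h⟩
        | succ j ih =>
          rintro f g F h ⟨g', h1, h2⟩
          obtain ⟨G, hG1, hG2⟩ := ih g g' F h1 h2
          exact ⟨G, ⟨g, h, hG1⟩, hG2⟩
      exact key j _ g F₃ hg hgF
    refine ⟨F₁ + a • F₂, V, R + a • F₃,
      ⟨_, inH1_cmul_comp hb a hw hv', hF₁.add (hF₂.smul a)⟩, ⟨v', hv', hV⟩, ?_, ?_⟩
    · have := hR.add (hF₂₃.smul a)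
      rwa [sub_add_eq_add_sub] at this
    · rw [add_right_comm, map_add, map_smul]
      refine (norm_add_le _ _).trans ?_
      rw [norm_smul, Real.norm_of_nonneg ha0]
      have e1 : K₁ * a ^ (j + 1) * N * M ≤ K₁ * a ^ (j + 2) * N * M := by
        gcongr
        omega
      calc _ ≤ K₁ * a ^ (j + 1) * N * M + a * (K₂ * a ^ (j + 1) * (K₃ * N * M)) := by gcongr
        _ ≤ K₁ * a ^ (j + 2) * N * M + a * (K₂ * a ^ (j + 1) * (K₃ * N * M)) := by gcongr
        _ = _ := by ring

/-- The mean value theorem gives |b(aw) − b(0)| ≤ C a |w|, which accounts for the extra power of a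
and the factor N; derivatives that hit b produce w₁ and hence N again. This makes the nonlinearity a
quadratic perturbation of the constant coefficient system. -/
theorem WeightedSymbol.exists_iterDx_sub {b : ℝ → ℝ} (hb : WeightedSymbol (fun _ => 1) b) (j : ℕ) :
    ∃ K, 0 ≤ K ∧ ∀ (a : ℝ) (w w₁ : CircleC L) (N : ℝ) (v : ScalarL2 L) (M : ℝ), 1 ≤ a →
      InH1 (toL2 w) (toL2 w₁) → SobLe (j + 1) (toL2 w) N → N ≤ 1 → SobLe j v M →
      ∃ F, IterDx j (cmul (compC b hb.contDiff.continuous (a • w)) v - b 0 • v) F ∧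
        ‖F‖ ≤ K * a ^ (j + 1) * N * M := by
  induction j with
  | zero =>
    obtain ⟨C, hC⟩ := hb.bound 1
    have hC0 : 0 ≤ C := (abs_nonneg _).trans (hC 0)
    have hS := supConst_nonneg L
    refine ⟨C * (2 * supConst L), by positivity, fun a w w₁ N v M ha _ hw _ hv => ⟨_, rfl, ?_⟩⟩
    have ha0 : 0 ≤ a := by linarith
    have hN0 := hw.nonneg
    have e0 : ∀ y, |b y - b 0| ≤ C * |y| := fun y => by
      have := Convex.norm_image_sub_le_of_norm_deriv_le (f := b) (C := C) (s := univ) (x := 0)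
        (y := y) (fun x _ => (hasDerivAt_of_contDiff hb.contDiff x).differentiableAt)
        (fun x _ => by simpa using hC x) convex_univ trivial trivial
      simpa using this
    have e1 : cmul (compC b hb.contDiff.continuous (a • w)) v - b 0 • v =
        cmul (compC b hb.contDiff.continuous (a • w) - b 0 • 1) v := by
      rw [map_sub, sub_apply, map_smul, smul_apply, cmul_one]
    have e2 := hw.norm_le_of_toL2
    rw [e1]
    refine (norm_cmul_le_of_le (M := C * (a * (2 * supConst L * N))) (fun x => ?_) v).trans ?_
    · have e3 := e0 ((a • w) x)
      have e4 : |(a • w) x| ≤ a * (2 * supConst L * N) := by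
        rw [ContinuousMap.smul_apply, smul_eq_mul, abs_mul, abs_of_nonneg ha0]
        exact mul_le_mul_of_nonneg_left ((w.norm_coe_le_norm x).trans e2) ha0
      have : (compC b hb.contDiff.continuous (a • w) - b 0 • 1 : CircleC L) x =
          b ((a • w) x) - b 0 := by simp
      rw [this]
      exact e3.trans (mul_le_mul_of_nonneg_left e4 hC0)
    · calc _ ≤ C * (a * (2 * supConst L * N)) * M := by gcongr; exact hv
        _ = _ := by ring
  | succ j ih =>
    obtain ⟨K₁, hK₁, h₁⟩ := ih
    obtain ⟨K₂, hK₂, h₂⟩ := hb.deriv.exists_iterDx (L := L) continuous_const j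
    obtain ⟨K₃, hK₃, h₃⟩ := exists_sobLe_cmul (L := L) j
    refine ⟨K₁ + K₂ * K₃, by positivity, fun a w w₁ N v M ha hw hwN hN hv => ?_⟩
    have hM := hv.nonneg
    have hN0 := hwN.nonneg
    have ha0 : 0 ≤ a := by linarith
    have hw₁ : SobLe (j + 1) (toL2 w₁) N := by
      obtain ⟨-, g, hg, hg'⟩ := hwN
      rwa [hw.unique hg]
    obtain ⟨-, v', hv', hv''⟩ := id hv
    obtain ⟨F₁, hF₁, hF₁'⟩ := h₁ a w w₁ N v' M ha hw hwN.pred hN hv''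
    obtain ⟨F₂, hF₂, hF₂'⟩ := h₂ a w w₁ N (cmul w₁ v) _ ha hw hw₁.pred hN (h₃ w₁ v N M hw₁ hv.pred)
    have hone : (compC (fun _ => (1 : ℝ)) continuous_const (a • w) : CircleC L) = 1 := rfl
    rw [hone, cmul_one] at hF₂'
    refine ⟨F₁ + a • F₂, ⟨_, (inH1_cmul_comp hb.contDiff a hw hv').sub (hv'.smul (b 0)), ?_⟩, ?_⟩
    · have := hF₁.add (hF₂.smul a)
      rwa [sub_add_eq_add_sub] at this
    · refine (norm_add_le _ _).trans ?_
      rw [norm_smul, Real.norm_of_nonneg ha0]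
      have e1 : K₁ * a ^ (j + 1) * N * M ≤ K₁ * a ^ (j + 2) * N * M := by
        gcongr
        omega
      have e2 : a * (K₂ * a ^ j * (K₃ * N * M)) ≤ a * (K₂ * a ^ (j + 1) * (K₃ * N * M)) := by
        gcongr
        omega
      calc _ ≤ K₁ * a ^ (j + 1) * N * M + a * (K₂ * a ^ j * (K₃ * N * M)) := by gcongr
        _ ≤ K₁ * a ^ (j + 2) * N * M + a * (K₂ * a ^ (j + 1) * (K₃ * N * M)) := by linarith
        _ = _ := by ring

end

noncomputable section

/-! ## The coefficients as functions of `φ(u)` -/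

section Symbols

variable {σ : ℝ}

theorem one_add_sq_pos (u : ℝ) : 0 < 1 + u ^ 2 := by positivity

theorem one_add_mul_sq_pos (h1 : σ < 1) (u : ℝ) : 0 < 1 + (1 - σ) * u ^ 2 := by
  have : 0 ≤ (1 - σ) * u ^ 2 := mul_nonneg (by linarith) (sq_nonneg u)
  linarith

theorem hasDerivAt_velocityMap (σ u : ℝ) :
    HasDerivAt (velocityMap σ) ((1 + (1 - σ) * u ^ 2) * (1 + u ^ 2) ^ (-(1 + σ / 2))) u := by
  have hp := one_add_sq_pos u
  have h2 : HasDerivAt (fun u : ℝ => 1 + u ^ 2) (2 * u) u := by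
    simpa using (hasDerivAt_pow 2 u).const_add 1
  have h3 := (hasDerivAt_id u).mul (h2.rpow_const (p := -(σ / 2)) (Or.inl hp.ne'))
  have h4 : velocityMap σ = id * fun u : ℝ => (1 + u ^ 2) ^ (-(σ / 2)) := by
    funext v
    simp only [velocityMap, Pi.mul_apply, id]
    rw [Real.rpow_neg (one_add_sq_pos v).le, div_eq_mul_inv]
  rw [h4]
  refine h3.congr_deriv ?_
  have e1 : (1 + u ^ 2) ^ (-(σ / 2)) = (1 + u ^ 2) ^ (-(1 + σ / 2)) * (1 + u ^ 2) := by
    rw [← Real.rpow_add_one hp.ne']; congr 1; ring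
  have e2 : -(σ / 2) - 1 = -(1 + σ / 2) := by ring
  rw [e2, e1, id]
  ring

theorem strictMono_velocityMap (h1 : σ < 1) : StrictMono (velocityMap σ) := by
  refine strictMono_of_deriv_pos fun u => ?_
  rw [(hasDerivAt_velocityMap σ u).deriv]
  exact mul_pos (one_add_mul_sq_pos h1 u) (Real.rpow_pos_of_pos (one_add_sq_pos u) _)

theorem velocityMap_velocityInv (h0 : 0 ≤ σ) (h1 : σ < 1) (y : ℝ) :
    velocityMap σ (velocityInv σ y) = y :=
  Function.rightInverse_invFun (velocityMap_bijective h0 h1).2 y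

theorem velocityInv_velocityMap (h0 : 0 ≤ σ) (h1 : σ < 1) (u : ℝ) :
    velocityInv σ (velocityMap σ u) = u :=
  Function.leftInverse_invFun (velocityMap_bijective h0 h1).1 u

theorem continuous_velocityInv (h0 : 0 ≤ σ) (h1 : σ < 1) : Continuous (velocityInv σ) := by
  have h := ((strictMono_velocityMap h1).orderIsoOfSurjective _
    (velocityMap_bijective h0 h1).2).symm.continuous
  refine h.congr fun y => ?_
  obtain ⟨u, rfl⟩ := (velocityMap_bijective h0 h1).2 y
  rw [velocityInv_velocityMap h0 h1]
  exact ((strictMono_velocityMap h1).orderIsoOfSurjective _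
    (velocityMap_bijective h0 h1).2).symm_apply_apply u

theorem hasDerivAt_velocityInv (h0 : 0 ≤ σ) (h1 : σ < 1) (y : ℝ) :
    HasDerivAt (velocityInv σ) ((1 + velocityInv σ y ^ 2) ^ (1 + σ / 2) *
      (1 + (1 - σ) * velocityInv σ y ^ 2)⁻¹) y := by
  have hp := one_add_sq_pos (velocityInv σ y)
  have h := HasDerivAt.of_local_left_inverse (continuous_velocityInv h0 h1).continuousAt
    (hasDerivAt_velocityMap σ (velocityInv σ y))
    (mul_pos (one_add_mul_sq_pos h1 _) (Real.rpow_pos_of_pos hp _)).ne'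
    (Eventually.of_forall (velocityMap_velocityInv h0 h1))
  rwa [mul_inv, Real.rpow_neg hp.le, inv_inv, mul_comm] at h

/-- The functions `uⁱ (1 + u²)^α (1 + (1 - σ) u²)^{-n}` at `u = φ⁻¹(y)`. -/
def symbolMonomial (σ : ℝ) (i : ℕ) (α : ℝ) (n : ℕ) (y : ℝ) : ℝ :=
  velocityInv σ y ^ i * (1 + velocityInv σ y ^ 2) ^ α * ((1 + (1 - σ) * velocityInv σ y ^ 2) ^ n)⁻¹

/-- The span of the monomials of order at most `m` in `u = φ⁻¹(y)`. -/
def symbolClass (σ m : ℝ) : Submodule ℝ (ℝ → ℝ) :=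
  Submodule.span ℝ {f | ∃ (i : ℕ) (α : ℝ) (n : ℕ), i + 2 * α - 2 * n ≤ m ∧
    f = symbolMonomial σ i α n}

theorem symbolMonomial_mem {i : ℕ} {α : ℝ} {n : ℕ} {m : ℝ} (h : i + 2 * α - 2 * n ≤ m) :
    symbolMonomial σ i α n ∈ symbolClass σ m := Submodule.subset_span ⟨i, α, n, h, rfl⟩

theorem symbolClass_mono {m m' : ℝ} (h : m ≤ m') : symbolClass σ m ≤ symbolClass σ m' :=
  Submodule.span_mono fun _ ⟨i, α, n, h', e⟩ => ⟨i, α, n, h'.trans h, e⟩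

theorem hasDerivAt_symbolMonomial (h0 : 0 ≤ σ) (h1 : σ < 1) (i : ℕ) (α : ℝ) (n : ℕ) (y : ℝ) :
    HasDerivAt (symbolMonomial σ i α n)
      (i * symbolMonomial σ (i - 1) (α + 1 + σ / 2) (n + 1) y +
        2 * α * symbolMonomial σ (i + 1) (α + σ / 2) (n + 1) y -
        2 * n * (1 - σ) * symbolMonomial σ (i + 1) (α + 1 + σ / 2) (n + 2) y) y := by
  have hψ := hasDerivAt_velocityInv h0 h1 y
  have hp := one_add_sq_pos (velocityInv σ y)
  have hq := one_add_mul_sq_pos h1 (velocityInv σ y)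
  have hQ1 : HasDerivAt (fun y => 1 + velocityInv σ y ^ 2) _ y := (hψ.pow 2).const_add 1
  have hQ2 : HasDerivAt (fun y => 1 + (1 - σ) * velocityInv σ y ^ 2) _ y :=
    ((hψ.pow 2).const_mul (1 - σ)).const_add 1
  have h := ((hψ.pow i).mul (hQ1.rpow_const (p := α) (Or.inl hp.ne'))).mul
    ((hQ2.pow n).inv (pow_pos hq n).ne')
  refine h.congr_deriv ?_
  simp only [symbolMonomial, Pi.mul_apply, Pi.pow_apply, Pi.inv_apply]
  set u := velocityInv σ y
  set P := 1 + u ^ 2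
  set Q := 1 + (1 - σ) * u ^ 2
  have e1 : P ^ (α + 1 + σ / 2) = P ^ α * P ^ (1 + σ / 2) := by
    rw [← Real.rpow_add hp]; congr 1; ring
  have e2 : P ^ (α + σ / 2) = P ^ (α - 1) * P ^ (1 + σ / 2) := by
    rw [← Real.rpow_add hp]; congr 1; ring
  rw [e1, e2]
  have hn : (n : ℝ) * Q ^ (n - 1) * Q = n * Q ^ n := by
    rcases n with _ | n
    · simp
    · rw [Nat.add_sub_cancel, pow_succ]; ring
  have hn' : (n : ℝ) * Q ^ (n - 1) = n * Q ^ n / Q := by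
    rw [← hn]; field_simp
  rw [hn']
  field_simp
  ring

/-- Since y grows like |u|^{1−σ}, the derivative du/dy has order σ in u, so d/dy lowers the order by
1 − σ. -/
theorem exists_hasDerivAt_of_mem_symbolClass (h0 : 0 ≤ σ) (h1 : σ < 1) {m : ℝ} {f : ℝ → ℝ}
    (hf : f ∈ symbolClass σ m) :
    ∃ f' ∈ symbolClass σ (m - (1 - σ)), ∀ y, HasDerivAt f (f' y) y := by
  induction hf using Submodule.span_induction with
  | mem f hf =>
    obtain ⟨i, α, n, h, rfl⟩ := hf
    refine ⟨(i : ℝ) • symbolMonomial σ (i - 1) (α + 1 + σ / 2) (n + 1) +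
      (2 * α) • symbolMonomial σ (i + 1) (α + σ / 2) (n + 1) -
        (2 * n * (1 - σ)) • symbolMonomial σ (i + 1) (α + 1 + σ / 2) (n + 2), ?_,
      fun y => hasDerivAt_symbolMonomial h0 h1 i α n y⟩
    refine Submodule.sub_mem _ (Submodule.add_mem _ ?_ ?_) ?_
    · rcases i with _ | i
      · simp
      · refine Submodule.smul_mem _ _ (symbolMonomial_mem ?_)
        push_cast at h ⊢
        linarith
    · refine Submodule.smul_mem _ _ (symbolMonomial_mem ?_)
      push_cast
      linarith
    · refine Submodule.smul_mem _ _ (symbolMonomial_mem ?_)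
      push_cast
      linarith
  | zero => exact ⟨0, Submodule.zero_mem _, fun y => hasDerivAt_const y 0⟩
  | add f g _ _ hf hg =>
    obtain ⟨f', h1, h2⟩ := hf
    obtain ⟨g', k1, k2⟩ := hg
    exact ⟨f' + g', Submodule.add_mem _ h1 k1, fun y => (h2 y).add (k2 y)⟩
  | smul a f _ hf =>
    obtain ⟨f', h1, h2⟩ := hf
    exact ⟨a • f', Submodule.smul_mem _ a h1, fun y => (h2 y).const_mul a⟩

theorem exists_bound_of_mem_symbolClass (h1 : σ < 1) {m : ℝ} {f : ℝ → ℝ}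
    (hf : f ∈ symbolClass σ m) :
    ∃ C, 0 ≤ C ∧ ∀ y, |f y| ≤ C * (1 + velocityInv σ y ^ 2) ^ (m / 2) := by
  induction hf using Submodule.span_induction with
  | mem f hf =>
    obtain ⟨i, α, n, h, rfl⟩ := hf
    have hs : 0 < 1 - σ := by linarith
    -- The bound 1 + (1−σ)u² ≥ min(1, 1−σ)(1 + u²) is what is needed; the summand 1 covers the case
    -- σ ≤ 0, where the minimum is 1.
    refine ⟨((1 - σ) ^ n)⁻¹ + 1, by positivity, fun y => ?_⟩
    rw [symbolMonomial]
    set u := velocityInv σ y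
    have hp := one_add_sq_pos u
    have hq := one_add_mul_sq_pos h1 u
    rw [abs_mul, abs_mul, abs_pow, abs_of_pos (Real.rpow_pos_of_pos hp α),
      abs_of_pos (inv_pos.2 (pow_pos hq n))]
    have e1 : |u| ^ i ≤ (1 + u ^ 2) ^ ((i : ℝ) / 2) := by
      have : |u| ^ i = (u ^ 2) ^ ((i : ℝ) / 2) := by
        rw [← sq_abs, ← Real.rpow_natCast (|u|) 2, ← Real.rpow_mul (abs_nonneg u),
          ← Real.rpow_natCast]
        congr 1
        push_cast
        ring
      rw [this]
      exact Real.rpow_le_rpow (sq_nonneg u) (by linarith) (by positivity)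
    have e2 : ((1 + (1 - σ) * u ^ 2) ^ n)⁻¹ ≤ (((1 - σ) ^ n)⁻¹ + 1) * (1 + u ^ 2) ^ (-(n : ℝ)) := by
      rcases le_total σ 0 with hσ | hσ
      · have h5 : (1 + u ^ 2) ^ n ≤ (1 + (1 - σ) * u ^ 2) ^ n := by
          gcongr
          nlinarith [sq_nonneg u]
        have h6 : 0 < (1 + u ^ 2) ^ n := by positivity
        rw [Real.rpow_neg hp.le, Real.rpow_natCast]
        have h7 : 0 ≤ ((1 - σ) ^ n)⁻¹ := by positivity
        calc _ ≤ ((1 + u ^ 2) ^ n)⁻¹ := by gcongr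
          _ ≤ _ := by
            have := mul_nonneg h7 (inv_pos.2 h6).le
            linarith
      · have h5 : ((1 - σ) * (1 + u ^ 2)) ^ n ≤ (1 + (1 - σ) * u ^ 2) ^ n := by
          gcongr
          nlinarith [sq_nonneg u]
        have h6 : 0 < (1 + u ^ 2) ^ n := by positivity
        rw [Real.rpow_neg hp.le, Real.rpow_natCast]
        calc _ ≤ (((1 - σ) * (1 + u ^ 2)) ^ n)⁻¹ := by gcongr
          _ = ((1 - σ) ^ n)⁻¹ * ((1 + u ^ 2) ^ n)⁻¹ := by rw [mul_pow, mul_inv]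
          _ ≤ _ := by
            have := (inv_pos.2 h6).le
            linarith
    have hα := Real.rpow_pos_of_pos hp α
    calc |u| ^ i * (1 + u ^ 2) ^ α * ((1 + (1 - σ) * u ^ 2) ^ n)⁻¹
        ≤ (1 + u ^ 2) ^ ((i : ℝ) / 2) * (1 + u ^ 2) ^ α *
          ((((1 - σ) ^ n)⁻¹ + 1) * (1 + u ^ 2) ^ (-(n : ℝ))) := by
          gcongr
      _ = (((1 - σ) ^ n)⁻¹ + 1) * (1 + u ^ 2) ^ ((i : ℝ) / 2 + α + -(n : ℝ)) := by
          rw [Real.rpow_add hp, Real.rpow_add hp]; ring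
      _ ≤ (((1 - σ) ^ n)⁻¹ + 1) * (1 + u ^ 2) ^ (m / 2) := by
          gcongr
          · nlinarith [sq_nonneg u]
          · linarith
  | zero => exact ⟨0, le_rfl, fun y => by simp⟩
  | add f g _ _ hf hg =>
    obtain ⟨A, hA, h2⟩ := hf
    obtain ⟨B, hB, k2⟩ := hg
    refine ⟨A + B, by positivity, fun y => ?_⟩
    rw [add_mul]
    exact (abs_add_le _ _).trans (add_le_add (h2 y) (k2 y))
  | smul a f _ hf =>
    obtain ⟨A, hA, h2⟩ := hf
    refine ⟨|a| * A, by positivity, fun y => ?_⟩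
    rw [Pi.smul_apply, smul_eq_mul, abs_mul, mul_assoc]
    exact mul_le_mul_of_nonneg_left (h2 y) (abs_nonneg a)

theorem deriv_mem_symbolClass (h0 : 0 ≤ σ) (h1 : σ < 1) {m : ℝ} {f : ℝ → ℝ}
    (hf : f ∈ symbolClass σ m) : deriv f ∈ symbolClass σ (m - (1 - σ)) := by
  obtain ⟨f', h2, h3⟩ := exists_hasDerivAt_of_mem_symbolClass h0 h1 hf
  rwa [show deriv f = f' from funext fun y => (h3 y).deriv]

theorem contDiff_of_mem_symbolClass (h0 : 0 ≤ σ) (h1 : σ < 1) {m : ℝ} {f : ℝ → ℝ}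
    (hf : f ∈ symbolClass σ m) : ContDiff ℝ ∞ f := by
  refine contDiff_infty.2 fun n => ?_
  induction n generalizing m f with
  | zero =>
    obtain ⟨f', -, h3⟩ := exists_hasDerivAt_of_mem_symbolClass h0 h1 hf
    exact contDiff_zero.2 (continuous_iff_continuousAt.2 fun y => (h3 y).continuousAt)
  | succ n ih =>
    obtain ⟨f', -, h3⟩ := exists_hasDerivAt_of_mem_symbolClass h0 h1 hf
    have := contDiff_succ_iff_deriv (𝕜 := ℝ) (f := f) (n := n)
    exact_mod_cast this.2 ⟨fun y => (h3 y).differentiableAt, by simp,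
      ih (deriv_mem_symbolClass h0 h1 hf)⟩

theorem iteratedDeriv_mem_symbolClass (h0 : 0 ≤ σ) (h1 : σ < 1) {m : ℝ} {f : ℝ → ℝ}
    (hf : f ∈ symbolClass σ m) (i : ℕ) : iteratedDeriv i f ∈ symbolClass σ m := by
  induction i with
  | zero => simpa
  | succ i ih =>
    rw [iteratedDeriv_succ]
    exact symbolClass_mono (by linarith) (deriv_mem_symbolClass h0 h1 ih)

/-- Differentiation never raises the order, so a weight adapted to f serves for all its derivatives.
-/
theorem weightedSymbol_of_mem_symbolClass (h0 : 0 ≤ σ) (h1 : σ < 1) {m : ℝ} {f ρ : ℝ → ℝ}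
    (hf : f ∈ symbolClass σ m) (hρ : ∀ y, |ρ y| ≤ (1 + velocityInv σ y ^ 2) ^ (-m / 2)) :
    WeightedSymbol ρ f := by
  refine ⟨contDiff_of_mem_symbolClass h0 h1 hf, fun i => ?_⟩
  obtain ⟨C, hC, h⟩ := exists_bound_of_mem_symbolClass h1 (iteratedDeriv_mem_symbolClass h0 h1 hf i)
  refine ⟨C, fun y => ?_⟩
  rw [abs_mul]
  have hp := one_add_sq_pos (velocityInv σ y)
  calc |ρ y| * |iteratedDeriv i f y|
      ≤ (1 + velocityInv σ y ^ 2) ^ (-m / 2) * (C * (1 + velocityInv σ y ^ 2) ^ (m / 2)) := by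
        gcongr
        · exact hρ y
        · exact h y
    _ = C * (1 + velocityInv σ y ^ 2) ^ (-m / 2 + m / 2) := by
        rw [Real.rpow_add hp]; ring
    _ = C := by rw [neg_div, neg_add_cancel, Real.rpow_zero, mul_one]

/-- The entries of `B` as functions of `y = φ(u)`. -/
def coeffB (σ : ℝ) (i j : Fin 2) (y : ℝ) : ℝ := matrixB σ (velocityInv σ y) i j

/-- The symmetrizer of `B` is `diag (symmetrizer, 1)`. -/
def symmetrizer (σ y : ℝ) : ℝ :=
  σ * (1 + velocityInv σ y ^ 2) ^ (-σ) * (1 + (1 - σ) * velocityInv σ y ^ 2)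

theorem coeffB_zero_zero : coeffB σ 0 0 = (-1 : ℝ) • symbolMonomial σ 1 (-(1 / 2)) 0 := by
  funext y
  have hp := one_add_sq_pos (velocityInv σ y)
  simp [coeffB, matrixB, symbolMonomial, Real.sqrt_eq_rpow, Real.rpow_neg hp.le, div_eq_mul_inv]

theorem coeffB_zero_one : coeffB σ 0 1 = (-1 : ℝ) • symbolMonomial σ 0 (-((1 - σ) / 2)) 1 := by
  funext y
  have hp := one_add_sq_pos (velocityInv σ y)
  simp [coeffB, matrixB, symbolMonomial, Real.rpow_neg hp.le, mul_comm]

theorem coeffB_one_zero : coeffB σ 1 0 = (-σ) • symbolMonomial σ 0 (-((1 + σ) / 2)) 0 := by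
  funext y
  have hp := one_add_sq_pos (velocityInv σ y)
  simp [coeffB, matrixB, symbolMonomial, Real.rpow_neg hp.le, div_eq_mul_inv]

theorem coeffB_one_one : coeffB σ 1 1 = (2 * σ - 1) • symbolMonomial σ 1 (-(1 / 2)) 1 +
    (-(1 - σ)) • symbolMonomial σ 3 (-(1 / 2)) 1 := by
  funext y
  have hp := one_add_sq_pos (velocityInv σ y)
  simp [coeffB, matrixB, symbolMonomial, Real.sqrt_eq_rpow, Real.rpow_neg hp.le, div_eq_mul_inv]
  ring

theorem symmetrizer_eq : symmetrizer σ = σ • symbolMonomial σ 0 (-σ) 0 +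
    (σ * (1 - σ)) • symbolMonomial σ 2 (-σ) 0 := by
  funext y
  simp [symmetrizer, symbolMonomial]
  ring

theorem symmetrizer_mul_coeffB_zero_zero : symmetrizer σ * coeffB σ 0 0 =
    (-σ) • symbolMonomial σ 1 (-σ - 1 / 2) 0 +
      (-(σ * (1 - σ))) • symbolMonomial σ 3 (-σ - 1 / 2) 0 := by
  funext y
  have hp := one_add_sq_pos (velocityInv σ y)
  have e : (1 + velocityInv σ y ^ 2) ^ (-σ - 1 / 2) =
      (1 + velocityInv σ y ^ 2) ^ (-σ) * (1 + velocityInv σ y ^ 2) ^ (-(1 / 2) : ℝ) := by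
    rw [← Real.rpow_add hp]; congr 1
  simp only [symmetrizer_eq, coeffB_zero_zero, symbolMonomial, Pi.mul_apply, Pi.add_apply,
    Pi.smul_apply, smul_eq_mul, e]
  ring

theorem symmetrizer_mul_coeffB_zero_one (h1 : σ < 1) (y : ℝ) :
    symmetrizer σ y * coeffB σ 0 1 y = coeffB σ 1 0 y := by
  have hp := one_add_sq_pos (velocityInv σ y)
  have hq := one_add_mul_sq_pos h1 (velocityInv σ y)
  have e : (1 + velocityInv σ y ^ 2) ^ (-((1 + σ) / 2)) =
      (1 + velocityInv σ y ^ 2) ^ (-σ) * (1 + velocityInv σ y ^ 2) ^ (-((1 - σ) / 2)) := by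
    rw [← Real.rpow_add hp]; congr 1; ring
  simp only [symmetrizer, coeffB_zero_one, coeffB_one_zero, symbolMonomial,
    Pi.smul_apply, smul_eq_mul, e]
  generalize 1 + (1 - σ) * velocityInv σ y ^ 2 = Q at hq
  field_simp

theorem coeffB_mem_zero (h0 : 0 ≤ σ) (h1 : σ < 1) (i j : Fin 2) :
    coeffB σ i j ∈ symbolClass σ 0 := by
  fin_cases i <;> fin_cases j
  · change coeffB σ 0 0 ∈ _
    rw [coeffB_zero_zero]
    exact Submodule.smul_mem _ _ (symbolMonomial_mem (by norm_num))
  · change coeffB σ 0 1 ∈ _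
    rw [coeffB_zero_one]
    exact Submodule.smul_mem _ _ (symbolMonomial_mem (by push_cast; linarith))
  · change coeffB σ 1 0 ∈ _
    rw [coeffB_one_zero]
    exact Submodule.smul_mem _ _ (symbolMonomial_mem (by push_cast; linarith))
  · change coeffB σ 1 1 ∈ _
    rw [coeffB_one_one]
    exact Submodule.add_mem _ (Submodule.smul_mem _ _ (symbolMonomial_mem (by norm_num)))
      (Submodule.smul_mem _ _ (symbolMonomial_mem (by norm_num)))

theorem symmetrizer_mem : symmetrizer σ ∈ symbolClass σ (2 * (1 - σ)) := by
  rw [symmetrizer_eq]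
  exact Submodule.add_mem _ (Submodule.smul_mem _ _ (symbolMonomial_mem (by push_cast; linarith)))
      (Submodule.smul_mem _ _ (symbolMonomial_mem (by push_cast; linarith)))

theorem symmetrizer_mul_mem : symmetrizer σ * coeffB σ 0 0 ∈ symbolClass σ (2 * (1 - σ)) := by
  rw [symmetrizer_mul_coeffB_zero_zero]
  exact Submodule.add_mem _ (Submodule.smul_mem _ _ (symbolMonomial_mem (by push_cast; linarith)))
      (Submodule.smul_mem _ _ (symbolMonomial_mem (by push_cast; linarith)))

theorem le_symmetrizer (h0 : 0 ≤ σ) (y : ℝ) :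
    σ * (1 - σ) * (1 + velocityInv σ y ^ 2) ^ (1 - σ) ≤ symmetrizer σ y := by
  have hp := one_add_sq_pos (velocityInv σ y)
  have e : (1 + velocityInv σ y ^ 2) ^ (1 - σ) =
      (1 + velocityInv σ y ^ 2) ^ (-σ) * (1 + velocityInv σ y ^ 2) := by
    rw [← Real.rpow_add_one hp.ne']; congr 1; ring
  rw [e, symmetrizer]
  have := mul_nonneg h0 (Real.rpow_pos_of_pos hp (-σ)).le
  have h2 : (1 - σ) * (1 + velocityInv σ y ^ 2) ≤ 1 + (1 - σ) * velocityInv σ y ^ 2 := by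
    linarith
  calc _ = σ * (1 + velocityInv σ y ^ 2) ^ (-σ) * ((1 - σ) * (1 + velocityInv σ y ^ 2)) := by ring
    _ ≤ _ := mul_le_mul_of_nonneg_left h2 this

theorem symmetrizer_le (h0 : 0 ≤ σ) (h1 : σ < 1) (y : ℝ) :
    symmetrizer σ y ≤ (1 + velocityInv σ y ^ 2) ^ (1 - σ) := by
  have hp := one_add_sq_pos (velocityInv σ y)
  have e : (1 + velocityInv σ y ^ 2) ^ (1 - σ) =
      (1 + velocityInv σ y ^ 2) ^ (-σ) * (1 + velocityInv σ y ^ 2) := by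
    rw [← Real.rpow_add_one hp.ne']; congr 1; ring
  rw [e, symmetrizer]
  have := (Real.rpow_pos_of_pos hp (-σ)).le
  have h2 : σ * (1 + (1 - σ) * velocityInv σ y ^ 2) ≤ 1 + velocityInv σ y ^ 2 := by
    have h3 := sq_nonneg (velocityInv σ y)
    have h4 := mul_nonneg h0 h3
    have h5 := mul_nonneg h0 h4
    nlinarith [mul_nonneg (sub_nonneg.2 h1.le) h3]
  calc _ = (1 + velocityInv σ y ^ 2) ^ (-σ) * (σ * (1 + (1 - σ) * velocityInv σ y ^ 2)) := by ring
    _ ≤ _ := mul_le_mul_of_nonneg_left h2 this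

theorem const_le_symmetrizer (h0 : 0 ≤ σ) (h1 : σ < 1) (y : ℝ) :
    σ * (1 - σ) ≤ symmetrizer σ y := by
  refine le_trans ?_ (le_symmetrizer h0 y)
  have h2 : 1 ≤ (1 + velocityInv σ y ^ 2) ^ (1 - σ) :=
    Real.one_le_rpow (by nlinarith [sq_nonneg (velocityInv σ y)]) (by linarith)
  have := mul_nonneg h0 (sub_nonneg.2 h1.le)
  nlinarith

theorem symmetrizer_nonneg (h0 : 0 ≤ σ) (h1 : σ < 1) (y : ℝ) : 0 ≤ symmetrizer σ y :=
  (mul_nonneg h0 (sub_nonneg.2 h1.le)).trans (const_le_symmetrizer h0 h1 y)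

theorem contDiff_symmetrizer (h0 : 0 ≤ σ) (h1 : σ < 1) : ContDiff ℝ ∞ (symmetrizer σ) :=
  contDiff_of_mem_symbolClass h0 h1 symmetrizer_mem

/-- This is the compatibility of the symmetrizer with the singular term. -/
theorem mul_deriv_symmetrizer_le (h0 : 0 ≤ σ) (h1 : σ < 1) (y : ℝ) :
    y * deriv (symmetrizer σ) y ≤ 2 * symmetrizer σ y := by
  have hp := one_add_sq_pos (velocityInv σ y)
  have hq := one_add_mul_sq_pos h1 (velocityInv σ y)
  have h := ((hasDerivAt_symbolMonomial h0 h1 0 (-σ) 0 y).const_mul σ).add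
    ((hasDerivAt_symbolMonomial h0 h1 2 (-σ) 0 y).const_mul (σ * (1 - σ)))
  have hd := h.deriv
  rw [show ((fun y => σ * symbolMonomial σ 0 (-σ) 0 y) +
    fun y => σ * (1 - σ) * symbolMonomial σ 2 (-σ) 0 y) = symmetrizer σ from
    symmetrizer_eq.symm] at hd
  clear h
  have hy : y = velocityInv σ y * (1 + velocityInv σ y ^ 2) ^ (-(σ / 2)) := by
    conv_lhs => rw [← velocityMap_velocityInv h0 h1 y]
    rw [velocityMap, Real.rpow_neg hp.le, div_eq_mul_inv]
  rw [hd, symmetrizer]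
  simp only [symbolMonomial]
  generalize velocityInv σ y = u at *
  have e1 : (1 + u ^ 2) ^ (-σ + 1 + σ / 2) = (1 + u ^ 2) ^ (-(σ / 2)) * (1 + u ^ 2) := by
    rw [← Real.rpow_add_one hp.ne']; congr 1; ring
  have e2 : (1 + u ^ 2) ^ (-σ + σ / 2) = (1 + u ^ 2) ^ (-(σ / 2)) := by congr 1; ring
  have e3 : (1 + u ^ 2) ^ (-σ) = (1 + u ^ 2) ^ (-(σ / 2)) * (1 + u ^ 2) ^ (-(σ / 2)) := by
    rw [← Real.rpow_add hp]; congr 1; ring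
  rw [e1, e2, e3, hy]
  generalize (1 + u ^ 2) ^ (-(σ / 2)) = p
  rw [← sub_nonneg]
  -- As |u| → ∞ the symmetriser is comparable to y², for which y s' = 2s exactly, so the inequality
  -- is borderline. The difference is computed explicitly: it equals 2σ(1+u²)^{1−σ}/(1+(1−σ)u²),
  -- since p² = (1+u²)^{−σ}.
  have key : 2 * (σ * (p * p) * (1 + (1 - σ) * u ^ 2)) - u * p *
      (σ * (((0 : ℕ) : ℝ) * (u ^ (0 - 1) * (p * (1 + u ^ 2)) * ((1 + (1 - σ) * u ^ 2) ^ (0 + 1))⁻¹) +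
        2 * -σ * (u ^ (0 + 1) * p * ((1 + (1 - σ) * u ^ 2) ^ (0 + 1))⁻¹) -
        2 * ((0 : ℕ) : ℝ) * (1 - σ) *
          (u ^ (0 + 1) * (p * (1 + u ^ 2)) * ((1 + (1 - σ) * u ^ 2) ^ (0 + 2))⁻¹)) +
      σ * (1 - σ) * (((2 : ℕ) : ℝ) * (u ^ (2 - 1) * (p * (1 + u ^ 2)) *
          ((1 + (1 - σ) * u ^ 2) ^ (0 + 1))⁻¹) +
        2 * -σ * (u ^ (2 + 1) * p * ((1 + (1 - σ) * u ^ 2) ^ (0 + 1))⁻¹) -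
        2 * ((0 : ℕ) : ℝ) * (1 - σ) *
          (u ^ (2 + 1) * (p * (1 + u ^ 2)) * ((1 + (1 - σ) * u ^ 2) ^ (0 + 2))⁻¹))) =
      2 * σ * p ^ 2 * (1 + u ^ 2) / (1 + (1 - σ) * u ^ 2) := by
    simp
    field_simp
    ring
  rw [key]
  positivity

/-- The derivative has order 1 − σ, below the order 2(1 − σ) of the lower bound for s. Applied to s
and to s b₀₀, it bounds the regular part of the rate of change of the energy by the energy itself.
-/
theorem exists_abs_deriv_le_symmetrizer (h0 : 0 < σ) (h1 : σ < 1) {f : ℝ → ℝ}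
    (hf : f ∈ symbolClass σ (2 * (1 - σ))) :
    ∃ C, 0 ≤ C ∧ ∀ y, |deriv f y| ≤ C * symmetrizer σ y := by
  obtain ⟨C, hC, h⟩ := exists_bound_of_mem_symbolClass h1 (deriv_mem_symbolClass h0.le h1 hf)
  have hc : 0 < σ * (1 - σ) := mul_pos h0 (by linarith)
  refine ⟨C * (σ * (1 - σ))⁻¹, by positivity, fun y => (h y).trans ?_⟩
  rw [mul_assoc]
  refine mul_le_mul_of_nonneg_left ?_ hC
  rw [inv_mul_eq_div, le_div_iff₀ hc, mul_comm]
  refine le_trans ?_ (le_symmetrizer h0.le y)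
  refine mul_le_mul_of_nonneg_left ?_ hc.le
  exact Real.rpow_le_rpow_of_exponent_le (by nlinarith [sq_nonneg (velocityInv σ y)]) (by linarith)

theorem weightedSymbol_coeffB (h0 : 0 ≤ σ) (h1 : σ < 1) (i j : Fin 2) :
    WeightedSymbol (fun _ => 1) (coeffB σ i j) :=
  weightedSymbol_of_mem_symbolClass h0 h1 (coeffB_mem_zero h0 h1 i j) fun y => by simp

/-- The square root of the symmetrizer. -/
def energyWeight (σ y : ℝ) : ℝ := √(symmetrizer σ y)

theorem continuous_energyWeight (h0 : 0 ≤ σ) (h1 : σ < 1) : Continuous (energyWeight σ) :=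
  (contDiff_symmetrizer h0 h1).continuous.sqrt

/-- The orders match exactly: b' has order −(1 − σ) and √s has order 1 − σ. This is why the growth
of the symmetriser does not spoil the commutators. -/
theorem weightedSymbol_deriv_coeffB (h0 : 0 ≤ σ) (h1 : σ < 1) (i j : Fin 2) :
    WeightedSymbol (energyWeight σ) (deriv (coeffB σ i j)) := by
  refine weightedSymbol_of_mem_symbolClass h0 h1
    (deriv_mem_symbolClass h0 h1 (coeffB_mem_zero h0 h1 i j)) fun y => ?_
  have hp := one_add_sq_pos (velocityInv σ y)
  rw [energyWeight, abs_of_nonneg (Real.sqrt_nonneg _)]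
  refine Real.sqrt_le_iff.2 ⟨(Real.rpow_pos_of_pos hp _).le, (symmetrizer_le h0 h1 y).trans ?_⟩
  rw [← Real.rpow_natCast (_ ^ (_ : ℝ)) 2, ← Real.rpow_mul hp.le]
  refine le_of_eq ?_
  congr 1
  push_cast
  ring

end Symbols

end

noncomputable section

variable {L : ℝ} [Fact (0 < L)]

set_option linter.unusedSectionVars false

/-! ## Components of vector-valued functions -/

/-- The components of a vector-valued `L²` function. -/
def compL2 (i : Fin 2) : CircleL2 L →L[ℝ] ScalarL2 L :=
  (EuclideanSpace.proj i : Vec2 →L[ℝ] ℝ).compLpL 2 volume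

theorem compL2_ae (i : Fin 2) (U : CircleL2 L) :
    (compL2 i U : AddCircle L → ℝ) =ᵐ[volume] fun x => U x i :=
  (EuclideanSpace.proj i : Vec2 →L[ℝ] ℝ).coeFn_compLpL U

/-- The inclusion of scalar functions as one component. -/
def inclL2 (i : Fin 2) : ScalarL2 L →L[ℝ] CircleL2 L :=
  (ContinuousLinearMap.toSpanSingleton ℝ (EuclideanSpace.single i (1 : ℝ) : Vec2)).compLpL 2 volume

theorem inclL2_ae (i : Fin 2) (f : ScalarL2 L) :
    (inclL2 i f : AddCircle L → Vec2) =ᵐ[volume] fun x => f x • EuclideanSpace.single i (1 : ℝ) :=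
  (ContinuousLinearMap.toSpanSingleton ℝ (EuclideanSpace.single i (1 : ℝ) : Vec2)).coeFn_compLpL f

theorem eq_inclL2_add (U : CircleL2 L) : U = inclL2 0 (compL2 0 U) + inclL2 1 (compL2 1 U) := by
  refine Lp.ext ?_
  filter_upwards [Lp.coeFn_add (inclL2 0 (compL2 0 U)) (inclL2 1 (compL2 1 U)),
    inclL2_ae 0 (compL2 0 U), inclL2_ae 1 (compL2 1 U), compL2_ae 0 U, compL2_ae 1 U]
    with x h1 h2 h3 h4 h5
  rw [h1, Pi.add_apply, h2, h3, h4, h5]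
  ext i
  fin_cases i <;> simp

theorem norm_sq_eq_compL2 (U : CircleL2 L) : ‖U‖ ^ 2 = ‖compL2 0 U‖ ^ 2 + ‖compL2 1 U‖ ^ 2 := by
  rw [← real_inner_self_eq_norm_sq, ← real_inner_self_eq_norm_sq, ← real_inner_self_eq_norm_sq,
    L2.inner_def, L2.inner_def, L2.inner_def,
    ← integral_add (L2.integrable_inner _ _) (L2.integrable_inner _ _)]
  refine integral_congr_ae ?_
  filter_upwards [compL2_ae 0 U, compL2_ae 1 U] with x h1 h2
  rw [h1, h2, PiLp.inner_apply, Fin.sum_univ_two]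

theorem norm_compL2_le (i : Fin 2) (U : CircleL2 L) : ‖compL2 i U‖ ≤ ‖U‖ := by
  have h := norm_sq_eq_compL2 U
  refine abs_le_of_sq_le_sq' ?_ (norm_nonneg _) |>.2
  fin_cases i
  · change ‖compL2 0 U‖ ^ 2 ≤ _
    nlinarith [sq_nonneg ‖compL2 1 U‖]
  · change ‖compL2 1 U‖ ^ 2 ≤ _
    nlinarith [sq_nonneg ‖compL2 0 U‖]

/-! ## Smooth functions on the circle -/

theorem circleDeriv_coe (v : AddCircle L → Vec2) (s : ℝ) :
    circleDeriv v (s : AddCircle L) = deriv (fun r : ℝ => v (r : AddCircle L)) s := by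
  have h := deriv_comp_const_add (f := fun r : ℝ => v (r : AddCircle L)) s 0
  rw [add_zero] at h
  rw [← h]
  simp only [AddCircle.coe_add]
  rfl

theorem CircleContDiff.circleDeriv {v : AddCircle L → Vec2} (hv : CircleContDiff ∞ v) :
    CircleContDiff ∞ (circleDeriv v) := by
  have : (fun s : ℝ => _root_.circleDeriv v (s : AddCircle L)) =
      deriv fun r : ℝ => v (r : AddCircle L) := funext fun s => circleDeriv_coe v s
  rw [CircleContDiff, this]
  exact (contDiff_infty_iff_deriv.1 hv).2

theorem CircleContDiff.iterate {v : AddCircle L → Vec2} (hv : CircleContDiff ∞ v) (ℓ : ℕ) :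
    CircleContDiff ∞ (_root_.circleDeriv^[ℓ] v) := by
  induction ℓ with
  | zero => exact hv
  | succ ℓ ih =>
    rw [Function.iterate_succ_apply']
    exact ih.circleDeriv

theorem CircleContDiff.continuous {n : WithTop ℕ∞} {v : AddCircle L → Vec2}
    (hv : CircleContDiff n v) : Continuous v :=
  isQuotientMap_quotient_mk'.continuous_iff.2 (ContDiff.continuous hv)

theorem CircleContDiff.hasDerivAt {v : AddCircle L → Vec2} (hv : CircleContDiff ∞ v) (s : ℝ) :
    HasDerivAt (fun r : ℝ => v (r : AddCircle L)) (_root_.circleDeriv v (s : AddCircle L)) s := by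
  rw [circleDeriv_coe]
  exact ((ContDiff.differentiable hv (by simp)) s).hasDerivAt

/-- The components of a continuous vector-valued function. -/
def compC2 (i : Fin 2) (v : AddCircle L → Vec2) (hv : Continuous v) : CircleC L :=
  ⟨fun x => v x i, by fun_prop⟩

theorem CircleContDiff.inH1 {v : AddCircle L → Vec2} (hv : CircleContDiff ∞ v) (i : Fin 2) :
    InH1 (toL2 (compC2 i v hv.continuous)) (toL2 (compC2 i _ hv.circleDeriv.continuous)) := by
  refine InH1.of_smooth ?_ fun s => ?_
  · exact (EuclideanSpace.proj i : Vec2 →L[ℝ] ℝ).contDiff.comp (hv : ContDiff ℝ ∞ _)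
  · exact (EuclideanSpace.proj i : Vec2 →L[ℝ] ℝ).hasFDerivAt.comp_hasDerivAt s (hv.hasDerivAt s)

/-! ## Components of Sobolev functions -/

/-- The `i`-th component of the entry of order `ℓ` of a jet. -/
def jetComp (k : ℕ) (i : Fin 2) (ℓ : ℕ) : JetL2 L k →L[ℝ] ScalarL2 L :=
  if h : ℓ < k + 1 then (compL2 i).comp (PiLp.proj 2 (fun _ : Fin (k + 1) => CircleL2 L) ⟨ℓ, h⟩)
  else 0

theorem jetComp_of_lt {k ℓ : ℕ} (i : Fin 2) (h : ℓ < k + 1) (U : JetL2 L k) :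
    jetComp k i ℓ U = compL2 i (U ⟨ℓ, h⟩) := by
  rw [jetComp, dif_pos h]; rfl

/-- The `i`-th component of the derivative of order `ℓ` of a Sobolev function. -/
def sobComp {k : ℕ} (i : Fin 2) (ℓ : ℕ) : sobolev L k →L[ℝ] ScalarL2 L :=
  (jetComp k i ℓ).comp (sobolev L k).subtypeL

theorem sobComp_of_lt {k ℓ : ℕ} (i : Fin 2) (h : ℓ < k + 1) (u : sobolev L k) :
    sobComp i ℓ u = compL2 i ((u : JetL2 L k) ⟨ℓ, h⟩) := jetComp_of_lt i h _

theorem sobComp_incl {j k : ℕ} (h : j ≤ k) (i : Fin 2) {ℓ : ℕ} (hℓ : ℓ ≤ j) (u : sobolev L k) :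
    sobComp i ℓ (sobolevIncl h u) = sobComp i ℓ u := by
  rw [sobComp_of_lt i (Nat.lt_succ_of_le hℓ), sobComp_of_lt i (Nat.lt_succ_of_le (hℓ.trans h))]
  rfl

/-- The relation is closed and linear in the jet, so it is enough to verify it on smooth jets. -/
theorem inH1_sobComp {k ℓ : ℕ} (h : ℓ < k) (i : Fin 2) (u : sobolev L k) :
    InH1 (sobComp i ℓ u) (sobComp i (ℓ + 1) u) := by
  have hle : sobolev L k ≤ (smoothGraph L).topologicalClosure.comap
      ((jetComp k i ℓ).prod (jetComp k i (ℓ + 1))).toLinearMap := by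
    refine Submodule.topologicalClosure_minimal _ (Submodule.span_le.2 ?_)
      ((Submodule.isClosed_topologicalClosure _).preimage (ContinuousLinearMap.continuous _))
    rintro V ⟨v, hv, hV⟩
    change InH1 (jetComp k i ℓ V) (jetComp k i (ℓ + 1) V)
    have key : ∀ (m : ℕ) (hm : m < k + 1), jetComp k i m V =
        toL2 (compC2 i _ (hv.iterate m).continuous) := by
      intro m hm
      rw [jetComp_of_lt i hm]
      refine Lp.ext ?_
      filter_upwards [compL2_ae i (V ⟨m, hm⟩), hV ⟨m, hm⟩,
        toL2_ae (compC2 i _ (hv.iterate m).continuous)] with x h1 h2 h3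
      rw [h1, h2, h3]; rfl
    rw [key ℓ (by omega), key (ℓ + 1) (by omega)]
    have := (hv.iterate ℓ).inH1 i
    simp only [Function.iterate_succ_apply']
    exact this
  exact hle u.2

theorem norm_sq_eq_sobComp {k : ℕ} (u : sobolev L k) :
    ‖u‖ ^ 2 = ∑ ℓ ∈ Finset.range (k + 1), (‖sobComp 0 ℓ u‖ ^ 2 + ‖sobComp 1 ℓ u‖ ^ 2) := by
  rw [Submodule.coe_norm, PiLp.norm_sq_eq_of_L2, Finset.sum_range]
  refine Finset.sum_congr rfl fun ℓ _ => ?_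
  rw [sobComp_of_lt 0 ℓ.2, sobComp_of_lt 1 ℓ.2, norm_sq_eq_compL2]

theorem norm_sobComp_le {k : ℕ} (i : Fin 2) (ℓ : ℕ) (u : sobolev L k) : ‖sobComp i ℓ u‖ ≤ ‖u‖ := by
  by_cases h : ℓ < k + 1
  · rw [sobComp_of_lt i h]
    exact (norm_compL2_le i _).trans (PiLp.norm_apply_le (u : JetL2 L k) ⟨ℓ, h⟩)
  · have : sobComp i ℓ u = 0 := by
      rw [sobComp, jetComp, dif_neg h]; rfl
    rw [this, norm_zero]
    exact norm_nonneg u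

theorem sobLe_sobComp {k ℓ j : ℕ} (h : ℓ + j ≤ k) (i : Fin 2) (u : sobolev L k) :
    SobLe j (sobComp i ℓ u) ‖u‖ :=
  SobLe.of_forall (u := fun ℓ => sobComp i ℓ u) (fun r _ => inH1_sobComp (by omega) i u)
    fun _ _ => norm_sobComp_le i _ u

theorem iterDx_sobComp {k ℓ : ℕ} (h : ℓ ≤ k) (i : Fin 2) (u : sobolev L k) :
    IterDx ℓ (sobComp i 0 u) (sobComp i ℓ u) := by
  have := IterDx.of_forall (u := fun ℓ => sobComp i ℓ u) (j := ℓ) (m := 0)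
    fun r _ => inH1_sobComp (by omega) i u
  simpa using this

theorem iterDx_sobComp_one {k ℓ : ℕ} (h : ℓ + 1 ≤ k) (i : Fin 2) (u : sobolev L k) :
    IterDx ℓ (sobComp i 1 u) (sobComp i (ℓ + 1) u) := by
  have := IterDx.of_forall (u := fun ℓ => sobComp i ℓ u) (j := ℓ) (m := 1)
    fun r _ => inH1_sobComp (by omega) i u
  rwa [add_comm 1 ℓ] at this

theorem exists_toL2_sobComp {k ℓ : ℕ} (h : ℓ < k) (i : Fin 2) (u : sobolev L k) :
    ∃ c : CircleC L, toL2 c = sobComp i ℓ u := (inH1_sobComp h i u).exists_toL2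

theorem sobComp_ext {k : ℕ} {u v : sobolev L k}
    (h : ∀ ℓ ≤ k, ∀ i, sobComp i ℓ u = sobComp i ℓ v) : u = v := by
  rw [← sub_eq_zero, ← norm_eq_zero, ← sq_eq_zero_iff, norm_sq_eq_sobComp]
  refine Finset.sum_eq_zero fun ℓ hℓ => ?_
  have hℓ' : ℓ ≤ k := Nat.lt_succ_iff.1 (Finset.mem_range.1 hℓ)
  rw [map_sub, map_sub, h ℓ hℓ' 0, h ℓ hℓ' 1]
  simp

theorem sobolevFun_ae {k : ℕ} (u : sobolev L k) (i : Fin 2) :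
    (sobComp i 0 u : AddCircle L → ℝ) =ᵐ[volume] fun x => sobolevFun u x i := by
  rw [sobComp_of_lt i (Nat.succ_pos k)]
  exact compL2_ae i _

theorem sobolevDx_ae {k : ℕ} (hk : 1 ≤ k) (u : sobolev L k) (i : Fin 2) :
    (sobComp i 1 u : AddCircle L → ℝ) =ᵐ[volume] fun x => sobolevDx hk u x i := by
  rw [sobComp_of_lt i (Nat.lt_succ_of_le hk)]
  exact compL2_ae i _

/-! ## The embedding in Hölder spaces -/

/-- The C^m representative is built from the continuous representatives of all derivatives up to
order m. Each of the m + 1 suprema costs 4 `supConst L` (a factor 2 for the two components, a factor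
2 for the two L² norms in the embedding), and the seminorm costs 2, the exponent 1/2 being that of
Cauchy–Schwarz. -/
theorem holderENorm_le {k m : ℕ} (hk : k = m + 1) (u : sobolev L k) :
    holderENorm m (1 / 2) (sobolevFun u) ≤
      ENNReal.ofReal (((m + 1) * (4 * supConst L) + 2) * ‖u‖) := by
  -- Orders above m, which may have no continuous representative, receive the default value 0.
  have hex : ∀ (i : Fin 2) (ℓ : ℕ), ∃ c : CircleC L, ℓ ≤ m → toL2 c = sobComp i ℓ u := fun i ℓ => by
    by_cases h : ℓ ≤ m
    · obtain ⟨c, hc⟩ := exists_toL2_sobComp (by omega : ℓ < k) i u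
      exact ⟨c, fun _ => hc⟩
    · exact ⟨0, fun h' => absurd h' h⟩
  choose r hr using hex
  set V : ℕ → AddCircle L → Vec2 := fun ℓ x => !₂[r 0 ℓ x, r 1 ℓ x] with hV
  have hVi : ∀ ℓ x i, V ℓ x i = r i ℓ x := fun ℓ x i => by fin_cases i <;> simp [hV]
  have hnorm : ∀ (a : Vec2) (A : ℝ), 0 ≤ A → (∀ i, |a i| ≤ A) → ‖a‖ ≤ 2 * A := by
    intro a A hA h
    refine abs_le_of_sq_le_sq' ?_ (by positivity) |>.2
    rw [EuclideanSpace.real_norm_sq_eq, Fin.sum_univ_two]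
    have h0 := sq_le_sq' (abs_le.1 (h 0)).1 (abs_le.1 (h 0)).2
    have h1 := sq_le_sq' (abs_le.1 (h 1)).1 (abs_le.1 (h 1)).2
    nlinarith [sq_nonneg A]
  have hderiv : ∀ ℓ, ℓ < m → ∀ s : ℝ, HasDerivAt (fun s : ℝ => V ℓ (s : AddCircle L))
      (V (ℓ + 1) (s : AddCircle L)) s := by
    intro ℓ hℓ s
    have h1 : ∀ i, HasDerivAt (fun s : ℝ => r i ℓ (s : AddCircle L))
        (r i (ℓ + 1) (s : AddCircle L)) s := fun i => by
      refine InH1.hasDerivAt_lift ?_ s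
      rw [hr i ℓ (by omega), hr i (ℓ + 1) (by omega)]
      exact inH1_sobComp (by omega) i u
    have h2 : ∀ ℓ, (fun s : ℝ => V ℓ (s : AddCircle L)) = fun s : ℝ =>
        r 0 ℓ (s : AddCircle L) • (EuclideanSpace.single 0 (1 : ℝ) : Vec2) +
          r 1 ℓ (s : AddCircle L) • (EuclideanSpace.single 1 (1 : ℝ) : Vec2) := fun ℓ => by
      funext s
      ext i
      rw [hVi]
      fin_cases i <;> simp
    rw [h2 ℓ, show V (ℓ + 1) (s : AddCircle L) = _ from congrFun (h2 (ℓ + 1)) s]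
    exact ((h1 0).smul_const _).add ((h1 1).smul_const _)
  have hcd : ∀ n ℓ, ℓ + n ≤ m → CircleContDiff n (V ℓ) := by
    intro n
    induction n with
    | zero =>
      intro ℓ _
      refine contDiff_zero.2 ?_
      rw [continuous_iff_continuousAt]
      intro s
      have : Continuous fun s : ℝ => V ℓ (s : AddCircle L) := by
        have h0 := continuous_lift (r 0 ℓ)
        have h1 := continuous_lift (r 1 ℓ)
        simp only [hV]
        fun_prop
      exact this.continuousAt
    | succ n ih =>
      intro ℓ hℓ
      have hd := hderiv ℓ (by omega)
      have := contDiff_succ_iff_deriv (𝕜 := ℝ) (f := fun s : ℝ => V ℓ (s : AddCircle L)) (n := n)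
      have h2 := this.2 ⟨fun s => (hd s).differentiableAt, by simp, ?_⟩
      · exact_mod_cast h2
      · rw [show deriv (fun s : ℝ => V ℓ (s : AddCircle L)) = fun s : ℝ => V (ℓ + 1) s from
          funext fun s => (hd s).deriv]
        exact ih (ℓ + 1) (by omega)
  have hiter : ∀ ℓ, ℓ ≤ m → circleDeriv^[ℓ] (V 0) = V ℓ := by
    intro ℓ
    induction ℓ with
    | zero => intro _; rfl
    | succ ℓ ih =>
      intro hℓ
      rw [Function.iterate_succ_apply', ih (by omega)]
      funext x
      obtain ⟨s, rfl⟩ := QuotientAddGroup.mk_surjective x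
      exact (circleDeriv_coe (V ℓ) s).trans (hderiv ℓ (by omega) s).deriv
  have hS := supConst_nonneg L
  have hu := norm_nonneg u
  have hsup : ∀ ℓ, ℓ ≤ m → ∀ x, ‖V ℓ x‖ ≤ 4 * supConst L * ‖u‖ := by
    intro ℓ hℓ x
    refine (hnorm (V ℓ x) (2 * supConst L * ‖u‖) (by positivity) fun i => ?_).trans_eq (by ring)
    rw [hVi]
    have h1 : SobLe 1 (toL2 (r i ℓ)) ‖u‖ := by
      rw [hr i ℓ hℓ]; exact sobLe_sobComp (by omega) i u
    exact ((r i ℓ).norm_coe_le_norm x).trans h1.norm_le_of_toL2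
  have hhol : HolderWith (2 * ‖u‖).toNNReal (1 / 2) (V m) := by
    intro x y
    have h1 : ‖V m x - V m y‖ ≤ 2 * (dist x y ^ (1 / 2 : ℝ) * ‖u‖) := by
      refine hnorm _ _ (by positivity) fun i => ?_
      rw [PiLp.sub_apply, hVi, hVi]
      have h2 : InH1 (toL2 (r i m)) (sobComp i (m + 1) u) := by
        rw [hr i m le_rfl]; exact inH1_sobComp (by omega) i u
      have h3 := h2.holder x y
      refine abs_le_of_sq_le_sq ?_ (by positivity)
      rw [mul_pow, ← Real.sqrt_eq_rpow, Real.sq_sqrt dist_nonneg]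
      refine h3.trans ?_
      gcongr
      exact norm_sobComp_le i _ u
    rw [edist_dist, edist_dist, dist_eq_norm, ENNReal.ofReal_rpow_of_nonneg dist_nonneg (by simp)]
    change _ ≤ ENNReal.ofReal (2 * ‖u‖) * _
    rw [← ENNReal.ofReal_mul (by positivity)]
    refine ENNReal.ofReal_le_ofReal (h1.trans_eq ?_)
    have : ((1 / 2 : ℝ≥0) : ℝ) = 1 / 2 := by simp
    rw [this]
    ring
  have hae : sobolevFun u =ᵐ[volume] V 0 := by
    filter_upwards [sobolevFun_ae u 0, sobolevFun_ae u 1, toL2_ae (r 0 0), toL2_ae (r 1 0)]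
      with x h1 h2 h3 h4
    rw [hr 0 0 (Nat.zero_le m)] at h3
    rw [hr 1 0 (Nat.zero_le m)] at h4
    ext i
    rw [hVi]
    fin_cases i
    · exact h1.symm.trans h3
    · exact h2.symm.trans h4
  refine iInf_le_of_le (V 0) (iInf_le_of_le (hcd m 0 (by omega)) (iInf_le_of_le hae ?_))
  rw [add_mul, ENNReal.ofReal_add (by positivity) (by positivity), hiter m le_rfl]
  refine add_le_add ?_ hhol.eHolderNorm_le
  refine (Finset.sum_le_card_nsmul _ _ (ENNReal.ofReal (4 * supConst L * ‖u‖)) fun ℓ hℓ => ?_).trans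
    (le_of_eq ?_)
  · have hℓ' : ℓ ≤ m := Nat.lt_succ_iff.1 (Finset.mem_range.1 hℓ)
    rw [hiter ℓ hℓ']
    refine iSup_le fun x => ?_
    rw [← ofReal_norm]
    exact ENNReal.ofReal_le_ofReal (hsup ℓ hℓ' x)
  · rw [Finset.card_range, ← ENNReal.ofReal_nsmul, nsmul_eq_mul]
    congr 1
    push_cast
    ring

end

noncomputable section

variable {L : ℝ} [Fact (0 < L)]

set_option linter.unusedSectionVars false

/-! ## Convergence and differentiability in Sobolev spaces, componentwise -/

theorem tendsto_sobolev_iff {ι : Type*} {l : Filter ι} {k : ℕ} {u : ι → sobolev L k}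
    {u₀ : sobolev L k} :
    Tendsto u l (𝓝 u₀) ↔
      ∀ ℓ ≤ k, ∀ i, Tendsto (fun r => sobComp i ℓ (u r)) l (𝓝 (sobComp i ℓ u₀)) := by
  refine ⟨fun h ℓ _ i => ((sobComp i ℓ).continuous.tendsto _).comp h, fun h => ?_⟩
  rw [tendsto_iff_norm_sub_tendsto_zero]
  have h2 : Tendsto (fun r => ‖u r - u₀‖ ^ 2) l (𝓝 0) := by
    have e : (fun r => ‖u r - u₀‖ ^ 2) = fun r => ∑ ℓ ∈ Finset.range (k + 1),
        (‖sobComp 0 ℓ (u r) - sobComp 0 ℓ u₀‖ ^ 2 + ‖sobComp 1 ℓ (u r) - sobComp 1 ℓ u₀‖ ^ 2) := by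
      funext r
      rw [norm_sq_eq_sobComp]
      simp only [map_sub]
    have e2 : ∀ ℓ ∈ Finset.range (k + 1), Tendsto (fun r => ‖sobComp 0 ℓ (u r) - sobComp 0 ℓ u₀‖ ^ 2 +
        ‖sobComp 1 ℓ (u r) - sobComp 1 ℓ u₀‖ ^ 2) l (𝓝 ((fun _ => (0 : ℝ)) ℓ)) := fun ℓ hℓ => by
      have hℓ' : ℓ ≤ k := Nat.lt_succ_iff.1 (Finset.mem_range.1 hℓ)
      have h0 := (tendsto_iff_norm_sub_tendsto_zero.1 (h ℓ hℓ' 0)).pow 2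
      have h1 := (tendsto_iff_norm_sub_tendsto_zero.1 (h ℓ hℓ' 1)).pow 2
      simpa using h0.add h1
    rw [e]
    simpa using tendsto_finsetSum _ e2
  have h3 := h2.sqrt
  simpa [Real.sqrt_sq (norm_nonneg _)] using h3

theorem hasDerivWithinAt_sobolev {k : ℕ} {u : ℝ → sobolev L k} {u' : sobolev L k} {s : Set ℝ}
    {t : ℝ} (h : ∀ ℓ ≤ k, ∀ i, HasDerivWithinAt (fun r => sobComp i ℓ (u r)) (sobComp i ℓ u') s t) :
    HasDerivWithinAt u u' s t := by
  rw [hasDerivWithinAt_iff_tendsto_slope, tendsto_sobolev_iff]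
  intro ℓ hℓ i
  have := hasDerivWithinAt_iff_tendsto_slope.1 (h ℓ hℓ i)
  refine this.congr fun r => ?_
  simp [slope, vsub_eq_sub]

/-- Limits in a Sobolev space can be taken componentwise. -/
theorem exists_tendsto_sobolev {ι : Type*} {l : Filter ι} [l.NeBot] {k : ℕ} {u : ι → sobolev L k}
    (h : ∀ ℓ ≤ k, ∀ i, ∃ f, Tendsto (fun r => sobComp i ℓ (u r)) l (𝓝 f)) :
    ∃ u₀, Tendsto u l (𝓝 u₀) := by
  choose f hf using h
  set U : JetL2 L k := WithLp.toLp 2 fun ℓ : Fin (k + 1) =>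
    inclL2 0 (f ℓ (Nat.lt_succ_iff.1 ℓ.2) 0) + inclL2 1 (f ℓ (Nat.lt_succ_iff.1 ℓ.2) 1)
  have hU : Tendsto (fun r => (u r : JetL2 L k)) l (𝓝 U) := by
    have h2 : Tendsto (fun r => (PiLp.continuousLinearEquiv 2 ℝ
        (fun _ : Fin (k + 1) => CircleL2 L)) (u r : JetL2 L k)) l
        (𝓝 ((PiLp.continuousLinearEquiv 2 ℝ (fun _ : Fin (k + 1) => CircleL2 L)) U)) := by
      refine tendsto_pi_nhds.2 fun ℓ => ?_
      have hℓ := Nat.lt_succ_iff.1 ℓ.2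
      have h3 := (((inclL2 0).continuous.tendsto _).comp (hf ℓ hℓ 0)).add
        (((inclL2 1).continuous.tendsto _).comp (hf ℓ hℓ 1))
      refine h3.congr fun r => ?_
      simp only [Function.comp_apply]
      rw [sobComp_of_lt 0 ℓ.2, sobComp_of_lt 1 ℓ.2, ← eq_inclL2_add]
      rfl
    have h4 := ((PiLp.continuousLinearEquiv 2 ℝ
      (fun _ : Fin (k + 1) => CircleL2 L)).symm.continuous.tendsto _).comp h2
    simpa [Function.comp_def] using h4
  have hmem : U ∈ sobolev L k :=
    (Submodule.isClosed_topologicalClosure _).mem_of_tendsto hU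
      (Eventually.of_forall fun r => (u r).2)
  exact ⟨⟨U, hmem⟩, tendsto_subtype_rng.2 hU⟩

/-! ## Operators on Sobolev spaces -/

theorem mem_sobolev_of_smoothJets {j k : ℕ} (T : JetL2 L k →L[ℝ] JetL2 L j)
    (hT : ∀ U ∈ smoothJets L k, T U ∈ smoothJets L j) (u : sobolev L k) :
    T (u : JetL2 L k) ∈ sobolev L j := by
  have hle : sobolev L k ≤ (sobolev L j).comap T.toLinearMap :=
    Submodule.topologicalClosure_minimal _
      (Submodule.span_le.2 fun V hV =>
        Submodule.le_topologicalClosure _ (Submodule.subset_span (hT V hV)))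
      ((Submodule.isClosed_topologicalClosure _).preimage T.continuous)
  exact hle u.2

/-- A bounded operator on jets that preserves smooth jets, on Sobolev spaces. -/
def sobolevMap {j k : ℕ} (T : JetL2 L k →L[ℝ] JetL2 L j)
    (hT : ∀ U ∈ smoothJets L k, T U ∈ smoothJets L j) : sobolev L k →L[ℝ] sobolev L j :=
  (T.comp (sobolev L k).subtypeL).codRestrict (sobolev L j) (mem_sobolev_of_smoothJets T hT)

/-- Jets are mapped entrywise, with a reindexing. -/
def jetMap {j k : ℕ} (e : Fin (j + 1) → Fin (k + 1)) (T : CircleL2 L →L[ℝ] CircleL2 L) :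
    JetL2 L k →L[ℝ] JetL2 L j :=
  (PiLp.continuousLinearEquiv 2 ℝ (fun _ : Fin (j + 1) => CircleL2 L)).symm.toContinuousLinearMap ∘L
    ContinuousLinearMap.pi fun i : Fin (j + 1) =>
      T.comp (PiLp.proj 2 (fun _ : Fin (k + 1) => CircleL2 L) (e i))

theorem circleDeriv_iterate_shift (v : AddCircle L → Vec2) (h : ℝ) (ℓ : ℕ) :
    circleDeriv^[ℓ] (fun x => v (x + (h : AddCircle L))) =
      fun x => circleDeriv^[ℓ] v (x + (h : AddCircle L)) := by
  induction ℓ with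
  | zero => rfl
  | succ ℓ ih =>
    rw [Function.iterate_succ_apply', ih, Function.iterate_succ_apply']
    funext x
    simp only [circleDeriv, add_right_comm]

theorem circleDeriv_iterate_comp (A : Vec2 →L[ℝ] Vec2) {v : AddCircle L → Vec2}
    (hv : CircleContDiff ∞ v) (ℓ : ℕ) :
    circleDeriv^[ℓ] (fun x => A (v x)) = fun x => A (circleDeriv^[ℓ] v x) := by
  induction ℓ with
  | zero => rfl
  | succ ℓ ih =>
    rw [Function.iterate_succ_apply', ih, Function.iterate_succ_apply']
    funext x
    obtain ⟨s, rfl⟩ := QuotientAddGroup.mk_surjective x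
    exact (circleDeriv_coe _ s).trans
      (A.hasFDerivAt.comp_hasDerivAt s ((hv.iterate ℓ).hasDerivAt s)).deriv

/-- Translation of Sobolev functions. -/
def sobShift {k : ℕ} (h : ℝ) : sobolev L k →L[ℝ] sobolev L k :=
  sobolevMap (jetMap id (shiftLp h).toContinuousLinearMap) <| by
    rintro U ⟨v, hv, hU⟩
    refine ⟨fun x => v (x + (h : AddCircle L)), ?_, fun ℓ => ?_⟩
    · have : (fun s : ℝ => v ((s : AddCircle L) + (h : AddCircle L))) =
          (fun s : ℝ => v (s : AddCircle L)) ∘ fun s : ℝ => s + h := by funext s; simp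
      rw [CircleContDiff, this]
      exact ContDiff.comp hv (contDiff_id.add contDiff_const)
    · rw [circleDeriv_iterate_shift]
      filter_upwards [shiftLp_ae h (U ℓ),
        (measurePreserving_shift h).quasiMeasurePreserving.ae (hU ℓ)] with x h1 h2
      exact h1.trans h2

/-- The action of a constant matrix on Sobolev functions. -/
def sobMat {k : ℕ} (A : Matrix (Fin 2) (Fin 2) ℝ) : sobolev L k →L[ℝ] sobolev L k :=
  sobolevMap (jetMap id (A.toEuclideanLin.toContinuousLinearMap.compLpL 2 volume)) <| by
    rintro U ⟨v, hv, hU⟩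
    refine ⟨fun x => A.toEuclideanLin.toContinuousLinearMap (v x),
      A.toEuclideanLin.toContinuousLinearMap.contDiff.comp (hv : ContDiff ℝ ∞ _), fun ℓ => ?_⟩
    rw [circleDeriv_iterate_comp _ hv]
    filter_upwards [hU ℓ,
      A.toEuclideanLin.toContinuousLinearMap.coeFn_compLpL (p := 2) (U ℓ)] with x h1 h2
    exact h2.trans (congrArg _ h1)

/-- The derivative as a map `H^k → H^{k-1}`. -/
def sobDeriv {k : ℕ} (hk : 1 ≤ k) : sobolev L k →L[ℝ] sobolev L (k - 1) :=
  sobolevMap (jetMap (fun ℓ => ⟨ℓ + 1, by omega⟩) (ContinuousLinearMap.id ℝ _)) <| by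
    rintro U ⟨v, hv, hU⟩
    exact ⟨circleDeriv v, hv.circleDeriv, fun ℓ => hU ⟨ℓ + 1, by omega⟩⟩

theorem compL2_shiftLp (i : Fin 2) (h : ℝ) (U : CircleL2 L) :
    compL2 i (shiftLp h U) = shiftLp h (compL2 i U) := by
  refine Lp.ext ?_
  filter_upwards [compL2_ae i (shiftLp h U), shiftLp_ae h U, shiftLp_ae h (compL2 i U),
    (measurePreserving_shift h).quasiMeasurePreserving.ae (compL2_ae i U)] with x h1 h2 h3 h4
  rw [h1, h2, h3, h4]

theorem sobComp_shift {k ℓ : ℕ} (hℓ : ℓ ≤ k) (i : Fin 2) (h : ℝ) (u : sobolev L k) :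
    sobComp i ℓ (sobShift h u) = shiftLp h (sobComp i ℓ u) := by
  rw [sobComp_of_lt i (Nat.lt_succ_of_le hℓ), sobComp_of_lt i (Nat.lt_succ_of_le hℓ),
    ← compL2_shiftLp]
  rfl

theorem sobComp_mat {k ℓ : ℕ} (hℓ : ℓ ≤ k) (i : Fin 2) (A : Matrix (Fin 2) (Fin 2) ℝ)
    (u : sobolev L k) :
    sobComp i ℓ (sobMat A u) = A i 0 • sobComp 0 ℓ u + A i 1 • sobComp 1 ℓ u := by
  have hℓ' := Nat.lt_succ_of_le hℓ
  rw [sobComp_of_lt i hℓ', sobComp_of_lt 0 hℓ', sobComp_of_lt 1 hℓ']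
  change compL2 i (A.toEuclideanLin.toContinuousLinearMap.compLpL 2 volume
    ((u : JetL2 L k) ⟨ℓ, hℓ'⟩)) = _
  generalize (u : JetL2 L k) ⟨ℓ, hℓ'⟩ = U
  refine Lp.ext ?_
  filter_upwards [compL2_ae i (A.toEuclideanLin.toContinuousLinearMap.compLpL 2 volume U),
    A.toEuclideanLin.toContinuousLinearMap.coeFn_compLpL (p := 2) U, compL2_ae 0 U, compL2_ae 1 U,
    Lp.coeFn_add (A i 0 • compL2 0 U) (A i 1 • compL2 1 U), Lp.coeFn_smul (A i 0) (compL2 0 U),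
    Lp.coeFn_smul (A i 1) (compL2 1 U)] with x h1 h2 h3 h4 h5 h6 h7
  rw [h1, h2, h5, Pi.add_apply, h6, h7, Pi.smul_apply, Pi.smul_apply, h3, h4]
  simp [Matrix.mulVec, dotProduct, Fin.sum_univ_two]

theorem sobComp_deriv {k ℓ : ℕ} (hk : 1 ≤ k) (hℓ : ℓ ≤ k - 1) (i : Fin 2) (u : sobolev L k) :
    sobComp i ℓ (sobDeriv hk u) = sobComp i (ℓ + 1) u := by
  rw [sobComp_of_lt i (Nat.lt_succ_of_le hℓ), sobComp_of_lt i (by omega)]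
  rfl

theorem norm_sobShift {k : ℕ} (h : ℝ) (u : sobolev L k) : ‖sobShift h u‖ = ‖u‖ := by
  rw [← sq_eq_sq₀ (norm_nonneg _) (norm_nonneg _), norm_sq_eq_sobComp, norm_sq_eq_sobComp]
  refine Finset.sum_congr rfl fun ℓ hℓ => ?_
  have hℓ' : ℓ ≤ k := Nat.lt_succ_iff.1 (Finset.mem_range.1 hℓ)
  rw [sobComp_shift hℓ', sobComp_shift hℓ', LinearIsometry.norm_map, LinearIsometry.norm_map]

/-! ## Translates of curves -/

theorem tendsto_shiftLp {ι : Type*} {l : Filter ι} {h : ι → ℝ} {h₀ : ℝ} {f : ι → ScalarL2 L}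
    {f₀ : ScalarL2 L} (hh : Tendsto h l (𝓝 h₀)) (hf : Tendsto f l (𝓝 f₀)) :
    Tendsto (fun r => shiftLp (h r) (f r)) l (𝓝 (shiftLp h₀ f₀)) := by
  have h1 := ((continuous_shiftLp f₀).tendsto h₀).comp hh
  have h2 : Tendsto (fun r => shiftLp (h r) (f r) - shiftLp (h r) f₀) l (𝓝 0) := by
    rw [tendsto_zero_iff_norm_tendsto_zero]
    refine (tendsto_iff_norm_sub_tendsto_zero.1 hf).congr fun r => ?_
    rw [← map_sub, LinearIsometry.norm_map]
  simpa using h2.add h1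

/-- Translations are only strongly continuous, so there is no product rule in operator norm.
Splitting γ(r) = γ(t) + (γ(r) − γ(t)) leaves a translate of a fixed H¹ function and a difference
whose slopes converge and may be translated. -/
theorem hasDerivWithinAt_shiftLp {γ : ℝ → ScalarL2 L} {γ' g : ScalarL2 L} {s : Set ℝ} {t : ℝ}
    (a : ℝ) (hγ : HasDerivWithinAt γ γ' s t) (hg : InH1 (γ t) g) :
    HasDerivWithinAt (fun r => shiftLp (a * r) (γ r))
      (a • shiftLp (a * t) g + shiftLp (a * t) γ') s t := by
  have h1 : HasDerivWithinAt (fun r => shiftLp (a * r) (γ t)) (a • shiftLp (a * t) g) s t := by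
    have hm : HasDerivWithinAt (fun r => a * r) a s t := by
      simpa using ((hasDerivAt_id t).const_mul a).hasDerivWithinAt
    exact (hg.hasDerivAt_shift (a * t)).scomp_hasDerivWithinAt t hm
  have h2 : HasDerivWithinAt (fun r => shiftLp (a * r) (γ r - γ t)) (shiftLp (a * t) γ') s t := by
    rw [hasDerivWithinAt_iff_tendsto_slope] at hγ ⊢
    have hm : Tendsto (fun r : ℝ => a * r) (𝓝[s \ {t}] t) (𝓝 (a * t)) :=
      (continuous_const.mul continuous_id).continuousWithinAt
    refine (tendsto_shiftLp hm hγ).congr fun r => ?_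
    simp [slope, vsub_eq_sub]
  have e : (fun r => shiftLp (a * r) (γ r)) =
      (fun r => shiftLp (a * r) (γ t)) + fun r => shiftLp (a * r) (γ r - γ t) := by
    funext r
    simp
  rw [e]
  exact h1.add h2

end

noncomputable section

/-! ## Linear differential equations with strongly continuous coefficients -/

section LinearODE

variable {Y : Type*} [NormedAddCommGroup Y] [NormedSpace ℝ Y]

theorem continuousOn_clm_apply_of_bounded {X : Type*} [TopologicalSpace X] {K : X → Y →L[ℝ] Y}
    {M : ℝ} {s : Set X} (hK : ∀ x, ContinuousOn (fun r => K r x) s) (hM : ∀ r, ‖K r‖ ≤ M) {V : X → Y}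
    (hV : ContinuousOn V s) : ContinuousOn (fun r => K r (V r)) s := by
  intro r₀ hr₀
  have h1 := hK (V r₀) r₀ hr₀
  have h2 : Tendsto (fun r => K r (V r - V r₀)) (𝓝[s] r₀) (𝓝 0) := by
    have h3 := tendsto_iff_norm_sub_tendsto_zero.1 (hV r₀ hr₀)
    refine squeeze_zero_norm (fun r => ?_) (by simpa using h3.const_mul M)
    exact (K r).le_of_opNorm_le (hM r) _
  have h4 := h2.add h1
  rw [zero_add] at h4
  refine h4.congr fun r => ?_
  rw [map_sub, sub_add_cancel]

/-- K is continuous only pointwise, but uniformly bounded, so K r (V r) is continuous for continuous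
V and the Picard series of iterated integrals converges with its derivatives, dominated by the
exponential series. -/
theorem exists_hasDerivAt_linear [CompleteSpace Y] {K : ℝ → Y →L[ℝ] Y} {M : ℝ}
    (hK : ∀ x, Continuous fun r => K r x) (hM : ∀ r, ‖K r‖ ≤ M) (x₀ : Y) :
    ∃ V : ℝ → Y, V 0 = x₀ ∧ ∀ s, HasDerivAt V (K s (V s)) s := by
  have hM0 : 0 ≤ M := (norm_nonneg _).trans (hM 0)
  have hKV : ∀ {V : ℝ → Y}, Continuous V → Continuous fun r => K r (V r) := fun hV =>
    continuousOn_univ.1 (continuousOn_clm_apply_of_bounded (fun x => (hK x).continuousOn) hM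
      hV.continuousOn)
  let P : ℕ → ℝ → Y := fun n => Nat.rec (fun _ => x₀) (fun _ V s => ∫ r in (0 : ℝ)..s, K r (V r)) n
  have hP0 : P 0 = fun _ => x₀ := rfl
  have hPs : ∀ n, P (n + 1) = fun s => ∫ r in (0 : ℝ)..s, K r (P n r) := fun n => rfl
  have hPc : ∀ n, Continuous (P n) := by
    intro n
    induction n with
    | zero => exact continuous_const
    | succ n ih =>
      rw [hPs]
      exact intervalIntegral.continuous_primitive (fun a b => (hKV ih).intervalIntegrable a b) 0
  have hPd : ∀ n s, HasDerivAt (P (n + 1)) (K s (P n s)) s := fun n s => by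
    rw [hPs]
    exact ((hKV (hPc n)).integral_hasStrictDerivAt 0 s).hasDerivAt
  have hPb : ∀ n s, ‖P n s‖ ≤ (M * |s|) ^ n / n.factorial * ‖x₀‖ := by
    intro n
    induction n with
    | zero => intro s; simp [hP0]
    | succ n ih =>
      intro s
      -- Rescaling the integral to [0,1] treats both signs of s at once.
      have e1 : P (n + 1) s = s • ∫ r in (0 : ℝ)..1, K (s * r) (P n (s * r)) := by
        rw [intervalIntegral.smul_integral_comp_mul_left (fun r => K r (P n r)), hPs]
        simp
      have e2 : ‖∫ r in (0 : ℝ)..1, K (s * r) (P n (s * r))‖ ≤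
          ∫ r in (0 : ℝ)..1, M * ((M * |s|) ^ n / n.factorial * ‖x₀‖) * r ^ n := by
        refine intervalIntegral.norm_integral_le_of_norm_le zero_le_one
          (Eventually.of_forall fun r hr => ?_) (Continuous.intervalIntegrable (by fun_prop) _ _)
        refine ((K (s * r)).le_of_opNorm_le (hM _) _).trans ?_
        rw [mul_assoc]
        refine mul_le_mul_of_nonneg_left ((ih (s * r)).trans (le_of_eq ?_)) hM0
        rw [abs_mul, abs_of_pos hr.1]
        ring
      rw [intervalIntegral.integral_const_mul, integral_pow] at e2
      rw [e1, norm_smul, Real.norm_eq_abs]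
      refine (mul_le_mul_of_nonneg_left e2 (abs_nonneg s)).trans (le_of_eq ?_)
      rw [Nat.factorial_succ]
      push_cast
      have : ((n : ℝ) + 1) ≠ 0 := by positivity
      have : (n.factorial : ℝ) ≠ 0 := by positivity
      field_simp
      simp
      ring
  have hsum : ∀ s, Summable fun n => P n s := fun s =>
    Summable.of_norm_bounded ((Real.summable_pow_div_factorial (M * |s|)).mul_right ‖x₀‖)
      fun n => hPb n s
  refine ⟨fun s => ∑' n, P n s, ?_, fun s => ?_⟩
  · have : ∀ n, n ≠ 0 → P n 0 = 0 := fun n hn => by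
      obtain ⟨m, rfl⟩ := Nat.exists_eq_succ_of_ne_zero hn
      rw [Nat.succ_eq_add_one, hPs]; simp
    exact (tsum_eq_single 0 this).trans (by rw [hP0])
  · set R := |s| + 1
    let g' : ℕ → ℝ → Y := fun n s => Nat.casesOn n 0 fun m => K s (P m s)
    have hg' : ∀ n y, HasDerivAt (P n) (g' n y) y := fun n y => by
      cases n with
      | zero => exact hasDerivAt_const y x₀
      | succ n => exact hPd n y
    let b : ℕ → ℝ := fun n => Nat.casesOn n 0 fun m => M * ((M * R) ^ m / m.factorial * ‖x₀‖)
    have hb : Summable b := by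
      rw [← summable_nat_add_iff 1]
      exact ((Real.summable_pow_div_factorial (M * R)).mul_right ‖x₀‖).mul_left M
    have hgb : ∀ n y, y ∈ Metric.ball (0 : ℝ) R → ‖g' n y‖ ≤ b n := fun n y hy => by
      cases n with
      | zero => simp [g', b]
      | succ n =>
        refine ((K y).le_of_opNorm_le (hM _) _).trans (mul_le_mul_of_nonneg_left ?_ hM0)
        refine (hPb n y).trans ?_
        have hy' : |y| ≤ R := by
          have := Metric.mem_ball.1 hy
          rw [dist_zero_right, Real.norm_eq_abs] at this
          exact this.le
        gcongr
    have hs : s ∈ Metric.ball (0 : ℝ) R := by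
      rw [Metric.mem_ball, dist_zero_right, Real.norm_eq_abs]; simp [R]
    have h := hasDerivAt_tsum_of_isPreconnected hb Metric.isOpen_ball
      (convex_ball (0 : ℝ) R).isPreconnected (fun n y _ => hg' n y) hgb
      (Metric.mem_ball_self (by positivity)) (hsum 0) hs
    refine h.congr_deriv ?_
    have hg's : Summable fun n => g' n s := Summable.of_norm_bounded hb fun n => hgb n s hs
    rw [hg's.tsum_eq_zero_add, (K s).map_tsum (hsum s)]
    exact zero_add _

end LinearODE

end

noncomputable section

variable {L : ℝ} [Fact (0 < L)]

set_option linter.unusedSectionVars false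

/-! ## The equations, componentwise -/

theorem equation_iff_sobComp {k : ℕ} (hk : 1 ≤ k) {u' : sobolev L (k - 1)} {u : sobolev L k}
    {M : AddCircle L → Matrix (Fin 2) (Fin 2) ℝ} {B : Fin 2 → Fin 2 → CircleC L} {a : ℝ}
    (hM : ∀ᵐ x, ∀ i j, M x i j = B i j x) :
    (∀ᵐ x : AddCircle L, sobolevFun u' x + (M x).toEuclideanLin (sobolevDx hk u x) =
      a • piPerp.toEuclideanLin (sobolevFun u x)) ↔
    (sobComp 0 0 u' + (cmul (B 0 0) (sobComp 0 1 u) + cmul (B 0 1) (sobComp 1 1 u)) =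
      a • sobComp 0 0 u ∧
    sobComp 1 0 u' + (cmul (B 1 0) (sobComp 0 1 u) + cmul (B 1 1) (sobComp 1 1 u)) = 0) := by
  have hlhs : ∀ i, (↑(sobComp i 0 u' + (cmul (B i 0) (sobComp 0 1 u) + cmul (B i 1) (sobComp 1 1 u)) :
      ScalarL2 L) : AddCircle L → ℝ) =ᵐ[volume]
      fun x => (sobolevFun u' x + (M x).toEuclideanLin (sobolevDx hk u x)) i := fun i => by
    filter_upwards [hM, sobolevFun_ae u' i, sobolevDx_ae hk u 0, sobolevDx_ae hk u 1,
      Lp.coeFn_add (sobComp i 0 u') (cmul (B i 0) (sobComp 0 1 u) + cmul (B i 1) (sobComp 1 1 u)),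
      Lp.coeFn_add (cmul (B i 0) (sobComp 0 1 u)) (cmul (B i 1) (sobComp 1 1 u)),
      cmul_ae (B i 0) (sobComp 0 1 u), cmul_ae (B i 1) (sobComp 1 1 u)]
      with x h1 h2 h3 h4 h5 h6 h7 h8
    rw [h5, Pi.add_apply, h6, Pi.add_apply, h7, h8, h2, h3, h4, ← h1, ← h1]
    simp [Matrix.mulVec, dotProduct, Fin.sum_univ_two]
  have hr0 : (↑(a • sobComp 0 0 u : ScalarL2 L) : AddCircle L → ℝ) =ᵐ[volume]
      fun x => (a • piPerp.toEuclideanLin (sobolevFun u x)) 0 := by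
    filter_upwards [Lp.coeFn_smul a (sobComp 0 0 u), sobolevFun_ae u 0] with x h1 h2
    rw [h1, Pi.smul_apply, h2]
    simp [piPerp, Matrix.mulVec, dotProduct, Fin.sum_univ_two]
  have hr1 : ∀ x, (a • piPerp.toEuclideanLin (sobolevFun u x)) 1 = 0 := fun x => by
    simp [piPerp, Matrix.mulVec, dotProduct, Fin.sum_univ_two]
  constructor
  · intro h
    refine ⟨Lp.ext ?_, Lp.ext ?_⟩
    · filter_upwards [h, hlhs 0, hr0] with x h1 h2 h3
      rw [h2, h3, h1]
    · filter_upwards [h, hlhs 1, Lp.coeFn_zero ℝ 2 (volume : Measure (AddCircle L))] with x h1 h2 h3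
      rw [h2, h1, hr1, h3]; rfl
  · rintro ⟨e0, e1⟩
    have g0 := hlhs 0
    have g1 := hlhs 1
    rw [e0] at g0
    rw [e1] at g1
    filter_upwards [g0, g1, hr0, Lp.coeFn_zero ℝ 2 (volume : Measure (AddCircle L))]
      with x h1 h2 h3 h4
    ext i
    fin_cases i
    · exact h1.symm.trans h3
    · refine h2.symm.trans (h4.trans ?_)
      exact (hr1 x).symm

theorem cmul_const (a : ℝ) (f : ScalarL2 L) : cmul (a • (1 : CircleC L)) f = a • f := by
  rw [map_smul, smul_apply, cmul_one]

/-! ## Existence for the linearised equation -/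

/-- The group generated by `-𝙱(t, 0) ∂ₓ`, where `c² = σ`. -/
def waveGroup {k : ℕ} (c t : ℝ) : sobolev L k →L[ℝ] sobolev L k :=
  (sobShift (c * t)).comp (sobMat !![1 / 2, 1 / (2 * c); c / 2, 1 / 2]) +
    (sobShift (-c * t)).comp (sobMat !![1 / 2, -(1 / (2 * c)); -(c / 2), 1 / 2])

theorem sobComp_zero_waveGroup {k ℓ : ℕ} (hℓ : ℓ ≤ k) (c t : ℝ) (u : sobolev L k) :
    sobComp 0 ℓ (waveGroup c t u) =
      shiftLp (c * t) ((1 / 2 : ℝ) • sobComp 0 ℓ u + (1 / (2 * c)) • sobComp 1 ℓ u) +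
      shiftLp (-c * t) ((1 / 2 : ℝ) • sobComp 0 ℓ u + (-(1 / (2 * c))) • sobComp 1 ℓ u) := by
  rw [waveGroup, add_apply, map_add, ContinuousLinearMap.comp_apply,
    ContinuousLinearMap.comp_apply, sobComp_shift hℓ, sobComp_shift hℓ, sobComp_mat hℓ,
    sobComp_mat hℓ]
  rfl

theorem sobComp_one_waveGroup {k ℓ : ℕ} (hℓ : ℓ ≤ k) (c t : ℝ) (u : sobolev L k) :
    sobComp 1 ℓ (waveGroup c t u) =
      shiftLp (c * t) ((c / 2) • sobComp 0 ℓ u + (1 / 2 : ℝ) • sobComp 1 ℓ u) +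
      shiftLp (-c * t) ((-(c / 2)) • sobComp 0 ℓ u + (1 / 2 : ℝ) • sobComp 1 ℓ u) := by
  rw [waveGroup, add_apply, map_add, ContinuousLinearMap.comp_apply,
    ContinuousLinearMap.comp_apply, sobComp_shift hℓ, sobComp_shift hℓ, sobComp_mat hℓ,
    sobComp_mat hℓ]
  rfl

theorem exists_norm_waveGroup_le (L : ℝ) [Fact (0 < L)] (k : ℕ) (c : ℝ) :
    ∃ M, ∀ t, ‖(waveGroup c t : sobolev L k →L[ℝ] sobolev L k)‖ ≤ M := by
  refine ⟨‖(sobMat !![1 / 2, 1 / (2 * c); c / 2, 1 / 2] : sobolev L k →L[ℝ] sobolev L k)‖ +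
    ‖(sobMat !![1 / 2, -(1 / (2 * c)); -(c / 2), 1 / 2] : sobolev L k →L[ℝ] sobolev L k)‖,
    fun t => ContinuousLinearMap.opNorm_le_bound _ (by positivity) fun u => ?_⟩
  rw [waveGroup, add_apply, add_mul]
  refine (norm_add_le _ _).trans (add_le_add ?_ ?_)
  · rw [ContinuousLinearMap.comp_apply, norm_sobShift]
    exact ContinuousLinearMap.le_opNorm _ _
  · rw [ContinuousLinearMap.comp_apply, norm_sobShift]
    exact ContinuousLinearMap.le_opNorm _ _

theorem continuous_waveGroup {k : ℕ} (c : ℝ) (u : sobolev L k) :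
    Continuous fun t => waveGroup c t u := by
  refine continuous_iff_continuousAt.2 fun t => tendsto_sobolev_iff.2 fun ℓ hℓ i => ?_
  have h1 : Tendsto (fun t : ℝ => c * t) (𝓝 t) (𝓝 (c * t)) :=
    (continuous_const.mul continuous_id).tendsto t
  have h2 : Tendsto (fun t : ℝ => -c * t) (𝓝 t) (𝓝 (-c * t)) :=
    (continuous_const.mul continuous_id).tendsto t
  fin_cases i
  · simp only [Fin.zero_eta, sobComp_zero_waveGroup hℓ]
    exact (tendsto_shiftLp h1 tendsto_const_nhds).add (tendsto_shiftLp h2 tendsto_const_nhds)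
  · simp only [Fin.mk_one, sobComp_one_waveGroup hℓ]
    exact (tendsto_shiftLp h1 tendsto_const_nhds).add (tendsto_shiftLp h2 tendsto_const_nhds)

theorem waveGroup_waveGroup_neg {k : ℕ} {c : ℝ} (hc : c ≠ 0) (t : ℝ) (u : sobolev L k) :
    waveGroup c t (waveGroup c (-t) u) = u := by
  have key : ∀ (a b : ℝ), a + b = 0 → ∀ f : ScalarL2 L, shiftLp a (shiftLp b f) = f := by
    intro a b h f
    rw [← shiftLp_add, h, shiftLp_zero]
  refine sobComp_ext fun ℓ hℓ i => ?_
  have e1 := key (c * t) (c * -t) (by ring)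
  have e2 := key (-c * t) (-c * -t) (by ring)
  fin_cases i
  · simp only [Fin.zero_eta, sobComp_zero_waveGroup hℓ, sobComp_one_waveGroup hℓ, map_add, map_smul,
      e1, e2]
    match_scalars <;> field_simp <;> ring
  · simp only [Fin.mk_one, sobComp_zero_waveGroup hℓ, sobComp_one_waveGroup hℓ, map_add, map_smul,
      e1, e2]
    match_scalars <;> field_simp <;> ring

/-- Differentiating the group in time produces an x-derivative, so the rule is stated only for
orders ℓ < k even when V is differentiable in H^k. -/
theorem hasDerivWithinAt_waveGroup {k ℓ : ℕ} (hℓ : ℓ + 1 ≤ k) {c : ℝ} (hc : c ≠ 0)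
    {V : ℝ → sobolev L k} {V' : sobolev L k} {s : Set ℝ} {t : ℝ} (hV : HasDerivWithinAt V V' s t) :
    HasDerivWithinAt (fun r => sobComp 0 ℓ (waveGroup c r (V r)))
      (sobComp 1 (ℓ + 1) (waveGroup c t (V t)) + sobComp 0 ℓ (waveGroup c t V')) s t ∧
    HasDerivWithinAt (fun r => sobComp 1 ℓ (waveGroup c r (V r)))
      ((c * c) • sobComp 0 (ℓ + 1) (waveGroup c t (V t)) + sobComp 1 ℓ (waveGroup c t V')) s t := by
  have hℓ' : ℓ ≤ k := by omega
  have hcomp : ∀ j, HasDerivWithinAt (fun r => sobComp j ℓ (V r)) (sobComp j ℓ V') s t := fun j =>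
    (sobComp j ℓ).hasFDerivAt.comp_hasDerivWithinAt t hV
  have hin : ∀ j, InH1 (sobComp j ℓ (V t)) (sobComp j (ℓ + 1) (V t)) := fun j =>
    inH1_sobComp (by omega) j (V t)
  have hd : ∀ (A B a : ℝ), HasDerivWithinAt
      (fun r => shiftLp (a * r) (A • sobComp 0 ℓ (V r) + B • sobComp 1 ℓ (V r))) _ s t :=
    fun A B a => hasDerivWithinAt_shiftLp a (((hcomp 0).const_smul A).add ((hcomp 1).const_smul B))
      (((hin 0).smul A).add ((hin 1).smul B))
  constructor
  · simp only [sobComp_zero_waveGroup hℓ', sobComp_one_waveGroup hℓ]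
    refine ((hd _ _ c).add (hd _ _ (-c))).congr_deriv ?_
    generalize sobComp 0 (ℓ + 1) (V t) = a, sobComp 1 (ℓ + 1) (V t) = b,
      sobComp 0 ℓ V' = a', sobComp 1 ℓ V' = b'
    simp only [map_add, map_smul]
    match_scalars <;> field_simp
  · simp only [sobComp_one_waveGroup hℓ', sobComp_zero_waveGroup hℓ]
    refine ((hd _ _ c).add (hd _ _ (-c))).congr_deriv ?_
    generalize sobComp 0 (ℓ + 1) (V t) = a, sobComp 1 (ℓ + 1) (V t) = b,
      sobComp 0 ℓ V' = a', sobComp 1 ℓ V' = b'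
    simp only [map_add, map_smul]
    match_scalars <;> field_simp

theorem linearised_equation_iff {k : ℕ} (hk : 1 ≤ k) {σ : ℝ} (h0 : 0 ≤ σ) (h1 : σ < 1) (t : ℝ)
    (u' : sobolev L (k - 1)) (u : sobolev L k) :
    (∀ᵐ x : AddCircle L, sobolevFun u' x + (fuchsianB σ t 0).toEuclideanLin (sobolevDx hk u x) =
      ((3 * σ - 1) / t) • piPerp.toEuclideanLin (sobolevFun u x)) ↔
    (sobComp 0 0 u' = ((3 * σ - 1) / t) • sobComp 0 0 u + sobComp 1 1 u ∧
      sobComp 1 0 u' = σ • sobComp 0 1 u) := by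
  rw [equation_iff_sobComp hk (B := fun i j => (!![0, -1; -σ, 0] i j : ℝ) • (1 : CircleC L))]
  · simp only [cmul_const]
    refine and_congr ?_ ?_
    · rw [← eq_sub_iff_add_eq]
      simp
    · rw [← eq_sub_iff_add_eq]
      simp
  · refine Eventually.of_forall fun x i j => ?_
    rw [fuchsianB_zero h0 h1]
    simp

/-- Without the source, c z ± w are Riemann invariants travelling with speeds ∓c, where c² = σ;
translating them gives a group G(t). Setting W = G(t)V removes the spatial derivative and leaves V'
= (p/t) G(−t) π^⊥ G(t) V, an ODE with bounded operators on H^k. -/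
theorem exists_solvesLinearised {k : ℕ} (hk : 1 ≤ k) {σ : ℝ} (h0 : 0 < σ) (h1 : σ < 1)
    (W₁ : sobolev L k) : ∃ W, SolvesLinearised hk σ W ∧ W 1 = W₁ := by
  set p := 3 * σ - 1
  obtain ⟨c, hc, hc2⟩ : ∃ c : ℝ, 0 < c ∧ c * c = σ :=
    ⟨√σ, Real.sqrt_pos.2 h0, Real.mul_self_sqrt h0.le⟩
  obtain ⟨M, hM⟩ := exists_norm_waveGroup_le L k c
  let G : ℝ → sobolev L k →L[ℝ] sobolev L k := fun t => waveGroup c t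
  have hGc : ∀ {f : ℝ → ℝ} {V : ℝ → sobolev L k} {s : Set ℝ}, Continuous f → ContinuousOn V s →
      ContinuousOn (fun t => G (f t) (V t)) s := fun hf hV =>
    continuousOn_clm_apply_of_bounded (fun x => ((continuous_waveGroup c x).comp hf).continuousOn)
      (fun r => hM _) hV
  -- The substitution t = e^{−s} absorbs the factor 1/t, so that K is uniformly bounded on the whole
  -- line.
  let K : ℝ → sobolev L k →L[ℝ] sobolev L k := fun s =>
    (-p) • (G (-Real.exp (-s))).comp ((sobMat piPerp).comp (G (Real.exp (-s))))
  have hexp : Continuous fun s : ℝ => Real.exp (-s) := by fun_prop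
  have hK : ∀ x, Continuous fun r => K r x := fun x => by
    refine Continuous.const_smul (continuousOn_univ.1 (hGc hexp.neg ?_)) (-p)
    exact (sobMat piPerp).continuous.comp_continuousOn (hGc hexp continuousOn_const)
  have hKM : ∀ r, ‖K r‖ ≤ |p| * (M * (‖(sobMat piPerp : sobolev L k →L[ℝ] sobolev L k)‖ * M)) := by
    intro r
    have hM0 : 0 ≤ M := (norm_nonneg (G 0)).trans (hM 0)
    refine (ContinuousLinearMap.opNorm_smul_le _ _).trans ?_
    rw [norm_neg, Real.norm_eq_abs]
    gcongr
    refine (ContinuousLinearMap.opNorm_comp_le _ _).trans ?_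
    gcongr
    · exact hM _
    · refine (ContinuousLinearMap.opNorm_comp_le _ _).trans ?_
      gcongr
      exact hM _
  have : CompleteSpace (sobolev L k) :=
    (Submodule.isClosed_topologicalClosure (Submodule.span ℝ (smoothJets L k))).completeSpace_coe
  obtain ⟨V₀, hV₀, hV₀'⟩ := exists_hasDerivAt_linear hK hKM (G (-1) W₁)
  let V : ℝ → sobolev L k := fun t => V₀ (-Real.log t)
  have hV : ∀ t ∈ Ioc (0 : ℝ) 1, HasDerivAt V ((p / t) • G (-t) (sobMat piPerp (G t (V t)))) t := by
    intro t ht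
    have h2 := (hV₀' (-Real.log t)).scomp t (Real.hasDerivAt_log ht.1.ne').neg
    refine h2.congr_deriv ?_
    simp only [K, neg_neg, Real.exp_log ht.1, smul_apply, ContinuousLinearMap.comp_apply, V,
      smul_smul]
    congr 1
    field_simp
  have hVc : ContinuousOn V (Ioc 0 1) := fun t ht => (hV t ht).continuousAt.continuousWithinAt
  let W : ℝ → sobolev L k := fun t => G t (V t)
  have hWc : ContinuousOn W (Ioc 0 1) := hGc continuous_id hVc
  let W' : ℝ → sobolev L (k - 1) := fun t => (p / t) • sobMat piPerp (sobolevIncl (Nat.sub_le k 1) (W t)) -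
    sobMat !![0, -1; -σ, 0] (sobDeriv hk (W t))
  have hW'0 : ∀ t, ∀ ℓ ≤ k - 1, sobComp 0 ℓ (W' t) =
      (p / t) • sobComp 0 ℓ (W t) + sobComp 1 (ℓ + 1) (W t) := fun t ℓ hℓ => by
    simp only [W', map_sub, map_smul, sobComp_mat hℓ, sobComp_incl _ _ hℓ, sobComp_deriv hk hℓ]
    simp [piPerp]
  have hW'1 : ∀ t, ∀ ℓ ≤ k - 1, sobComp 1 ℓ (W' t) = σ • sobComp 0 (ℓ + 1) (W t) := fun t ℓ hℓ => by
    simp only [W', map_sub, map_smul, sobComp_mat hℓ, sobComp_incl _ _ hℓ, sobComp_deriv hk hℓ]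
    simp [piPerp]
  refine ⟨W, ⟨hWc, W', ?_, fun t ht => ?_, fun t ht => ?_⟩, ?_⟩
  · have e1 : ContinuousOn (fun t : ℝ => p / t) (Ioc 0 1) :=
      continuousOn_const.div continuousOn_id fun t ht => ht.1.ne'
    have e2 : ContinuousOn (fun t => sobMat piPerp (sobolevIncl (Nat.sub_le k 1) (W t))) (Ioc 0 1) :=
      (sobMat piPerp).continuous.comp_continuousOn
        ((sobolevIncl (Nat.sub_le k 1)).continuous.comp_continuousOn hWc)
    have e3 : ContinuousOn (fun t => sobMat !![0, -1; -σ, 0] (sobDeriv hk (W t))) (Ioc 0 1) :=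
      (sobMat !![0, -1; -σ, 0]).continuous.comp_continuousOn
        ((sobDeriv hk).continuous.comp_continuousOn hWc)
    exact (e1.smul e2).sub e3
  · refine hasDerivWithinAt_sobolev fun ℓ hℓ i => ?_
    have hℓ' : ℓ ≤ k := hℓ.trans (Nat.sub_le k 1)
    obtain ⟨d0, d1⟩ := hasDerivWithinAt_waveGroup (by omega : ℓ + 1 ≤ k) hc.ne'
      (hV t ht).hasDerivWithinAt (s := Ioc 0 1)
    have hGG : G t ((p / t) • G (-t) (sobMat piPerp (G t (V t)))) = (p / t) • sobMat piPerp (W t) := by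
      rw [map_smul]
      exact congrArg _ (waveGroup_waveGroup_neg hc.ne' t _)
    have e0 : sobComp 0 ℓ ((p / t) • sobMat piPerp (W t)) = (p / t) • sobComp 0 ℓ (W t) := by
      rw [map_smul, sobComp_mat hℓ']
      simp [piPerp]
    have e1 : sobComp 1 ℓ ((p / t) • sobMat piPerp (W t)) = 0 := by
      rw [map_smul, sobComp_mat hℓ']
      simp [piPerp]
    fin_cases i
    · simp only [Fin.zero_eta, sobComp_incl _ _ hℓ, hW'0 t ℓ hℓ]
      refine d0.congr_deriv ?_
      rw [show waveGroup c t ((p / t) • G (-t) (sobMat piPerp (G t (V t)))) = _ from hGG, e0, add_comm]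
    · simp only [Fin.mk_one, sobComp_incl _ _ hℓ, hW'1 t ℓ hℓ]
      refine d1.congr_deriv ?_
      rw [show waveGroup c t ((p / t) • G (-t) (sobMat piPerp (G t (V t)))) = _ from hGG, e1,
        add_zero, hc2]
  · rw [linearised_equation_iff hk h0.le h1]
    exact ⟨hW'0 t 0 (Nat.zero_le _), hW'1 t 0 (Nat.zero_le _)⟩
  · change G 1 (V₀ (-Real.log 1)) = W₁
    rw [Real.log_one, neg_zero, hV₀]
    exact waveGroup_waveGroup_neg hc.ne' 1 W₁

end

noncomputable section

variable {L : ℝ} [Fact (0 < L)]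

set_option linter.unusedSectionVars false

/-! ## Differential inequalities on `(0, 1]` -/

theorem monotoneOn_Ioc_of_deriv_nonneg {f f' : ℝ → ℝ}
    (hf : ∀ t ∈ Ioc (0 : ℝ) 1, HasDerivWithinAt f (f' t) (Ioc 0 1) t)
    (h0 : ∀ t ∈ Ioc (0 : ℝ) 1, 0 ≤ f' t) : MonotoneOn f (Ioc 0 1) := by
  refine monotoneOn_of_deriv_nonneg (convex_Ioc 0 1) (fun t ht => (hf t ht).continuousWithinAt) ?_ ?_
  · rw [interior_Ioc]
    intro t ht
    exact ((hf t ⟨ht.1, ht.2.le⟩).hasDerivAt (Ioc_mem_nhds ht.1 ht.2)).differentiableAt.differentiableWithinAt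
  · rw [interior_Ioc]
    intro t ht
    rw [((hf t ⟨ht.1, ht.2.le⟩).hasDerivAt (Ioc_mem_nhds ht.1 ht.2)).deriv]
    exact h0 t ⟨ht.1, ht.2.le⟩

theorem hasDerivAt_rpow_one_sub_div {κ t : ℝ} (hκ : κ < 1) (ht : 0 < t) :
    HasDerivAt (fun t : ℝ => t ^ (1 - κ) / (1 - κ)) (t ^ (-κ)) t := by
  have h := (Real.hasDerivAt_rpow_const (p := 1 - κ) (Or.inl ht.ne')).div_const (1 - κ)
  refine h.congr_deriv ?_
  have : 1 - κ ≠ 0 := by linarith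
  rw [show 1 - κ - 1 = -κ by ring]
  field_simp

/-- Formally (√f)' ≥ −A t^{−κ}, and this is integrated from t to 1. The square root is regularised
by ε² because f may vanish. -/
theorem sqrt_le_of_deriv_ge {f f' : ℝ → ℝ} {A κ : ℝ} (hA : 0 ≤ A) (hκ : κ < 1)
    (hf : ∀ t ∈ Ioc (0 : ℝ) 1, HasDerivWithinAt f (f' t) (Ioc 0 1) t)
    (hf0 : ∀ t, 0 ≤ f t) (hf' : ∀ t ∈ Ioc (0 : ℝ) 1, -(2 * (A * t ^ (-κ)) * √(f t)) ≤ f' t) {t : ℝ}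
    (ht : t ∈ Ioc (0 : ℝ) 1) : √(f t) ≤ √(f 1) + A / (1 - κ) := by
  have hκ' : 0 < 1 - κ := by linarith
  refine le_of_forall_pos_le_add fun ε hε => ?_
  have hη : 0 < ε ^ 2 := by positivity
  have hpos : ∀ t, 0 < f t + ε ^ 2 := fun t => by linarith [hf0 t]
  have hmono := monotoneOn_Ioc_of_deriv_nonneg
    (f := fun t => √(f t + ε ^ 2) + A * (t ^ (1 - κ) / (1 - κ)))
    (fun t ht => (((hf t ht).add_const (ε ^ 2)).sqrt (hpos t).ne').add
      ((hasDerivAt_rpow_one_sub_div hκ ht.1).const_mul A).hasDerivWithinAt) (fun t ht => by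
        have h1 := hf' t ht
        have h2 : √(f t) ≤ √(f t + ε ^ 2) := Real.sqrt_le_sqrt (by linarith)
        have h3 : 0 < √(f t + ε ^ 2) := Real.sqrt_pos.2 (hpos t)
        have h4 : 0 ≤ A * t ^ (-κ) := mul_nonneg hA (Real.rpow_nonneg ht.1.le _)
        have h5 : -(A * t ^ (-κ)) ≤ f' t / (2 * √(f t + ε ^ 2)) := by
          rw [le_div_iff₀ (by positivity)]
          nlinarith [mul_le_mul_of_nonneg_left h2 h4]
        linarith)
  have h1 := hmono ht ⟨one_pos, le_rfl⟩ ht.2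
  simp only [Real.one_rpow] at h1
  have h2 : 0 ≤ A * (t ^ (1 - κ) / (1 - κ)) := by
    have := Real.rpow_nonneg ht.1.le (1 - κ)
    positivity
  have h3 : √(f t) ≤ √(f t + ε ^ 2) := Real.sqrt_le_sqrt (by linarith)
  have h4 : √(f 1 + ε ^ 2) ≤ √(f 1) + ε := by
    refine Real.sqrt_le_iff.2 ⟨by positivity, ?_⟩
    have := Real.sq_sqrt (hf0 1)
    nlinarith [Real.sqrt_nonneg (f 1)]
  have h5 : A * (1 / (1 - κ)) = A / (1 - κ) := by ring
  linarith

theorem norm_sub_le_of_norm_deriv_le {E : Type*} [NormedAddCommGroup E] [NormedSpace ℝ E]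
    {f f' : ℝ → E} {A κ : ℝ} (hκ : κ < 1)
    (hf : ∀ t ∈ Ioc (0 : ℝ) 1, HasDerivWithinAt f (f' t) (Ioc 0 1) t)
    (hf' : ∀ t ∈ Ioc (0 : ℝ) 1, ‖f' t‖ ≤ A * t ^ (-κ)) {a b : ℝ} (ha : 0 < a) (hab : a ≤ b)
    (hb : b ≤ 1) : ‖f b - f a‖ ≤ A * (b ^ (1 - κ) / (1 - κ)) - A * (a ^ (1 - κ) / (1 - κ)) := by
  have hsub : Icc a b ⊆ Ioc 0 1 := fun t ht => ⟨ha.trans_le ht.1, ht.2.trans hb⟩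
  have hB : ∀ x ∈ Icc a b, HasDerivAt
      (fun x => A * (x ^ (1 - κ) / (1 - κ)) - A * (a ^ (1 - κ) / (1 - κ))) (A * x ^ (-κ)) x :=
    fun x hx => ((hasDerivAt_rpow_one_sub_div hκ (ha.trans_le hx.1)).const_mul A).sub_const _
  refine image_norm_le_of_norm_deriv_right_le_deriv_boundary' (f := fun x => f x - f a) (f' := f')
    (a := a) (b := b) (B := fun x => A * (x ^ (1 - κ) / (1 - κ)) - A * (a ^ (1 - κ) / (1 - κ)))
    (B' := fun x => A * x ^ (-κ)) ?_ (fun x hx => ?_) (by simp) ?_ (fun x hx => ?_)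
    (fun x hx => hf' x (hsub ⟨hx.1, hx.2.le⟩)) (right_mem_Icc.2 hab)
  · exact ContinuousOn.sub (fun x hx => ((hf x (hsub hx)).mono hsub).continuousWithinAt)
      continuousOn_const
  · have h1 := hf x (hsub ⟨hx.1, hx.2.le⟩)
    have h2 : HasDerivAt f (f' x) x :=
      h1.hasDerivAt (Ioc_mem_nhds (ha.trans_le hx.1) (hx.2.trans_le hb))
    exact (h2.sub_const _).hasDerivWithinAt
  · exact fun x hx => (hB x hx).continuousAt.continuousWithinAt
  · exact (hB x ⟨hx.1, hx.2.le⟩).hasDerivWithinAt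

theorem exists_tendsto_of_norm_deriv_le {E : Type*} [NormedAddCommGroup E] [NormedSpace ℝ E]
    [CompleteSpace E] {f f' : ℝ → E} {A κ : ℝ} (hκ : κ < 1)
    (hf : ∀ t ∈ Ioc (0 : ℝ) 1, HasDerivWithinAt f (f' t) (Ioc 0 1) t)
    (hf' : ∀ t ∈ Ioc (0 : ℝ) 1, ‖f' t‖ ≤ A * t ^ (-κ)) : ∃ l, Tendsto f (𝓝[>] 0) (𝓝 l) := by
  have hκ' : 0 < 1 - κ := by linarith
  have hg : Tendsto (fun t : ℝ => A * (t ^ (1 - κ) / (1 - κ))) (𝓝[>] 0) (𝓝 0) := by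
    have h1 : Tendsto (fun t : ℝ => t ^ (1 - κ)) (𝓝[>] 0) (𝓝 0) := by
      have := (Real.continuous_rpow_const hκ'.le).tendsto 0
      rw [Real.zero_rpow hκ'.ne'] at this
      exact this.mono_left nhdsWithin_le_nhds
    simpa using (h1.div_const (1 - κ)).const_mul A
  refine cauchy_map_iff_exists_tendsto.1 (Metric.cauchy_iff.2 ⟨inferInstance, fun ε hε => ?_⟩)
  have h1 := (Metric.tendsto_nhds.1 hg (ε / 2) (by positivity)).and
    (Ioc_mem_nhdsGT (zero_lt_one (α := ℝ)))
  refine ⟨f '' {t | dist (A * (t ^ (1 - κ) / (1 - κ))) 0 < ε / 2 ∧ t ∈ Ioc (0 : ℝ) 1},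
    image_mem_map h1, ?_⟩
  have key : ∀ a b : ℝ, dist (A * (a ^ (1 - κ) / (1 - κ))) 0 < ε / 2 →
      dist (A * (b ^ (1 - κ) / (1 - κ))) 0 < ε / 2 → 0 < a → a ≤ b → b ≤ 1 →
      dist (f b) (f a) < ε := by
    intro a b h1 h2 ha hab hb
    rw [dist_eq_norm]
    refine (norm_sub_le_of_norm_deriv_le hκ hf hf' ha hab hb).trans_lt ?_
    rw [dist_zero_right, Real.norm_eq_abs, abs_lt] at h1 h2
    linarith [h1.1, h2.2]
  rintro _ ⟨a, ⟨ha, ha'⟩, rfl⟩ _ ⟨b, ⟨hb, hb'⟩, rfl⟩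
  rcases le_total a b with hab | hab
  · rw [dist_comm]
    exact key a b ha hb ha'.1 hab hb'.2
  · exact key b a hb ha hb'.1 hab ha'.2

/-- With the integrating factor t^{−p} the derivative becomes t^{−p} g, which is integrable because
κ + p < 1. Hence t^{−p} f has a limit, and f is t^p times a convergent function. -/
theorem tendsto_zero_of_singular_deriv {E : Type*} [NormedAddCommGroup E] [NormedSpace ℝ E]
    [CompleteSpace E] {f f' g : ℝ → E} {A κ p : ℝ} (hp : 0 < p) (hκ : κ + p < 1)
    (hf : ∀ t ∈ Ioc (0 : ℝ) 1, HasDerivWithinAt f (f' t) (Ioc 0 1) t)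
    (hf' : ∀ t ∈ Ioc (0 : ℝ) 1, f' t = (p / t) • f t + g t)
    (hg : ∀ t ∈ Ioc (0 : ℝ) 1, ‖g t‖ ≤ A * t ^ (-κ)) : Tendsto f (𝓝[>] 0) (𝓝 0) := by
  have hd : ∀ t ∈ Ioc (0 : ℝ) 1, HasDerivWithinAt (fun t => t ^ (-p) • f t) (t ^ (-p) • g t)
      (Ioc 0 1) t := by
    intro t ht
    have h1 := (Real.hasDerivAt_rpow_const (x := t) (p := -p)
      (Or.inl ht.1.ne')).hasDerivWithinAt (s := Ioc 0 1)
    refine (h1.smul (hf t ht)).congr_deriv ?_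
    rw [hf' t ht, Real.rpow_sub_one ht.1.ne']
    match_scalars
    · have := ht.1.ne'
      field_simp
      ring
    · ring
  obtain ⟨l, hl⟩ := exists_tendsto_of_norm_deriv_le (A := A) hκ hd fun t ht => by
    rw [norm_smul, Real.norm_of_nonneg (Real.rpow_nonneg ht.1.le _), neg_add, Real.rpow_add ht.1]
    calc _ ≤ t ^ (-p) * (A * t ^ (-κ)) :=
          mul_le_mul_of_nonneg_left (hg t ht) (Real.rpow_nonneg ht.1.le _)
      _ = _ := by ring
  have h1 : Tendsto (fun t : ℝ => t ^ p) (𝓝[>] 0) (𝓝 0) := by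
    have := (Real.continuous_rpow_const hp.le).tendsto 0
    rw [Real.zero_rpow hp.ne'] at this
    exact this.mono_left nhdsWithin_le_nhds
  have h2 := h1.smul hl
  rw [zero_smul] at h2
  refine h2.congr' ?_
  filter_upwards [self_mem_nhdsWithin] with t ht
  rw [smul_smul, ← Real.rpow_add ht, add_neg_cancel, Real.rpow_zero, one_smul]

/-! ## Energy estimate for the constant coefficient system -/

/-- The cross terms cancel after integration by parts and the singular term contributes 2σ(p/t)‖z‖²
≥ 0, so going back from t = 1 only the errors can increase the energy. The factor 2 in front of A
counts the two error terms. -/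
theorem constant_coeff_energy {σ p A κ : ℝ} (hσ : 0 < σ) (hσ1 : σ < 1) (hp : 0 ≤ p) (hA : 0 ≤ A)
    (hκ : κ < 1) {z w zx wx r₀ r₁ : ℝ → ScalarL2 L}
    (hz : ∀ t ∈ Ioc (0 : ℝ) 1, HasDerivWithinAt z ((p / t) • z t + wx t - r₀ t) (Ioc 0 1) t)
    (hw : ∀ t ∈ Ioc (0 : ℝ) 1, HasDerivWithinAt w (σ • zx t - r₁ t) (Ioc 0 1) t)
    (hzx : ∀ t ∈ Ioc (0 : ℝ) 1, InH1 (z t) (zx t)) (hwx : ∀ t ∈ Ioc (0 : ℝ) 1, InH1 (w t) (wx t))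
    (hr₀ : ∀ t ∈ Ioc (0 : ℝ) 1, ‖r₀ t‖ ≤ A * t ^ (-κ))
    (hr₁ : ∀ t ∈ Ioc (0 : ℝ) 1, ‖r₁ t‖ ≤ A * t ^ (-κ)) {t : ℝ} (ht : t ∈ Ioc (0 : ℝ) 1) :
    √(σ * ‖z t‖ ^ 2 + ‖w t‖ ^ 2) ≤ √(σ * ‖z 1‖ ^ 2 + ‖w 1‖ ^ 2) + 2 * A / (1 - κ) := by
  refine sqrt_le_of_deriv_ge (f := fun t => σ * ‖z t‖ ^ 2 + ‖w t‖ ^ 2) (A := 2 * A) (by positivity)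
    hκ (fun t ht => ((hz t ht).norm_sq.const_mul σ).add (hw t ht).norm_sq)
    (fun t => by positivity) (fun t ht => ?_) ht
  have hibp := inner_integration_by_parts_one (hzx t ht) (hwx t ht)
  have hsw : inner ℝ (w t) (zx t) = inner ℝ (zx t) (w t) := real_inner_comm _ _
  simp only [inner_sub_right, inner_add_right, inner_smul_right, real_inner_self_eq_norm_sq]
  rw [hsw]
  set ε := √(σ * ‖z t‖ ^ 2 + ‖w t‖ ^ 2)
  have hR : 0 ≤ A * t ^ (-κ) := mul_nonneg hA (Real.rpow_nonneg ht.1.le _)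
  have h1 : σ * ‖z t‖ ≤ ε := by
    refine Real.le_sqrt_of_sq_le ?_
    have := sq_nonneg ‖z t‖
    have : (σ * ‖z t‖) ^ 2 = σ * (σ * ‖z t‖ ^ 2) := by ring
    nlinarith [mul_nonneg hσ.le (sq_nonneg ‖z t‖), sq_nonneg ‖w t‖]
  have h2 : ‖w t‖ ≤ ε := by
    refine Real.le_sqrt_of_sq_le ?_
    nlinarith [mul_nonneg hσ.le (sq_nonneg ‖z t‖)]
  have h3 : inner ℝ (z t) (r₀ t) ≤ ‖z t‖ * (A * t ^ (-κ)) :=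
    (real_inner_le_norm _ _).trans (mul_le_mul_of_nonneg_left (hr₀ t ht) (norm_nonneg _))
  have h4 : inner ℝ (w t) (r₁ t) ≤ ‖w t‖ * (A * t ^ (-κ)) :=
    (real_inner_le_norm _ _).trans (mul_le_mul_of_nonneg_left (hr₁ t ht) (norm_nonneg _))
  have h5 : 0 ≤ p / t * ‖z t‖ ^ 2 := mul_nonneg (div_nonneg hp ht.1.le) (sq_nonneg _)
  have h6 := mul_le_mul_of_nonneg_right h1 hR
  have h7 := mul_le_mul_of_nonneg_right h2 hR
  have h8 := mul_nonneg hσ.le h5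
  have h9 := mul_le_mul_of_nonneg_left h3 hσ.le
  nlinarith

/-! ## The linearised equation -/

section Linearised

variable {k : ℕ} {σ : ℝ}

theorem hasDerivWithinAt_sobComp {W : ℝ → sobolev L k} {W' : sobolev L (k - 1)} {t : ℝ} {s : Set ℝ}
    (h : HasDerivWithinAt (fun s => sobolevIncl (Nat.sub_le k 1) (W s)) W' s t) {ℓ : ℕ}
    (hℓ : ℓ ≤ k - 1) (i : Fin 2) :
    HasDerivWithinAt (fun s => sobComp i ℓ (W s)) (sobComp i ℓ W') s t := by
  have := (sobComp i ℓ).hasFDerivAt.comp_hasDerivWithinAt t h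
  refine this.congr_of_eventuallyEq ?_ ?_
  · exact Eventually.of_forall fun s => (sobComp_incl _ i hℓ (W s)).symm
  · exact (sobComp_incl _ i hℓ (W t)).symm

/-- The equation is given at order zero only. Both sides have weak derivatives up to order k − 1,
and uniqueness of these transfers the equation to order ℓ. -/
theorem SolvesLinearised.hasDerivWithinAt {hk : 1 ≤ k} (h0 : 0 ≤ σ) (h1 : σ < 1) {W : ℝ → sobolev L k}
    (hW : SolvesLinearised hk σ W) {t : ℝ} (ht : t ∈ Ioc (0 : ℝ) 1) {ℓ : ℕ} (hℓ : ℓ ≤ k - 1) :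
    HasDerivWithinAt (fun s => sobComp 0 ℓ (W s))
      (((3 * σ - 1) / t) • sobComp 0 ℓ (W t) + sobComp 1 (ℓ + 1) (W t)) (Ioc 0 1) t ∧
    HasDerivWithinAt (fun s => sobComp 1 ℓ (W s)) (σ • sobComp 0 (ℓ + 1) (W t)) (Ioc 0 1) t := by
  obtain ⟨-, W', -, hd, he⟩ := hW
  obtain ⟨e0, e1⟩ := (linearised_equation_iff hk h0 h1 t (W' t) (W t)).1 (he t ht)
  have g0 : sobComp 0 ℓ (W' t) = ((3 * σ - 1) / t) • sobComp 0 ℓ (W t) + sobComp 1 (ℓ + 1) (W t) := by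
    refine (iterDx_sobComp hℓ 0 (W' t)).unique ?_
    rw [e0]
    exact ((iterDx_sobComp (by omega) 0 (W t)).smul _).add (iterDx_sobComp_one (by omega) 1 (W t))
  have g1 : sobComp 1 ℓ (W' t) = σ • sobComp 0 (ℓ + 1) (W t) := by
    refine (iterDx_sobComp hℓ 1 (W' t)).unique ?_
    rw [e1]
    exact (iterDx_sobComp_one (by omega) 0 (W t)).smul _
  rw [← g0, ← g1]
  exact ⟨hasDerivWithinAt_sobComp (hd t ht) hℓ 0, hasDerivWithinAt_sobComp (hd t ht) hℓ 1⟩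

theorem SolvesLinearised.sub {hk : 1 ≤ k} (h0 : 0 ≤ σ) (h1 : σ < 1) {V W : ℝ → sobolev L k}
    (hV : SolvesLinearised hk σ V) (hW : SolvesLinearised hk σ W) :
    SolvesLinearised hk σ (fun t => V t - W t) := by
  obtain ⟨cV, V', cV', hdV, heV⟩ := hV
  obtain ⟨cW, W', cW', hdW, heW⟩ := hW
  refine ⟨cV.sub cW, fun t => V' t - W' t, cV'.sub cW', fun t ht => ?_, fun t ht => ?_⟩
  · simp only [map_sub]
    exact (hdV t ht).sub (hdW t ht)
  · obtain ⟨e0, e1⟩ := (linearised_equation_iff hk h0 h1 t (V' t) (V t)).1 (heV t ht)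
    obtain ⟨e0', e1'⟩ := (linearised_equation_iff hk h0 h1 t (W' t) (W t)).1 (heW t ht)
    refine (linearised_equation_iff hk h0 h1 t (V' t - W' t) (V t - W t)).2 ⟨?_, ?_⟩
    · simp only [map_sub, e0, e0', smul_sub]; abel
    · simp only [map_sub, e1, e1', smul_sub]

/-- Below order k this is the energy estimate without errors. At order k the time derivative is
unavailable, so the estimate is applied to difference quotients of order k − 1, which solve the same
system, and h → 0. -/
theorem SolvesLinearised.energy_le {hk : 1 ≤ k} (h0 : 1 / 3 < σ) (h1 : σ < 1) {W : ℝ → sobolev L k}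
    (hW : SolvesLinearised hk σ W) {t : ℝ} (ht : t ∈ Ioc (0 : ℝ) 1) {ℓ : ℕ} (hℓ : ℓ ≤ k) :
    σ * ‖sobComp 0 ℓ (W t)‖ ^ 2 + ‖sobComp 1 ℓ (W t)‖ ^ 2 ≤
      σ * ‖sobComp 0 ℓ (W 1)‖ ^ 2 + ‖sobComp 1 ℓ (W 1)‖ ^ 2 := by
  have hσ : 0 < σ := by linarith
  have key : ∀ T : ScalarL2 L →L[ℝ] ScalarL2 L,
      (∀ {f g : ScalarL2 L}, InH1 f g → InH1 (T f) (T g)) → ∀ ℓ, ℓ ≤ k - 1 →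
      σ * ‖T (sobComp 0 ℓ (W t))‖ ^ 2 + ‖T (sobComp 1 ℓ (W t))‖ ^ 2 ≤
        σ * ‖T (sobComp 0 ℓ (W 1))‖ ^ 2 + ‖T (sobComp 1 ℓ (W 1))‖ ^ 2 := by
    intro T hT ℓ hℓ
    have h := constant_coeff_energy (σ := σ) (p := 3 * σ - 1) (A := 0) (κ := 0) hσ h1 (by linarith)
      le_rfl one_pos (z := fun s => T (sobComp 0 ℓ (W s)))
      (w := fun s => T (sobComp 1 ℓ (W s))) (zx := fun s => T (sobComp 0 (ℓ + 1) (W s)))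
      (wx := fun s => T (sobComp 1 (ℓ + 1) (W s))) (r₀ := 0) (r₁ := 0)
      (fun s hs => by
        have := T.hasFDerivAt.comp_hasDerivWithinAt s (hW.hasDerivWithinAt hσ.le h1 hs hℓ).1
        exact this.congr_deriv (by simp))
      (fun s hs => by
        have := T.hasFDerivAt.comp_hasDerivWithinAt s (hW.hasDerivWithinAt hσ.le h1 hs hℓ).2
        exact this.congr_deriv (by simp))
      (fun s _ => hT (inH1_sobComp (by omega) 0 _)) (fun s _ => hT (inH1_sobComp (by omega) 1 _))
      (fun s _ => by simp) (fun s _ => by simp) ht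
    rw [mul_zero, zero_div, add_zero] at h
    exact (Real.sqrt_le_sqrt_iff (by positivity)).1 h
  rcases hℓ.lt_or_eq with hlt | rfl
  · exact key (ContinuousLinearMap.id ℝ _) (fun h => h) ℓ (by omega)
  · obtain ⟨m, rfl⟩ : ∃ m, ℓ = m + 1 := ⟨ℓ - 1, by omega⟩
    have hlim : ∀ s, Tendsto (fun h => σ * ‖diffQuot h (sobComp 0 m (W s))‖ ^ 2 +
        ‖diffQuot h (sobComp 1 m (W s))‖ ^ 2) (𝓝[≠] 0)
        (𝓝 (σ * ‖sobComp 0 (m + 1) (W s)‖ ^ 2 + ‖sobComp 1 (m + 1) (W s)‖ ^ 2)) := fun s =>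
      (((inH1_sobComp (Nat.lt_succ_self m) 0 (W s)).tendsto_diffQuot.norm.pow 2).const_mul σ).add
        ((inH1_sobComp (Nat.lt_succ_self m) 1 (W s)).tendsto_diffQuot.norm.pow 2)
    exact le_of_tendsto_of_tendsto' (hlim t) (hlim 1) fun h =>
      key (diffQuot h) (fun hf => hf.diffQuot h) m (by omega)

theorem SolvesLinearised.norm_le {hk : 1 ≤ k} (h0 : 1 / 3 < σ) (h1 : σ < 1) {W : ℝ → sobolev L k}
    (hW : SolvesLinearised hk σ W) {t : ℝ} (ht : t ∈ Ioc (0 : ℝ) 1) : ‖W t‖ ≤ σ⁻¹ * ‖W 1‖ := by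
  have hσ : 0 < σ := by linarith
  have h2 : σ * ‖W t‖ ^ 2 ≤ ‖W 1‖ ^ 2 := by
    rw [norm_sq_eq_sobComp, norm_sq_eq_sobComp, Finset.mul_sum]
    refine Finset.sum_le_sum fun ℓ hℓ => ?_
    have := hW.energy_le h0 h1 ht (Nat.lt_succ_iff.1 (Finset.mem_range.1 hℓ))
    nlinarith [sq_nonneg ‖sobComp 0 ℓ (W 1)‖, sq_nonneg ‖sobComp 1 ℓ (W t)‖]
  refine abs_le_of_sq_le_sq' ?_ (by positivity) |>.2
  rw [mul_pow, inv_pow, inv_mul_eq_div, le_div_iff₀ (by positivity)]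
  nlinarith [sq_nonneg ‖W t‖, mul_nonneg hσ.le (sq_nonneg ‖W t‖)]

theorem SolvesLinearised.eqOn {hk : 1 ≤ k} (h0 : 1 / 3 < σ) (h1 : σ < 1) {V W : ℝ → sobolev L k}
    (hV : SolvesLinearised hk σ V) (hW : SolvesLinearised hk σ W) (h : V 1 = W 1) :
    EqOn V W (Ioc 0 1) := fun t ht => by
  have h2 := (hV.sub (by linarith) h1 hW).norm_le h0 h1 ht
  rw [h, sub_self, norm_zero, mul_zero] at h2
  exact sub_eq_zero.1 (norm_le_zero_iff.1 h2)

/-- In H^{k−1} the term with ∂ₓW is bounded. Thus w has bounded velocity and z is O(t^p) by the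
integrating factor; σ < 2/3 says p < 1. -/
theorem SolvesLinearised.exists_tendsto {hk : 1 ≤ k} (h0 : 1 / 3 < σ) (h1 : σ < 2 / 3)
    {W : ℝ → sobolev L k} (hW : SolvesLinearised hk σ W) :
    ∃ W₀, Tendsto (fun t => sobolevIncl (Nat.sub_le k 1) (W t)) (𝓝[>] 0) (𝓝 W₀) := by
  have hσ : 0 < σ := by linarith
  have hb : ∀ t ∈ Ioc (0 : ℝ) 1, ∀ i ℓ, ‖sobComp i ℓ (W t)‖ ≤ σ⁻¹ * ‖W 1‖ := fun t ht i ℓ =>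
    (norm_sobComp_le i ℓ _).trans (hW.norm_le h0 (by linarith) ht)
  refine exists_tendsto_sobolev fun ℓ hℓ i => ?_
  simp only [sobComp_incl _ _ hℓ]
  fin_cases i
  · refine ⟨0, tendsto_zero_of_singular_deriv (A := σ⁻¹ * ‖W 1‖) (κ := 0) (p := 3 * σ - 1)
      (by linarith) (by linarith) (fun t ht => (hW.hasDerivWithinAt hσ.le (by linarith) ht hℓ).1)
      (fun t _ => rfl) fun t ht => ?_⟩
    rw [neg_zero, Real.rpow_zero, mul_one]
    exact hb t ht _ _
  · refine exists_tendsto_of_norm_deriv_le (A := σ * (σ⁻¹ * ‖W 1‖)) (κ := 0) one_pos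
      (fun t ht => (hW.hasDerivWithinAt hσ.le (by linarith) ht hℓ).2) fun t ht => ?_
    rw [neg_zero, Real.rpow_zero, mul_one, norm_smul, Real.norm_of_nonneg hσ.le]
    exact mul_le_mul_of_nonneg_left (hb t ht _ _) hσ.le

end Linearised

end

noncomputable section

variable {L : ℝ} [Fact (0 < L)]

set_option linter.unusedSectionVars false

/-! ## The embedding `H^k ⊆ C^ℓ`, `ℓ < k` -/

/-- The continuous representative of the `i`-th component of the derivative of order `ℓ < k`. -/
def sobC {k ℓ : ℕ} (h : ℓ < k) (i : Fin 2) : sobolev L k →L[ℝ] CircleC L :=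
  LinearMap.mkContinuous
    { toFun := fun u => (exists_toL2_sobComp h i u).choose
      map_add' := fun u v => toL2_injective <|
        (exists_toL2_sobComp h i (u + v)).choose_spec.trans <| by
          simp only [map_add, (exists_toL2_sobComp h i _).choose_spec]
      map_smul' := fun a u => toL2_injective <|
        (exists_toL2_sobComp h i (a • u)).choose_spec.trans <| by
          simp only [map_smul, RingHom.id_apply, (exists_toL2_sobComp h i _).choose_spec] }
    (2 * supConst L) fun u => by
      refine SobLe.norm_le_of_toL2 (m := 0) ?_
      change SobLe 1 (toL2 (exists_toL2_sobComp h i u).choose) ‖u‖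
      rw [(exists_toL2_sobComp h i u).choose_spec]
      exact sobLe_sobComp h i u

theorem toL2_sobC {k ℓ : ℕ} (h : ℓ < k) (i : Fin 2) (u : sobolev L k) :
    toL2 (sobC h i u) = sobComp i ℓ u := (exists_toL2_sobComp h i u).choose_spec

theorem norm_sobC_le {k ℓ : ℕ} (h : ℓ < k) (i : Fin 2) (u : sobolev L k) :
    ‖sobC h i u‖ ≤ 2 * supConst L * ‖u‖ := by
  refine SobLe.norm_le_of_toL2 (m := 0) ?_
  rw [toL2_sobC]
  exact sobLe_sobComp h i u

theorem sobC_incl {j k ℓ : ℕ} (h : j ≤ k) (hℓ : ℓ < j) (i : Fin 2) (u : sobolev L k) :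
    sobC hℓ i (sobolevIncl h u) = sobC (hℓ.trans_le h) i u := toL2_injective <| by
  rw [toL2_sobC, toL2_sobC, sobComp_incl h i hℓ.le]

/-! ## The coefficients along a solution -/

/-- The coefficient `b_ij(y)`. -/
def coefC {σ : ℝ} (h0 : 0 ≤ σ) (h1 : σ < 1) (i j : Fin 2) (y : CircleC L) : CircleC L :=
  compC (coeffB σ i j) (weightedSymbol_coeffB h0 h1 i j).contDiff.continuous y

theorem nonlinear_equation_iff {k : ℕ} (hk : 1 ≤ k) {σ : ℝ} (h0 : 0 ≤ σ) (h1 : σ < 1) (t : ℝ)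
    (u' : sobolev L (k - 1)) (u : sobolev L k) :
    (∀ᵐ x : AddCircle L, sobolevFun u' x +
      (fuchsianB σ t (sobolevFun u x 1)).toEuclideanLin (sobolevDx hk u x) =
      ((3 * σ - 1) / t) • piPerp.toEuclideanLin (sobolevFun u x)) ↔
    (sobComp 0 0 u' + (cmul (coefC h0 h1 0 0 (t ^ (1 - 3 * σ) • sobC hk 1 u)) (sobComp 0 1 u) +
      cmul (coefC h0 h1 0 1 (t ^ (1 - 3 * σ) • sobC hk 1 u)) (sobComp 1 1 u)) =
        ((3 * σ - 1) / t) • sobComp 0 0 u ∧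
    sobComp 1 0 u' + (cmul (coefC h0 h1 1 0 (t ^ (1 - 3 * σ) • sobC hk 1 u)) (sobComp 0 1 u) +
      cmul (coefC h0 h1 1 1 (t ^ (1 - 3 * σ) • sobC hk 1 u)) (sobComp 1 1 u)) = 0) := by
  refine equation_iff_sobComp hk (M := fun x => fuchsianB σ t (sobolevFun u x 1))
    (B := fun i j => coefC h0 h1 i j (t ^ (1 - 3 * σ) • sobC hk 1 u)) ?_
  have h := toL2_ae (sobC hk 1 u)
  rw [toL2_sobC] at h
  filter_upwards [h, sobolevFun_ae u 1] with x h1 h2 i j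
  rw [← h2, h1]
  rfl

/-- The equations satisfied by the derivatives of a solution. -/
theorem sobComp_of_nonlinear_equation {k : ℕ} (hk : 1 ≤ k) {σ : ℝ} (h0 : 0 ≤ σ) (h1 : σ < 1)
    {t : ℝ} {u' : sobolev L (k - 1)} {u : sobolev L k}
    (h : ∀ᵐ x : AddCircle L, sobolevFun u' x +
      (fuchsianB σ t (sobolevFun u x 1)).toEuclideanLin (sobolevDx hk u x) =
      ((3 * σ - 1) / t) • piPerp.toEuclideanLin (sobolevFun u x))
    {ℓ : ℕ} (hℓ : ℓ ≤ k - 1) {F : Fin 2 → Fin 2 → ScalarL2 L}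
    (hF : ∀ i j, IterDx ℓ (cmul (coefC h0 h1 i j (t ^ (1 - 3 * σ) • sobC hk 1 u)) (sobComp j 1 u))
      (F i j)) :
    sobComp 0 ℓ u' = ((3 * σ - 1) / t) • sobComp 0 ℓ u - (F 0 0 + F 0 1) ∧
    sobComp 1 ℓ u' = -(F 1 0 + F 1 1) := by
  obtain ⟨e0, e1⟩ := (nonlinear_equation_iff hk h0 h1 t u' u).1 h
  constructor
  · refine (iterDx_sobComp hℓ 0 u').unique ?_
    rw [eq_sub_of_add_eq e0]
    exact ((iterDx_sobComp (by omega) 0 u).smul _).sub ((hF 0 0).add (hF 0 1))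
  · refine (iterDx_sobComp hℓ 1 u').unique ?_
    rw [eq_neg_of_add_eq_zero_left e1, ← neg_one_smul ℝ, ← neg_one_smul ℝ (F 1 0 + F 1 1)]
    exact ((hF 1 0).add (hF 1 1)).smul _

/-- The velocity of `w` as a continuous function. -/
theorem sobC_of_nonlinear_equation {k : ℕ} (hk : 1 < k) {σ : ℝ} (h0 : 0 ≤ σ) (h1 : σ < 1)
    {t : ℝ} {u' : sobolev L (k - 1)} {u : sobolev L k}
    (h : ∀ᵐ x : AddCircle L, sobolevFun u' x +
      (fuchsianB σ t (sobolevFun u x 1)).toEuclideanLin (sobolevDx hk.le u x) =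
      ((3 * σ - 1) / t) • piPerp.toEuclideanLin (sobolevFun u x)) :
    sobC (by omega : 0 < k - 1) 1 u' =
      -(coefC h0 h1 1 0 (t ^ (1 - 3 * σ) • sobC hk.le 1 u) * sobC hk 0 u +
        coefC h0 h1 1 1 (t ^ (1 - 3 * σ) • sobC hk.le 1 u) * sobC hk 1 u) := toL2_injective <| by
  have e1 := ((nonlinear_equation_iff hk.le h0 h1 t u' u).1 h).2
  rw [toL2_sobC, eq_neg_of_add_eq_zero_left e1, map_neg, map_add, ← cmul_toL2, ← cmul_toL2,
    toL2_sobC, toL2_sobC]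

/-! ## The energy of the top order derivatives -/

/-- The quadratic form of the symmetrised system. -/
def energyForm (s : CircleC L) (z w : ScalarL2 L) : ℝ := inner ℝ (cmul s z) z + ‖w‖ ^ 2

/-- The rate of change of the energy. -/
def energyRate (q d e s : CircleC L) (z w r₀ r₁ : ScalarL2 L) : ℝ :=
  inner ℝ (cmul q z) z + 2 * inner ℝ (cmul d z) w + inner ℝ (cmul e w) w -
    2 * inner ℝ (cmul s z) r₀ - 2 * inner ℝ w r₁

theorem abs_inner_cmul_le (c : CircleC L) (f g : ScalarL2 L) :
    |inner ℝ (cmul c f) g| ≤ ‖c‖ * ‖f‖ * ‖g‖ :=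
  (abs_real_inner_le_norm _ _).trans
    (mul_le_mul_of_nonneg_right (norm_cmul_le c f) (norm_nonneg g))

/-- A crude bound, whose only role is to supply the dominating constant when h → 0 in the difference
quotients. -/
theorem abs_energyRate_le {q d e s : CircleC L} {z w r₀ r₁ : ScalarL2 L} {M : ℝ} (hq : ‖q‖ ≤ M)
    (hd : ‖d‖ ≤ M) (he : ‖e‖ ≤ M) (hs : ‖s‖ ≤ M) (hz : ‖z‖ ≤ 1) (hw : ‖w‖ ≤ 1)
    (hr₀ : ‖r₀‖ ≤ M) (hr₁ : ‖r₁‖ ≤ M) : |energyRate q d e s z w r₀ r₁| ≤ 6 * M + 2 * M * M := by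
  have hM : 0 ≤ M := (norm_nonneg q).trans hq
  have key : ∀ (c : CircleC L) (f g : ScalarL2 L) (B : ℝ), ‖c‖ ≤ M → ‖f‖ ≤ 1 → ‖g‖ ≤ B →
      |inner ℝ (cmul c f) g| ≤ M * B := fun c f g B hc hf hg => by
    refine (abs_inner_cmul_le c f g).trans ?_
    refine mul_le_mul ?_ hg (norm_nonneg g) hM
    calc ‖c‖ * ‖f‖ ≤ M * 1 := mul_le_mul hc hf (norm_nonneg f) hM
      _ = M := mul_one M
  have h1 := abs_le.1 (key q z z 1 hq hz hz)
  have h2 := abs_le.1 (key d z w 1 hd hz hw)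
  have h3 := abs_le.1 (key e w w 1 he hw hw)
  have h4 := abs_le.1 (key s z r₀ M hs hz hr₀)
  have h5 : |inner ℝ w r₁| ≤ M := by
    refine (abs_real_inner_le_norm _ _).trans ?_
    calc ‖w‖ * ‖r₁‖ ≤ 1 * M := mul_le_mul hw hr₁ (norm_nonneg _) zero_le_one
      _ = M := one_mul M
  have h5 := abs_le.1 h5
  rw [abs_le, energyRate]
  constructor <;> nlinarith

theorem tendsto_energyRate {ι : Type*} {l : Filter ι} {q d e s : CircleC L}
    {z w r₀ r₁ : ι → ScalarL2 L} {z' w' r₀' r₁' : ScalarL2 L} (hz : Tendsto z l (𝓝 z'))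
    (hw : Tendsto w l (𝓝 w')) (hr₀ : Tendsto r₀ l (𝓝 r₀')) (hr₁ : Tendsto r₁ l (𝓝 r₁')) :
    Tendsto (fun h => energyRate q d e s (z h) (w h) (r₀ h) (r₁ h)) l
      (𝓝 (energyRate q d e s z' w' r₀' r₁')) := by
  have hc : ∀ c : CircleC L, ∀ {f : ι → ScalarL2 L} {f' : ScalarL2 L}, Tendsto f l (𝓝 f') →
      Tendsto (fun h => cmul c (f h)) l (𝓝 (cmul c f')) :=
    fun c _ _ hf => ((cmul c).continuous.tendsto _).comp hf
  exact (((((hc q hz).inner hz).add (((hc d hz).inner hw).const_mul 2)).add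
    ((hc e hw).inner hw)).sub (((hc s hz).inner hr₀).const_mul 2)).sub
    ((hw.inner hr₁).const_mul 2)

/-- The energy identity for the difference quotients of a solution of a symmetrisable system. -/
theorem hasDerivWithinAt_energyForm_diffQuot {s : ℝ → CircleC L} {s' : CircleC L}
    {z w : ℝ → ScalarL2 L} {zx wx g₀ g₁ : ScalarL2 L} {b : Fin 2 → Fin 2 → CircleC L}
    {d₀ d e : CircleC L} {S : Set ℝ} {t κ : ℝ} (hs : HasDerivWithinAt s s' S t)
    (hz : HasDerivWithinAt z (κ • z t - (cmul (b 0 0) zx + cmul (b 0 1) wx + g₀)) S t)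
    (hw : HasDerivWithinAt w (-(cmul (b 1 0) zx + cmul (b 1 1) wx + g₁)) S t)
    (hzx : InH1 (z t) zx) (hwx : InH1 (w t) wx) (hsb : s t * b 0 1 = b 1 0)
    (hd₀ : InH1 (toL2 (s t * b 0 0)) (toL2 d₀)) (hd : InH1 (toL2 (b 1 0)) (toL2 d))
    (he : InH1 (toL2 (b 1 1)) (toL2 e)) (h : ℝ) :
    HasDerivWithinAt (fun r => energyForm (s r) (diffQuot h (z r)) (diffQuot h (w r)))
      (energyRate (s' + (2 * κ) • s t + d₀) d e (s t) (diffQuot h (z t)) (diffQuot h (w t))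
        (cmul (diffQuotC h (b 0 0)) (shiftLp h zx) + cmul (diffQuotC h (b 0 1)) (shiftLp h wx) +
          diffQuot h g₀)
        (cmul (diffQuotC h (b 1 0)) (shiftLp h zx) + cmul (diffQuotC h (b 1 1)) (shiftLp h wx) +
          diffQuot h g₁)) S t := by
  have hz' := (diffQuot h).hasFDerivAt.comp_hasDerivWithinAt t hz
  have hw' := (diffQuot h).hasFDerivAt.comp_hasDerivWithinAt t hw
  have hE := ((hs.cmul hz').inner ℝ hz').add hw'.norm_sq
  refine hE.congr_deriv ?_
  simp only [Function.comp_apply, map_sub, map_add, map_neg, map_smul, diffQuot_cmul]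
  -- The functions zx and wx are merely in L², but the difference quotients of z and w lie in H¹
  -- with derivatives D_h zx and D_h wx. These three identities remove the x-derivative from all
  -- principal terms; symmetry, s b₀₁ = b₁₀, lets the off-diagonal ones combine into one.
  have i0 := inner_integration_by_parts hd₀ (hzx.diffQuot h) (hzx.diffQuot h)
  have i1 := inner_integration_by_parts hd (hzx.diffQuot h) (hwx.diffQuot h)
  have i2 := inner_integration_by_parts he (hwx.diffQuot h) (hwx.diffQuot h)
  set Z := diffQuot h (z t)
  set V := diffQuot h (w t)
  set Zx := diffQuot h zx
  set Vx := diffQuot h wx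
  have j0 : inner ℝ (cmul (s t) (cmul (b 0 0) Zx)) Z = inner ℝ (cmul (s t * b 0 0) Zx) Z := by
    rw [cmul_mul]
  have j0' : inner ℝ (cmul (s t) Z) (cmul (b 0 0) Zx) = inner ℝ (cmul (s t * b 0 0) Z) Zx := by
    rw [mul_comm (s t), cmul_mul]
    exact (inner_cmul_left _ _ _).symm
  have j1 : inner ℝ (cmul (s t) (cmul (b 0 1) Vx)) Z = inner ℝ (cmul (b 1 0) Z) Vx := by
    rw [← cmul_mul, hsb, inner_cmul_left, real_inner_comm]
  have j1' : inner ℝ (cmul (s t) Z) (cmul (b 0 1) Vx) = inner ℝ (cmul (b 1 0) Z) Vx := by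
    rw [inner_cmul_left, ← cmul_mul, hsb, ← inner_cmul_left]
  have j2 : inner ℝ V (cmul (b 1 0) Zx) = inner ℝ (cmul (b 1 0) Zx) V := real_inner_comm _ _
  have j3 : inner ℝ V (cmul (b 1 1) Vx) = inner ℝ (cmul (b 1 1) Vx) V := real_inner_comm _ _
  have j3' : inner ℝ (cmul (b 1 1) V) Vx = inner ℝ (cmul (b 1 1) Vx) V := by
    rw [inner_cmul_left, real_inner_comm]
  have j4 : ∀ f, inner ℝ (cmul (s t) f) Z = inner ℝ (cmul (s t) Z) f := fun f => by
    rw [inner_cmul_left, real_inner_comm]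
  simp only [energyRate, map_add, map_smul, add_apply, smul_apply, inner_add_left, inner_add_right,
    inner_sub_left, inner_sub_right, inner_smul_left, inner_smul_right, inner_neg_right,
    RCLike.conj_to_real]
  rw [j0, j1, j0', j1', j2, j3]
  rw [j4 (cmul (diffQuotC h (b 0 0)) _), j4 (cmul (diffQuotC h (b 0 1)) _), j4 (diffQuot h g₀)]
  rw [j3'] at i2
  linarith

/-! ## Passing to the limit in differential inequalities -/

/-- The limit E need not be differentiable: the inequality is obtained by integrating e h over [τ,1]
and using dominated convergence. -/
theorem le_add_integral_of_tendsto_deriv {ι : Type*} {l : Filter ι} [l.IsCountablyGenerated]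
    [l.NeBot] {τ M : ℝ} (hτ : τ ≤ 1) {e G : ι → ℝ → ℝ} {E ψ : ℝ → ℝ} {H : ℝ → ℝ}
    (he : ∀ h, ∀ t ∈ Icc τ 1, HasDerivWithinAt (e h) (G h t) (Icc τ 1) t)
    (hM : ∀ h, ∀ t ∈ Icc τ 1, |G h t| ≤ M) (hE : ∀ t ∈ Icc τ 1, Tendsto (fun h => e h t) l (𝓝 (E t)))
    (hG : ∀ t ∈ Icc τ 1, Tendsto (fun h => G h t) l (𝓝 (H t))) (hψ : ContinuousOn ψ (Icc τ 1))
    (hH : ∀ t ∈ Icc τ 1, -ψ t ≤ H t) : E τ ≤ E 1 + ∫ t in τ..1, ψ t := by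
  have hd : ∀ h, ∀ t ∈ Ioo τ 1, HasDerivAt (e h) (G h t) t := fun h t ht =>
    (he h t ⟨ht.1.le, ht.2.le⟩).hasDerivAt (Icc_mem_nhds ht.1 ht.2)
  -- Measurability of G h is not assumed; it follows from that of `deriv (e h)`.
  have hae : ∀ h, ∀ᵐ t ∂volume.restrict (uIoc τ 1), deriv (e h) t = G h t := fun h => by
    rw [uIoc_of_le hτ, ← Measure.restrict_congr_set Ioo_ae_eq_Ioc]
    filter_upwards [ae_restrict_mem measurableSet_Ioo] with t ht
    exact (hd h t ht).deriv
  have : IsFiniteMeasure (volume.restrict (uIoc τ 1)) := by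
    rw [uIoc_of_le hτ]; infer_instance
  have hmeas : ∀ h, AEStronglyMeasurable (G h) (volume.restrict (uIoc τ 1)) := fun h =>
    (measurable_deriv (e h)).aestronglyMeasurable.congr (hae h)
  have hsub : uIoc τ 1 ⊆ Icc τ 1 := by rw [uIoc_of_le hτ]; exact Ioc_subset_Icc_self
  have hbd : ∀ h, ∀ᵐ t, t ∈ uIoc τ 1 → ‖G h t‖ ≤ M := fun h =>
    Eventually.of_forall fun t ht => hM h t (hsub ht)
  have hint : ∀ h, IntervalIntegrable (G h) volume τ 1 := fun h => by
    rw [intervalIntegrable_iff]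
    refine Integrable.of_bound (hmeas h) M ?_
    rw [ae_restrict_iff' measurableSet_uIoc]
    exact hbd h
  have hftc : ∀ h, ∫ t in τ..1, G h t = e h 1 - e h τ := fun h =>
    intervalIntegral.integral_eq_sub_of_hasDerivAt_of_le hτ
      (fun t ht => (he h t ht).continuousWithinAt) (hd h) (hint h)
  have hlim : ∀ᵐ t, t ∈ uIoc τ 1 → Tendsto (fun h => G h t) l (𝓝 (H t)) :=
    Eventually.of_forall fun t ht => hG t (hsub ht)
  have h1 := intervalIntegral.tendsto_integral_filter_of_dominated_convergence (fun _ => M)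
    (Eventually.of_forall hmeas) (Eventually.of_forall hbd) intervalIntegrable_const hlim
  have h2 : Tendsto (fun h => ∫ t in τ..1, G h t) l (𝓝 (E 1 - E τ)) := by
    simp only [hftc]
    exact (hE 1 ⟨hτ, le_rfl⟩).sub (hE τ ⟨le_rfl, hτ⟩)
  have h3 := tendsto_nhds_unique h1 h2
  have hHm : AEStronglyMeasurable H (volume.restrict (uIoc τ 1)) := by
    refine aestronglyMeasurable_of_tendsto_ae l hmeas ?_
    rw [ae_restrict_iff' measurableSet_uIoc]
    exact hlim
  have hHint : IntervalIntegrable H volume τ 1 := by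
    rw [intervalIntegrable_iff]
    refine Integrable.of_bound hHm M ?_
    rw [ae_restrict_iff' measurableSet_uIoc]
    refine Eventually.of_forall fun t ht => ?_
    exact le_of_tendsto (hG t (hsub ht)).norm (Eventually.of_forall fun h => hM h t (hsub ht))
  have hψi : IntervalIntegrable ψ volume τ 1 := hψ.intervalIntegrable_of_Icc hτ
  have h4 := intervalIntegral.integral_mono_on hτ hψi.neg hHint hH
  simp only [Pi.neg_apply, intervalIntegral.integral_neg] at h4
  linarith

/-- This is Grönwall backwards in time with the weight A t^{−κ}, whose integral over (0,1] is
A/(1−κ). The bound is therefore independent of τ. -/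
theorem le_exp_mul_of_le_add_integral {τ A κ : ℝ} (h0 : 0 < τ) (hτ : τ ≤ 1) (hA : 0 ≤ A) (hκ : κ < 1)
    {E : ℝ → ℝ} (hE : ContinuousOn E (Icc τ 1)) (hE0 : 0 ≤ E 1)
    (h : ∀ t ∈ Icc τ 1, E t ≤ E 1 + ∫ s in t..1, A * s ^ (-κ) * E s) :
    E τ ≤ Real.exp (A / (1 - κ)) * E 1 := by
  have hκ' : 0 < 1 - κ := by linarith
  set ψ : ℝ → ℝ := fun s => A * s ^ (-κ) * E s
  have hψ : ContinuousOn ψ (Icc τ 1) := by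
    refine ContinuousOn.mul (continuousOn_const.mul fun s hs => ?_) hE
    exact (Real.continuousAt_rpow_const _ _ (Or.inl (h0.trans_le hs.1).ne')).continuousWithinAt
  set Φ : ℝ → ℝ := fun t => E 1 + ∫ s in t..1, ψ s
  have hΦd : ∀ t ∈ Ioo τ 1, HasDerivAt Φ (-ψ t) t := fun t ht => by
    have hc : ContinuousAt ψ t := hψ.continuousAt (Icc_mem_nhds ht.1 ht.2)
    have hi : IntervalIntegrable ψ volume t 1 :=
      (hψ.mono (Icc_subset_Icc_left ht.1.le)).intervalIntegrable_of_Icc ht.2.le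
    exact (intervalIntegral.integral_hasDerivAt_left hi
      (hψ.mono Ioo_subset_Icc_self |>.stronglyMeasurableAtFilter isOpen_Ioo t ht) hc).const_add _
  have hΦc : ContinuousOn Φ (Icc τ 1) := by
    have hi : IntegrableOn ψ (uIcc τ 1) := by
      rw [uIcc_of_le hτ]; exact hψ.integrableOn_compact isCompact_Icc
    have := intervalIntegral.continuousOn_primitive_interval_left hi
    rw [uIcc_of_le hτ] at this
    exact continuousOn_const.add this
  set P : ℝ → ℝ := fun t => A * (t ^ (1 - κ) / (1 - κ))
  have hPd : ∀ t, 0 < t → HasDerivAt P (A * t ^ (-κ)) t := fun t ht =>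
    (hasDerivAt_rpow_one_sub_div hκ ht).const_mul A
  have hmono : MonotoneOn (fun t => Φ t * Real.exp (P t)) (Icc τ 1) := by
    refine monotoneOn_of_deriv_nonneg (convex_Icc τ 1) ?_ ?_ ?_
    · exact hΦc.mul fun t ht =>
        (hPd t (h0.trans_le ht.1)).continuousAt.rexp.continuousWithinAt
    · rw [interior_Icc]
      exact fun t ht => ((hΦd t ht).mul
        (hPd t (h0.trans ht.1)).exp).differentiableAt.differentiableWithinAt
    · rw [interior_Icc]
      intro t ht
      have hd := (hΦd t ht).mul (hPd t (h0.trans ht.1)).exp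
      rw [HasDerivAt.deriv (f := fun t => Φ t * Real.exp (P t)) hd]
      have h1 := h t ⟨ht.1.le, ht.2.le⟩
      have h2 : 0 ≤ A * t ^ (-κ) := mul_nonneg hA (Real.rpow_nonneg (h0.trans ht.1).le _)
      have h3 : ψ t ≤ A * t ^ (-κ) * Φ t := mul_le_mul_of_nonneg_left h1 h2
      have h4 := mul_nonneg (Real.exp_pos (P t)).le (sub_nonneg.2 h3)
      linarith
  have h1 := hmono ⟨le_rfl, hτ⟩ ⟨hτ, le_rfl⟩ hτ
  have h2 : Φ 1 = E 1 := by simp [Φ]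
  have h3 : P 1 = A / (1 - κ) := by simp only [P, Real.one_rpow]; ring
  simp only [h2, h3] at h1
  have h4 : 1 ≤ Real.exp (P τ) := Real.one_le_exp
    (mul_nonneg hA (div_nonneg (Real.rpow_nonneg h0.le _) hκ'.le))
  have h5 := h τ ⟨le_rfl, hτ⟩
  -- Dropping the factor exp(P τ) ≥ 1 requires Φ τ ≥ 0; otherwise E τ is negative and there is
  -- nothing to prove.
  by_cases h6 : 0 ≤ Φ τ
  · nlinarith [mul_le_mul_of_nonneg_left h4 h6]
  · have := mul_nonneg (Real.exp_pos (A / (1 - κ))).le hE0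
    have h5 : E τ ≤ Φ τ := h5
    linarith

end

noncomputable section

variable {L : ℝ} [Fact (0 < L)]

set_option linter.unusedSectionVars false

/-! ## Bounds for the coefficients at a fixed time -/

/-- Writing s = ρ² gives ⟨s z, r₀⟩ = ⟨ρ z, ρ r₀⟩, so r₀ is needed only in the weighted norm and ‖ρ
z‖ is part of the energy. The term with q is compared with s itself, since s has no upper bound
uniform in t. -/
theorem neg_le_energyRate {q d e s ρ : CircleC L} {z w r₀ r₁ : ScalarL2 L} {A N : ℝ}
    (hρ : s = ρ * ρ) (hA : 0 ≤ A) (hq : ∀ x, -(A * s x) ≤ q x) (hd : ‖d‖ ≤ A) (he : ‖e‖ ≤ A)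
    (hz : ‖z‖ ≤ N) (hw : ‖w‖ ≤ N) (hN : N ≤ 1) (hr₀ : ‖cmul ρ r₀‖ ≤ A * N ^ 2)
    (hr₁ : ‖r₁‖ ≤ A * N ^ 2) :
    -(6 * A * (energyForm s z w + N ^ 2)) ≤ energyRate q d e s z w r₀ r₁ := by
  have hN0 : 0 ≤ N := (norm_nonneg z).trans hz
  have hss : inner ℝ (cmul s z) z = ‖cmul ρ z‖ ^ 2 := by
    rw [hρ, cmul_mul, inner_cmul_left, real_inner_self_eq_norm_sq]
  have hsr : inner ℝ (cmul s z) r₀ = inner ℝ (cmul ρ z) (cmul ρ r₀) := by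
    rw [hρ, cmul_mul, inner_cmul_left]
  have h1 : -(A * inner ℝ (cmul s z) z) ≤ inner ℝ (cmul q z) z := by
    have := inner_cmul_self_mono (c := (-A) • s) (d := q) (fun x => by simpa using hq x) z
    rw [map_smul, smul_apply, inner_smul_left] at this
    simpa using this
  have key : ∀ (c : CircleC L) (f g : ScalarL2 L), ‖c‖ ≤ A → ‖f‖ ≤ N → ‖g‖ ≤ N →
      |inner ℝ (cmul c f) g| ≤ A * N * N := fun c f g hc hf hg =>
    (abs_inner_cmul_le c f g).trans
      (mul_le_mul (mul_le_mul hc hf (norm_nonneg _) hA) hg (norm_nonneg _) (by positivity))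
  have h2 := (abs_le.1 (key d z w hd hz hw)).1
  have h3 := (abs_le.1 (key e w w he hw hw)).1
  have hN2 : N ^ 2 ≤ 1 := pow_le_one₀ hN0 hN
  have h4 : inner ℝ (cmul s z) r₀ ≤ ‖cmul ρ z‖ * (A * N ^ 2) := by
    rw [hsr]
    exact (real_inner_le_norm _ _).trans (mul_le_mul_of_nonneg_left hr₀ (norm_nonneg _))
  have h5 : inner ℝ w r₁ ≤ N * (A * N ^ 2) :=
    (real_inner_le_norm _ _).trans (mul_le_mul hw hr₁ (norm_nonneg _) hN0)
  have h6 : 2 * (‖cmul ρ z‖ * N ^ 2) ≤ ‖cmul ρ z‖ ^ 2 + N ^ 2 := by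
    nlinarith [sq_nonneg (‖cmul ρ z‖ - N ^ 2), sq_nonneg N]
  have h7 : N * N ^ 2 ≤ N ^ 2 := by nlinarith [sq_nonneg N]
  have h8 := mul_le_mul_of_nonneg_left h6 hA
  have h9 := mul_le_mul_of_nonneg_left h7 hA
  have h10 : 0 ≤ A * N ^ 2 := by positivity
  have h11 : 0 ≤ A * ‖cmul ρ z‖ ^ 2 := by positivity
  have h12 : 0 ≤ A * ‖w‖ ^ 2 := by positivity
  rw [energyRate, energyForm]
  rw [hss] at h1 ⊢
  nlinarith

section Coefficients

variable {σ : ℝ} {n : ℕ}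

/-- The symmetriser along a function. -/
def symC (h0 : 0 ≤ σ) (h1 : σ < 1) (y : CircleC L) : CircleC L :=
  compC (symmetrizer σ) (contDiff_symmetrizer h0 h1).continuous y

/-- The square root of the symmetriser along a function. -/
def weightC (h0 : 0 ≤ σ) (h1 : σ < 1) (y : CircleC L) : CircleC L :=
  compC (energyWeight σ) (continuous_energyWeight h0 h1) y

theorem symC_eq (h0 : 0 ≤ σ) (h1 : σ < 1) (y : CircleC L) :
    symC h0 h1 y = weightC h0 h1 y * weightC h0 h1 y := by
  ext x
  exact (Real.mul_self_sqrt (symmetrizer_nonneg h0 h1 (y x))).symm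

theorem symC_mul_coefC (h0 : 0 ≤ σ) (h1 : σ < 1) (y : CircleC L) :
    symC h0 h1 y * coefC h0 h1 0 1 y = coefC h0 h1 1 0 y := by
  ext x
  exact symmetrizer_mul_coeffB_zero_one h1 (y x)

/-- The spatial derivative of `f(a w)`. -/
def compDx {f : ℝ → ℝ} (hf : ContDiff ℝ ∞ f) (a : ℝ) (w w₁ : CircleC L) : CircleC L :=
  a • (compC (deriv f) (continuous_deriv_of_contDiff hf) (a • w) * w₁)

theorem contDiff_coeffB (h0 : 0 ≤ σ) (h1 : σ < 1) (i j : Fin 2) : ContDiff ℝ ∞ (coeffB σ i j) :=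
  (weightedSymbol_coeffB h0 h1 i j).contDiff

theorem contDiff_symmetrizer_mul (h0 : 0 ≤ σ) (h1 : σ < 1) :
    ContDiff ℝ ∞ (symmetrizer σ * coeffB σ 0 0) :=
  contDiff_of_mem_symbolClass h0 h1 symmetrizer_mul_mem

/-- The weight is bounded below, so a weighted commutator bound implies the unweighted one needed in
the second equation. -/
theorem norm_le_mul_norm_cmul_weightC (h0 : 0 < σ) (h1 : σ < 1) (y : CircleC L) (f : ScalarL2 L) :
    ‖f‖ ≤ (√(σ * (1 - σ)))⁻¹ * ‖cmul (weightC h0.le h1 y) f‖ := by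
  have hc : 0 < σ * (1 - σ) := mul_pos h0 (by linarith)
  have h := norm_cmul_le_norm_cmul (c := 1) (d := weightC h0.le h1 y) (M := (√(σ * (1 - σ)))⁻¹)
    (fun x => ?_) f
  · rwa [cmul_one] at h
  · rw [ContinuousMap.one_apply, abs_one, inv_mul_eq_div, le_div_iff₀ (Real.sqrt_pos.2 hc), one_mul]
    exact (Real.sqrt_le_sqrt (const_le_symmetrizer h0.le h1 (y x))).trans (le_abs_self _)

/-- Commutators of top order derivatives with the coefficients. -/
theorem exists_commutator_coefC (L : ℝ) [Fact (0 < L)] (hn : 1 ≤ n) (h0 : 0 < σ) (h1 : σ < 1) :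
    ∃ K, 0 ≤ K ∧ ∀ (a : ℝ) (u : sobolev L (n + 1)), 1 ≤ a → ‖u‖ ≤ 1 → ∀ i j, ∃ F R,
      IterDx n (cmul (coefC h0.le h1 i j (a • sobC (Nat.succ_pos n) 1 u)) (sobComp j 1 u)) F ∧
      InH1 (F - cmul (coefC h0.le h1 i j (a • sobC (Nat.succ_pos n) 1 u)) (sobComp j (n + 1) u)) R ∧
      ‖cmul (weightC h0.le h1 (a • sobC (Nat.succ_pos n) 1 u))
        (cmul (compDx (contDiff_coeffB h0.le h1 i j) a (sobC (Nat.succ_pos n) 1 u)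
          (sobC (Nat.succ_lt_succ hn) 1 u)) (sobComp j (n + 1) u) + R)‖ ≤
        K * a ^ (n + 1) * ‖u‖ ^ 2 := by
  choose K hK hK' using fun i j => (weightedSymbol_deriv_coeffB h0.le h1 i j).exists_iterDx_commutator
    (L := L) (continuous_energyWeight h0.le h1) hn n le_rfl (contDiff_coeffB h0.le h1 i j)
  refine ⟨∑ i, ∑ j, K i j, Finset.sum_nonneg fun i _ => Finset.sum_nonneg fun j _ => hK i j,
    fun a u ha hu i j => ?_⟩
  have hw₁ : InH1 (toL2 (sobC (Nat.succ_pos n) 1 u)) (toL2 (sobC (Nat.succ_lt_succ hn) 1 u)) := by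
    rw [toL2_sobC, toL2_sobC]
    exact inH1_sobComp (Nat.succ_pos n) 1 u
  have hN : SobLe n (toL2 (sobC (Nat.succ_lt_succ hn) 1 u)) ‖u‖ := by
    rw [toL2_sobC]
    exact sobLe_sobComp (by omega) 1 u
  obtain ⟨F, V, R, hF, hV, hR, hb⟩ := hK' i j a _ _ ‖u‖ (sobComp j 1 u) ‖u‖ ha hw₁ hN hu
    (sobLe_sobComp (by omega) j u)
  obtain rfl := hV.unique (iterDx_sobComp_one le_rfl j u)
  refine ⟨F, R, hF, hR, ?_⟩
  rw [compDx, map_smul, smul_apply, cmul_mul, add_comm _ R]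
  refine hb.trans ?_
  rw [mul_assoc, ← sq]
  have h2 : K i j ≤ ∑ i, ∑ j, K i j :=
    (Finset.single_le_sum (f := fun j => K i j) (fun j _ => hK i j) (Finset.mem_univ j)).trans
      (Finset.single_le_sum (f := fun i => ∑ j, K i j)
        (fun i _ => Finset.sum_nonneg fun j _ => hK i j) (Finset.mem_univ i))
  have h3 : 0 ≤ a := by linarith
  gcongr

theorem exists_norm_coefC_le (h0 : 0 ≤ σ) (h1 : σ < 1) :
    ∃ C, 0 ≤ C ∧ ∀ i j y, |coeffB σ i j y| ≤ C ∧ |deriv (coeffB σ i j) y| ≤ C := by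
  choose C hC using fun i j => (weightedSymbol_coeffB h0 h1 i j).bound 0
  choose D hD using fun i j => (weightedSymbol_coeffB h0 h1 i j).bound 1
  have hC0 : ∀ i j, 0 ≤ C i j := fun i j => (abs_nonneg _).trans (hC i j 0)
  have hD0 : ∀ i j, 0 ≤ D i j := fun i j => (abs_nonneg _).trans (hD i j 0)
  have hle : ∀ K : Fin 2 → Fin 2 → ℝ, (∀ i j, 0 ≤ K i j) → ∀ i j, K i j ≤ ∑ i, ∑ j, K i j :=
    fun K hK i j => (Finset.single_le_sum (f := fun j => K i j) (fun j _ => hK i j)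
      (Finset.mem_univ j)).trans (Finset.single_le_sum (f := fun i => ∑ j, K i j)
        (fun i _ => Finset.sum_nonneg fun j _ => hK i j) (Finset.mem_univ i))
  have hsum : ∀ K : Fin 2 → Fin 2 → ℝ, (∀ i j, 0 ≤ K i j) → 0 ≤ ∑ i, ∑ j, K i j :=
    fun K hK => Finset.sum_nonneg fun i _ => Finset.sum_nonneg fun j _ => hK i j
  refine ⟨(∑ i, ∑ j, C i j) + ∑ i, ∑ j, D i j, add_nonneg (hsum C hC0) (hsum D hD0),
    fun i j y => ⟨?_, ?_⟩⟩
  · have h2 := hC i j y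
    rw [one_mul, iteratedDeriv_zero] at h2
    linarith [hle C hC0 i j, hsum D hD0]
  · have h2 := hD i j y
    rw [one_mul, iteratedDeriv_one] at h2
    linarith [hle D hD0 i j, hsum C hC0]

/-- The velocity of `a w` at the equation, without its singular part. -/
def velocityC (h0 : 0 ≤ σ) (h1 : σ < 1) (hn : 1 ≤ n) (a : ℝ) (u : sobolev L (n + 1)) : CircleC L :=
  -(coefC h0 h1 1 0 (a • sobC (Nat.succ_pos n) 1 u) * sobC (Nat.succ_lt_succ hn) 0 u +
    coefC h0 h1 1 1 (a • sobC (Nat.succ_pos n) 1 u) * sobC (Nat.succ_lt_succ hn) 1 u)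

/-- The derivative of the symmetriser along the flow of the equation. -/
def symRate (h0 : 0 ≤ σ) (h1 : σ < 1) (hn : 1 ≤ n) (κ a : ℝ) (u : sobolev L (n + 1)) : CircleC L :=
  compC (deriv (symmetrizer σ)) (continuous_deriv_of_contDiff (contDiff_symmetrizer h0 h1))
    (a • sobC (Nat.succ_pos n) 1 u) *
    ((-κ) • (a • sobC (Nat.succ_pos n) 1 u) + a • velocityC h0 h1 hn a u)

/-- The coefficient of the leading term in the energy identity. -/
def leadC (h0 : 0 ≤ σ) (h1 : σ < 1) (hn : 1 ≤ n) (κ a : ℝ) (u : sobolev L (n + 1)) : CircleC L :=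
  symRate h0 h1 hn κ a u + (2 * κ) • symC h0 h1 (a • sobC (Nat.succ_pos n) 1 u) +
    compDx (contDiff_symmetrizer_mul h0 h1) a (sobC (Nat.succ_pos n) 1 u)
      (sobC (Nat.succ_lt_succ hn) 1 u)

theorem norm_compDx_le {f : ℝ → ℝ} (hf : ContDiff ℝ ∞ f) {C : ℝ} (hC : 0 ≤ C)
    (h : ∀ y, |deriv f y| ≤ C) {a : ℝ} (ha : 0 ≤ a) (w w₁ : CircleC L) :
    ‖compDx hf a w w₁‖ ≤ a * (C * ‖w₁‖) := by
  rw [compDx, norm_smul, Real.norm_of_nonneg ha]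
  refine mul_le_mul_of_nonneg_left ((norm_mul_le _ _).trans ?_) ha
  exact mul_le_mul_of_nonneg_right ((ContinuousMap.norm_le _ hC).2 fun x => h _) (norm_nonneg _)

/-- The constant does not depend on κ = p/t. The singular contributions −κ y s' and 2κ s add up to
something nonnegative, and the remaining terms carry one factor a ≤ a^{n+1} and are bounded by s. -/
theorem exists_neg_le_energyRate (L : ℝ) [Fact (0 < L)] (hn : 1 ≤ n) (h0 : 0 < σ) (h1 : σ < 1)
    (K : ℝ) (hK : 0 ≤ K) :
    ∃ C, 0 ≤ C ∧ ∀ (κ a : ℝ) (u : sobolev L (n + 1)) (r₀ r₁ : ScalarL2 L), 0 ≤ κ → 1 ≤ a → ‖u‖ ≤ 1 →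
      ‖cmul (weightC h0.le h1 (a • sobC (Nat.succ_pos n) 1 u)) r₀‖ ≤ K * a ^ (n + 1) * ‖u‖ ^ 2 →
      ‖r₁‖ ≤ K * a ^ (n + 1) * ‖u‖ ^ 2 →
      -(C * a ^ (n + 1) * (energyForm (symC h0.le h1 (a • sobC (Nat.succ_pos n) 1 u))
        (sobComp 0 (n + 1) u) (sobComp 1 (n + 1) u) + ‖u‖ ^ 2)) ≤
      energyRate (leadC h0.le h1 hn κ a u)
        (compDx (contDiff_coeffB h0.le h1 1 0) a (sobC (Nat.succ_pos n) 1 u)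
          (sobC (Nat.succ_lt_succ hn) 1 u))
        (compDx (contDiff_coeffB h0.le h1 1 1) a (sobC (Nat.succ_pos n) 1 u)
          (sobC (Nat.succ_lt_succ hn) 1 u))
        (symC h0.le h1 (a • sobC (Nat.succ_pos n) 1 u))
        (sobComp 0 (n + 1) u) (sobComp 1 (n + 1) u) r₀ r₁ := by
  obtain ⟨B, hB, hB'⟩ := exists_norm_coefC_le h0.le h1
  obtain ⟨C₁, hC₁, hC₁'⟩ := exists_abs_deriv_le_symmetrizer h0 h1 symmetrizer_mem
  obtain ⟨C₂, hC₂, hC₂'⟩ := exists_abs_deriv_le_symmetrizer h0 h1 symmetrizer_mul_mem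
  have hS := supConst_nonneg L
  set S := 2 * supConst L
  have hS' : 0 ≤ S := by positivity
  refine ⟨6 * (K + B * S + C₁ * (2 * (B * S)) + C₂ * S), by positivity,
    fun κ a u r₀ r₁ hκ ha hu hr₀ hr₁ => ?_⟩
  have ha0 : 0 ≤ a := by linarith
  have hak : a ≤ a ^ (n + 1) := le_self_pow₀ ha (Nat.succ_ne_zero n)
  have hsup : ∀ i, ‖sobC (Nat.succ_lt_succ hn) i u‖ ≤ S := fun i => by
    refine (norm_sobC_le _ i u).trans ?_
    nlinarith
  set A := (K + B * S + C₁ * (2 * (B * S)) + C₂ * S) * a ^ (n + 1)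
  have hA : 0 ≤ A := by positivity
  have hAB : a * (B * S) ≤ A := by
    have : a * (B * S) ≤ a ^ (n + 1) * (B * S) := mul_le_mul_of_nonneg_right hak (by positivity)
    have h2 : 0 ≤ (K + C₁ * (2 * (B * S)) + C₂ * S) * a ^ (n + 1) := by positivity
    simp only [A]
    linarith
  have hAK : K * a ^ (n + 1) * ‖u‖ ^ 2 ≤ A * ‖u‖ ^ 2 := by
    refine mul_le_mul_of_nonneg_right ?_ (sq_nonneg _)
    have h2 : 0 ≤ (B * S + C₁ * (2 * (B * S)) + C₂ * S) * a ^ (n + 1) := by positivity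
    simp only [A]
    linarith
  have hb : ∀ i j, ‖compDx (contDiff_coeffB h0.le h1 i j) a (sobC (Nat.succ_pos n) 1 u)
      (sobC (Nat.succ_lt_succ hn) 1 u)‖ ≤ A := fun i j => by
    refine (norm_compDx_le _ hB (fun y => (hB' i j y).2) ha0 _ _).trans (le_trans ?_ hAB)
    exact mul_le_mul_of_nonneg_left (mul_le_mul_of_nonneg_left (hsup 1) hB) ha0
  have h := neg_le_energyRate (symC_eq h0.le h1 (a • sobC (Nat.succ_pos n) 1 u)) hA
    (q := leadC h0.le h1 hn κ a u) (fun x => ?_) (hb 1 0) (hb 1 1) (norm_sobComp_le 0 (n + 1) u)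
    (norm_sobComp_le 1 (n + 1) u) hu (hr₀.trans hAK) (hr₁.trans hAK)
  · refine le_trans (le_of_eq ?_) h
    simp only [A]
    ring
  · set y := (a • sobC (Nat.succ_pos n) 1 u) x
    set v := velocityC h0.le h1 hn a u x
    set g := sobC (Nat.succ_lt_succ hn) 1 u x
    have hlead : leadC h0.le h1 hn κ a u x = deriv (symmetrizer σ) y * (-κ * y + a * v) +
        2 * κ * symmetrizer σ y + a * (deriv (symmetrizer σ * coeffB σ 0 0) y * g) := rfl
    have hsym : symC h0.le h1 (a • sobC (Nat.succ_pos n) 1 u) x = symmetrizer σ y := rfl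
    rw [hlead, hsym]
    -- Multiplied by κ ≥ 0, this disposes of both singular terms at once.
    have e1 := mul_deriv_symmetrizer_le h0.le h1 y
    have e2 := hC₁' y
    have e3 := hC₂' y
    have e4 := symmetrizer_nonneg h0.le h1 y
    have hz : |sobC (Nat.succ_lt_succ hn) 0 u x| ≤ S :=
      ((sobC (Nat.succ_lt_succ hn) 0 u).norm_coe_le_norm x).trans (hsup 0)
    have hg : |g| ≤ S := ((sobC (Nat.succ_lt_succ hn) 1 u).norm_coe_le_norm x).trans (hsup 1)
    have hv : |v| ≤ 2 * (B * S) := by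
      have : v = -(coeffB σ 1 0 y * sobC (Nat.succ_lt_succ hn) 0 u x + coeffB σ 1 1 y * g) := rfl
      rw [this, abs_neg]
      refine (abs_add_le _ _).trans ?_
      rw [abs_mul, abs_mul]
      have f1 := mul_le_mul (hB' 1 0 y).1 hz (abs_nonneg _) hB
      have f2 := mul_le_mul (hB' 1 1 y).1 hg (abs_nonneg _) hB
      linarith
    set s := symmetrizer σ y
    set s' := deriv (symmetrizer σ) y
    set r' := deriv (symmetrizer σ * coeffB σ 0 0) y
    have f1 : -(C₁ * s * (2 * (B * S))) ≤ s' * v := by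
      have := mul_le_mul e2 hv (abs_nonneg _) (by positivity)
      rw [← abs_mul] at this
      exact (abs_le.1 this).1
    have f2 : -(C₂ * s * S) ≤ r' * g := by
      have := mul_le_mul e3 hg (abs_nonneg _) (by positivity)
      rw [← abs_mul] at this
      exact (abs_le.1 this).1
    have f3 := mul_le_mul_of_nonneg_left f1 ha0
    have f4 := mul_le_mul_of_nonneg_left f2 ha0
    have f5 := mul_le_mul_of_nonneg_left e1 hκ
    have f6 : a * (C₁ * (2 * (B * S)) + C₂ * S) * s ≤ A * s := by
      refine mul_le_mul_of_nonneg_right ?_ e4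
      have h2 : a * (C₁ * (2 * (B * S)) + C₂ * S) ≤ a ^ (n + 1) * (C₁ * (2 * (B * S)) + C₂ * S) :=
        mul_le_mul_of_nonneg_right hak (by positivity)
      have h3 : 0 ≤ (K + B * S) * a ^ (n + 1) := by positivity
      simp only [A]
      linarith
    nlinarith

/-! ## The energy -/

/-- The energy of a function in `H^{n+1}`. -/
def sobEnergy (h0 : 0 ≤ σ) (h1 : σ < 1) (a : ℝ) (u : sobolev L (n + 1)) : ℝ :=
  energyForm (symC h0 h1 (a • sobC (Nat.succ_pos n) 1 u)) (sobComp 0 (n + 1) u) (sobComp 1 (n + 1) u) +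
    ∑ ℓ ∈ Finset.range (n + 1), (‖sobComp 0 ℓ u‖ ^ 2 + ‖sobComp 1 ℓ u‖ ^ 2)

theorem le_sobEnergy (h0 : 0 < σ) (h1 : σ < 1) (a : ℝ) (u : sobolev L (n + 1)) :
    σ * (1 - σ) * ‖u‖ ^ 2 ≤ sobEnergy h0.le h1 a u := by
  have hc : 0 < σ * (1 - σ) := mul_pos h0 (by linarith)
  have hc1 : σ * (1 - σ) ≤ 1 := by nlinarith
  have h := inner_cmul_self_mono (c := (σ * (1 - σ)) • (1 : CircleC L))
    (d := symC h0.le h1 (a • sobC (Nat.succ_pos n) 1 u))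
    (fun _ => (mul_one _).trans_le (const_le_symmetrizer h0.le h1 _)) (sobComp 0 (n + 1) u)
  rw [map_smul, smul_apply, cmul_one, inner_smul_left, real_inner_self_eq_norm_sq] at h
  simp only [RCLike.conj_to_real] at h
  rw [norm_sq_eq_sobComp, Finset.sum_range_succ, sobEnergy, energyForm]
  have h2 : 0 ≤ ∑ ℓ ∈ Finset.range (n + 1), (‖sobComp 0 ℓ u‖ ^ 2 + ‖sobComp 1 ℓ u‖ ^ 2) :=
    Finset.sum_nonneg fun ℓ _ => by positivity
  nlinarith [sq_nonneg ‖sobComp 1 (n + 1) u‖, mul_le_mul_of_nonneg_right hc1 h2]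

theorem sobEnergy_nonneg (h0 : 0 < σ) (h1 : σ < 1) (a : ℝ) (u : sobolev L (n + 1)) :
    0 ≤ sobEnergy h0.le h1 a u :=
  (mul_nonneg (mul_nonneg h0.le (by linarith)) (sq_nonneg _)).trans (le_sobEnergy h0 h1 a u)

/-- At t = 1 one has a = 1, so the argument of s stays in a fixed compact interval and s is bounded
there. An upper bound by the norm is needed only at this initial time. -/
theorem exists_sobEnergy_one_le (L : ℝ) [Fact (0 < L)] (n : ℕ) (h0 : 0 ≤ σ) (h1 : σ < 1) :
    ∃ C, 0 ≤ C ∧ ∀ u : sobolev L (n + 1), ‖u‖ ≤ 1 → sobEnergy h0 h1 1 u ≤ C * ‖u‖ ^ 2 := by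
  have hS := supConst_nonneg L
  obtain ⟨M, hM⟩ := (isCompact_Icc (a := -(2 * supConst L)) (b := 2 * supConst L)).exists_bound_of_continuousOn
    (contDiff_symmetrizer h0 h1).continuous.continuousOn
  have hM0 : 0 ≤ M := (norm_nonneg _).trans (hM 0 ⟨by linarith, by linarith⟩)
  refine ⟨M + 1, by positivity, fun u hu => ?_⟩
  have hle : ∀ x, |symC h0 h1 ((1 : ℝ) • sobC (Nat.succ_pos n) 1 u) x| ≤ M := fun x => by
    refine hM _ (abs_le.1 ?_)
    rw [one_smul]
    refine ((sobC (Nat.succ_pos n) 1 u).norm_coe_le_norm x).trans ((norm_sobC_le _ 1 u).trans ?_)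
    nlinarith
  have h2 : inner ℝ (cmul (symC h0 h1 ((1 : ℝ) • sobC (Nat.succ_pos n) 1 u)) (sobComp 0 (n + 1) u))
      (sobComp 0 (n + 1) u) ≤ M * ‖u‖ ^ 2 := by
    refine (real_inner_le_norm _ _).trans ?_
    have h3 := norm_cmul_le_of_le hle (sobComp 0 (n + 1) u)
    have h4 := norm_sobComp_le 0 (n + 1) u
    calc _ ≤ M * ‖u‖ * ‖u‖ := mul_le_mul (h3.trans (mul_le_mul_of_nonneg_left h4 hM0)) h4
          (norm_nonneg _) (by positivity)
      _ = _ := by ring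
  have h5 := norm_sq_eq_sobComp u
  rw [Finset.sum_range_succ] at h5
  rw [sobEnergy, energyForm]
  nlinarith [sq_nonneg ‖sobComp 0 (n + 1) u‖]

end Coefficients

end

/-! ### Quadratic errors, and regularity of the coefficients along a solution. -/

noncomputable section

variable {L : ℝ} [Fact (0 < L)]

set_option linter.unusedSectionVars false

section Nonlinear

variable {σ : ℝ} {n : ℕ}

theorem coeffB_apply_zero (h0 : 0 ≤ σ) (h1 : σ < 1) (i j : Fin 2) :
    coeffB σ i j 0 = (!![0, -1; -σ, 0] : Matrix (Fin 2) (Fin 2) ℝ) i j := by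
  have := fuchsianB_zero h0 h1 0
  rw [← this, coeffB, fuchsianB, mul_zero]

/-- Derivatives of the products with the coefficients, up to quadratic errors. -/
theorem exists_iterDx_coefC (L : ℝ) [Fact (0 < L)] (hn : 1 ≤ n) (h0 : 0 ≤ σ) (h1 : σ < 1) :
    ∃ K, 0 ≤ K ∧ ∀ (a : ℝ) (u : sobolev L (n + 1)), 1 ≤ a → ‖u‖ ≤ 1 → ∀ ℓ ≤ n, ∀ i j, ∃ F,
      IterDx ℓ (cmul (coefC h0 h1 i j (a • sobC (Nat.succ_pos n) 1 u)) (sobComp j 1 u)) F ∧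
      ‖F - coeffB σ i j 0 • sobComp j (ℓ + 1) u‖ ≤ K * a ^ (ℓ + 1) * ‖u‖ ^ 2 := by
  choose K hK hK' using fun i j => fun ℓ =>
    (weightedSymbol_coeffB h0 h1 i j).exists_iterDx_sub (L := L) ℓ
  have hs : ∀ i j, 0 ≤ ∑ ℓ ∈ Finset.range (n + 1), K i j ℓ := fun i j =>
    Finset.sum_nonneg fun ℓ _ => hK i j ℓ
  refine ⟨∑ i, ∑ j, ∑ ℓ ∈ Finset.range (n + 1), K i j ℓ, Finset.sum_nonneg fun i _ =>
    Finset.sum_nonneg fun j _ => hs i j, fun a u ha hu ℓ hℓ i j => ?_⟩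
  have hw₁ : InH1 (toL2 (sobC (Nat.succ_pos n) 1 u)) (toL2 (sobC (Nat.succ_lt_succ hn) 1 u)) := by
    rw [toL2_sobC, toL2_sobC]
    exact inH1_sobComp (Nat.succ_pos n) 1 u
  have hN : SobLe (ℓ + 1) (toL2 (sobC (Nat.succ_pos n) 1 u)) ‖u‖ := by
    rw [toL2_sobC]
    exact sobLe_sobComp (by omega) 1 u
  obtain ⟨F, hF, hb⟩ := hK' i j ℓ a _ _ ‖u‖ (sobComp j 1 u) ‖u‖ ha hw₁ hN hu
    (sobLe_sobComp (by omega) j u)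
  refine ⟨F + coeffB σ i j 0 • sobComp j (ℓ + 1) u, ?_, ?_⟩
  · have := hF.add ((iterDx_sobComp_one (ℓ := ℓ) (by omega) j u).smul (coeffB σ i j 0))
    rwa [sub_add_cancel] at this
  · rw [add_sub_cancel_right]
    refine hb.trans ?_
    rw [mul_assoc, ← sq]
    have h2 : K i j ℓ ≤ ∑ i, ∑ j, ∑ ℓ ∈ Finset.range (n + 1), K i j ℓ :=
      (Finset.single_le_sum (f := fun ℓ => K i j ℓ) (fun ℓ _ => hK i j ℓ)
        (Finset.mem_range.2 (Nat.lt_succ_of_le hℓ))).trans <|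
      (Finset.single_le_sum (f := fun j => ∑ ℓ ∈ Finset.range (n + 1), K i j ℓ)
        (fun j _ => hs i j) (Finset.mem_univ j)).trans
      (Finset.single_le_sum (f := fun i => ∑ j, ∑ ℓ ∈ Finset.range (n + 1), K i j ℓ)
        (fun i _ => Finset.sum_nonneg fun j _ => hs i j) (Finset.mem_univ i))
    have h3 : 0 ≤ a := by linarith
    gcongr

theorem one_le_rpow_of_mem {t : ℝ} (h0 : 1 / 3 < σ) (ht : t ∈ Ioc (0 : ℝ) 1) :
    1 ≤ t ^ (1 - 3 * σ) :=
  Real.one_le_rpow_of_pos_of_le_one_of_nonpos ht.1 ht.2 (by linarith)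

/-- The derivatives of a solution solve the linearised equation with quadratic errors. -/
theorem exists_sobComp_eq_linear (L : ℝ) [Fact (0 < L)] (hn : 1 ≤ n) (h0 : 1 / 3 < σ) (h1 : σ < 1) :
    ∃ K, 0 ≤ K ∧ ∀ t ∈ Ioc (0 : ℝ) 1, ∀ (u' : sobolev L (n + 1 - 1)) (u : sobolev L (n + 1)),
      ‖u‖ ≤ 1 → (∀ᵐ x : AddCircle L, sobolevFun u' x +
        (fuchsianB σ t (sobolevFun u x 1)).toEuclideanLin (sobolevDx (Nat.le_add_left 1 n) u x) =
        ((3 * σ - 1) / t) • piPerp.toEuclideanLin (sobolevFun u x)) → ∀ ℓ ≤ n,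
      ‖((3 * σ - 1) / t) • sobComp 0 ℓ u + sobComp 1 (ℓ + 1) u - sobComp 0 ℓ u'‖ ≤
        K * (t ^ (1 - 3 * σ)) ^ (ℓ + 1) * ‖u‖ ^ 2 ∧
      ‖σ • sobComp 0 (ℓ + 1) u - sobComp 1 ℓ u'‖ ≤ K * (t ^ (1 - 3 * σ)) ^ (ℓ + 1) * ‖u‖ ^ 2 := by
  have h0' : 0 ≤ σ := by linarith
  obtain ⟨K, hK, hK'⟩ := exists_iterDx_coefC L hn h0' h1
  refine ⟨2 * K, by positivity, fun t ht u' u hu he ℓ hℓ => ?_⟩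
  choose F hF hb using hK' (t ^ (1 - 3 * σ)) u (one_le_rpow_of_mem h0 ht) hu ℓ hℓ
  obtain ⟨e0, e1⟩ := sobComp_of_nonlinear_equation (Nat.le_add_left 1 n) h0' h1 he hℓ hF
  have c00 : coeffB σ 0 0 0 = 0 := coeffB_apply_zero h0' h1 0 0
  have c01 : coeffB σ 0 1 0 = -1 := coeffB_apply_zero h0' h1 0 1
  have c10 : coeffB σ 1 0 0 = -σ := coeffB_apply_zero h0' h1 1 0
  have c11 : coeffB σ 1 1 0 = 0 := coeffB_apply_zero h0' h1 1 1
  have b00 := hb 0 0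
  have b01 := hb 0 1
  have b10 := hb 1 0
  have b11 := hb 1 1
  rw [c00] at b00
  rw [c01] at b01
  rw [c10] at b10
  rw [c11] at b11
  constructor
  · have : ((3 * σ - 1) / t) • sobComp 0 ℓ u + sobComp 1 (ℓ + 1) u - sobComp 0 ℓ u' =
        (F 0 0 - (0 : ℝ) • sobComp 0 (ℓ + 1) u) + (F 0 1 - (-1 : ℝ) • sobComp 1 (ℓ + 1) u) := by
      rw [e0]; module
    rw [this]
    refine (norm_add_le _ _).trans ?_
    linarith
  · have : σ • sobComp 0 (ℓ + 1) u - sobComp 1 ℓ u' =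
        (F 1 0 - (-σ) • sobComp 0 (ℓ + 1) u) + (F 1 1 - (0 : ℝ) • sobComp 1 (ℓ + 1) u) := by
      rw [e1]; module
    rw [this]
    refine (norm_add_le _ _).trans ?_
    linarith

/-! ## Coefficients along a curve -/

theorem continuousOn_compDx {f : ℝ → ℝ} (hf : ContDiff ℝ ∞ f) {a : ℝ → ℝ} {w w₁ : ℝ → CircleC L}
    {S : Set ℝ} (ha : ContinuousOn a S) (hw : ContinuousOn w S) (hw₁ : ContinuousOn w₁ S) :
    ContinuousOn (fun t => compDx hf (a t) (w t) (w₁ t)) S :=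
  ha.smul (((continuous_compC _ _).comp_continuousOn (ha.smul hw)).mul hw₁)

theorem continuousOn_leadC (h0 : 0 ≤ σ) (h1 : σ < 1) (hn : 1 ≤ n) {κ a : ℝ → ℝ}
    {u : ℝ → sobolev L (n + 1)} {S : Set ℝ} (hκ : ContinuousOn κ S) (ha : ContinuousOn a S)
    (hu : ContinuousOn u S) : ContinuousOn (fun t => leadC h0 h1 hn (κ t) (a t) (u t)) S := by
  have hs : ∀ {ℓ : ℕ} (h : ℓ < n + 1) (i : Fin 2), ContinuousOn (fun t => sobC h i (u t)) S :=
    fun h i => (sobC h i).continuous.comp_continuousOn hu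
  have hy := ha.smul (hs (Nat.succ_pos n) 1)
  have hc : ∀ {f : ℝ → ℝ} (hf : Continuous f), ContinuousOn
      (fun t => compC f hf (a t • sobC (Nat.succ_pos n) 1 (u t))) S :=
    fun hf => (continuous_compC _ _).comp_continuousOn hy
  refine ((ContinuousOn.mul (hc _) ((hκ.neg.smul hy).add (ha.smul ?_))).add
    ((hκ.const_mul 2).smul (hc _))).add (continuousOn_compDx _ ha (hs _ 1) (hs _ 1))
  exact (((hc _).mul (hs _ 0)).add ((hc _).mul (hs _ 1))).neg

theorem continuousOn_sobEnergy (h0 : 0 ≤ σ) (h1 : σ < 1) {a : ℝ → ℝ}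
    {u : ℝ → sobolev L (n + 1)} {S : Set ℝ} (ha : ContinuousOn a S)
    (hu : ContinuousOn u S) : ContinuousOn (fun t => sobEnergy h0 h1 (a t) (u t)) S := by
  have hy : ContinuousOn (fun t => a t • sobC (Nat.succ_pos n) 1 (u t)) S :=
    ha.smul ((sobC (Nat.succ_pos n) 1).continuous.comp_continuousOn hu)
  have hs : ContinuousOn (fun t => symC h0 h1 (a t • sobC (Nat.succ_pos n) 1 (u t))) S :=
    (continuous_compC _ _).comp_continuousOn hy
  have hz : ∀ i ℓ, ContinuousOn (fun t => sobComp i ℓ (u t)) S := fun i ℓ =>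
    (sobComp i ℓ).continuous.comp_continuousOn hu
  refine ContinuousOn.add (ContinuousOn.add ?_ ((hz _ _).norm.pow 2))
    (continuousOn_finsetSum _ fun ℓ _ => ((hz _ _).norm.pow 2).add ((hz _ _).norm.pow 2))
  exact ((cmul.continuous.comp_continuousOn hs).clm_apply (hz _ _)).inner (hz _ _)

/-- Since n ≥ 1, the derivative W' lies in H^n ⊆ C⁰, so w is differentiable in time in the sup norm.
The factor a' = −(p/t) a gives the singular part −κ y of the velocity of y = a w. -/
theorem hasDerivWithinAt_symC (h0 : 0 ≤ σ) (h1 : σ < 1) (hn : 1 ≤ n) {W : ℝ → sobolev L (n + 1)}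
    {W' : sobolev L (n + 1 - 1)} {S : Set ℝ} {t : ℝ} (ht : 0 < t)
    (hd : HasDerivWithinAt (fun s => sobolevIncl (Nat.sub_le (n + 1) 1) (W s)) W' S t)
    (he : ∀ᵐ x : AddCircle L, sobolevFun W' x +
        (fuchsianB σ t (sobolevFun (W t) x 1)).toEuclideanLin
          (sobolevDx (Nat.le_add_left 1 n) (W t) x) =
        ((3 * σ - 1) / t) • piPerp.toEuclideanLin (sobolevFun (W t) x)) :
    HasDerivWithinAt (fun r => symC h0 h1 (r ^ (1 - 3 * σ) • sobC (Nat.succ_pos n) 1 (W r)))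
      (symRate h0 h1 hn ((3 * σ - 1) / t) (t ^ (1 - 3 * σ)) (W t)) S t := by
  have hw : HasDerivWithinAt (fun r => sobC (Nat.succ_pos n) 1 (W r))
      (velocityC h0 h1 hn (t ^ (1 - 3 * σ)) (W t)) S t := by
    have h2 := (sobC (by omega : 0 < n + 1 - 1) 1).hasFDerivAt.comp_hasDerivWithinAt t hd
    rw [sobC_of_nonlinear_equation (Nat.succ_lt_succ hn) h0 h1 he] at h2
    refine h2.congr_of_eventuallyEq (Eventually.of_forall fun s => ?_) ?_
    · exact (sobC_incl _ _ 1 (W s)).symm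
    · exact (sobC_incl _ _ 1 (W t)).symm
  have ha : HasDerivWithinAt (fun r : ℝ => r ^ (1 - 3 * σ))
      (-((3 * σ - 1) / t) * t ^ (1 - 3 * σ)) S t := by
    refine (Real.hasDerivAt_rpow_const (Or.inl ht.ne')).hasDerivWithinAt.congr_deriv ?_
    rw [Real.rpow_sub_one ht.ne']
    ring
  have hy := ha.smul hw
  have h3 := hy.compC (contDiff_symmetrizer h0 h1).continuous
    (continuous_deriv_of_contDiff (contDiff_symmetrizer h0 h1))
    (hasDerivAt_of_contDiff (contDiff_symmetrizer h0 h1))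
  refine h3.congr_deriv ?_
  rw [symRate, smul_smul]
  exact congrArg (_ * ·) (add_comm _ _)

end Nonlinear

end

/-! ### The energy inequality for solutions of the nonlinear equation. -/

noncomputable section

variable {L : ℝ} [Fact (0 < L)]

set_option linter.unusedSectionVars false

theorem norm_cmul_diffQuotC_le {b d : CircleC L} (hb : InH1 (toL2 b) (toL2 d)) (v : ScalarL2 L)
    (h : ℝ) : ‖cmul (diffQuotC h b) (shiftLp h v)‖ ≤ ‖d‖ * ‖v‖ := by
  refine (norm_cmul_le _ _).trans ?_
  rw [(shiftLp h).norm_map]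
  exact mul_le_mul_of_nonneg_right (hb.norm_diffQuotC_le h) (norm_nonneg v)

theorem tendsto_cmul_diffQuotC {b d : CircleC L} (hb : InH1 (toL2 b) (toL2 d)) (v : ScalarL2 L) :
    Tendsto (fun h => cmul (diffQuotC h b) (shiftLp h v)) (𝓝[≠] 0) (𝓝 (cmul d v)) := by
  have h1 : Tendsto (fun h => shiftLp h v) (𝓝[≠] 0) (𝓝 v) := by
    have := ((continuous_shiftLp v).tendsto 0).mono_left (nhdsWithin_le_nhds (s := {0}ᶜ))
    rwa [shiftLp_zero] at this
  exact tendsto_cmul hb.tendsto_diffQuotC h1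

/-- This serves the derivatives below top order, where no symmetrisation is needed: the linear terms
are bounded by the H^{n+1} norm, and the singular term κ‖z‖² ≥ 0 is dropped. -/
theorem neg_le_inner_add_inner {σ κ A N : ℝ} (hσ : 0 ≤ σ) (hσ1 : σ ≤ 1) (hκ : 0 ≤ κ)
    {z w zx wx z' w' : ScalarL2 L} (hz : ‖z‖ ≤ N) (hw : ‖w‖ ≤ N) (hzx : ‖zx‖ ≤ N) (hwx : ‖wx‖ ≤ N)
    (hz' : ‖κ • z + wx - z'‖ ≤ A * N) (hw' : ‖σ • zx - w'‖ ≤ A * N) :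
    -((4 + 4 * A) * N ^ 2) ≤ 2 * inner ℝ z z' + 2 * inner ℝ w w' := by
  have hN : 0 ≤ N := (norm_nonneg z).trans hz
  have e1 : inner ℝ z z' = κ * ‖z‖ ^ 2 + inner ℝ z wx - inner ℝ z (κ • z + wx - z') := by
    simp only [inner_sub_right, inner_add_right, inner_smul_right, real_inner_self_eq_norm_sq]
    ring
  have e2 : inner ℝ w w' = σ * inner ℝ w zx - inner ℝ w (σ • zx - w') := by
    simp only [inner_sub_right, inner_smul_right]
    ring
  have key : ∀ (f g : ScalarL2 L) (B : ℝ), ‖f‖ ≤ N → ‖g‖ ≤ B → |inner ℝ f g| ≤ N * B :=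
    fun f g B hf hg => (abs_real_inner_le_norm f g).trans (mul_le_mul hf hg (norm_nonneg g) hN)
  have h1 := (abs_le.1 (key z wx N hz hwx)).1
  have h2 := (abs_le.1 (key z _ _ hz hz')).2
  have h3 := (abs_le.1 (key w zx N hw hzx))
  have h4 := (abs_le.1 (key w _ _ hw hw')).2
  have h5 : 0 ≤ κ * ‖z‖ ^ 2 := by positivity
  have h6 : -(N * N) ≤ σ * inner ℝ w zx := by
    have := mul_le_mul_of_nonneg_left h3.1 hσ
    nlinarith [mul_nonneg hN hN]
  rw [e1, e2]
  nlinarith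

section Nonlinear

variable {σ : ℝ} {n : ℕ}

-- The central estimate. The top order part is treated through difference quotients and the
-- symmetriser, the lower orders by direct differentiation, and both lose at most a^{n+1} =
-- t^{−(n+1)p}.
set_option maxHeartbeats 1000000 in
theorem exists_sobEnergy_le_add_integral (L : ℝ) [Fact (0 < L)] (hn : 1 ≤ n) (h0 : 1 / 3 < σ)
    (h0' : 0 < σ) (h1 : σ < 1) :
    ∃ C, 0 ≤ C ∧ ∀ W : ℝ → sobolev L (n + 1), SolvesNonlinear (Nat.le_add_left 1 n) σ W →
      ∀ τ ∈ Ioc (0 : ℝ) 1, (∀ t ∈ Icc τ 1, ‖W t‖ ≤ 1) →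
      sobEnergy h0'.le h1 (τ ^ (1 - 3 * σ)) (W τ) ≤
        sobEnergy h0'.le h1 ((1 : ℝ) ^ (1 - 3 * σ)) (W 1) +
        ∫ t in τ..1, C * t ^ (-((n + 1) * (3 * σ - 1))) *
          sobEnergy h0'.le h1 (t ^ (1 - 3 * σ)) (W t) := by
  obtain ⟨K, hK, hK'⟩ := exists_commutator_coefC L hn h0' h1
  obtain ⟨K₂, hK₂, hK₂'⟩ := exists_sobComp_eq_linear L hn h0 h1
  set c := (√(σ * (1 - σ)))⁻¹
  have hc : 0 ≤ c := inv_nonneg.2 (Real.sqrt_nonneg _)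
  -- Each row contains two commutators. The first row is measured with the weight, while the second
  -- has the weight removed at the cost of c; 2K(1 + c) covers both.
  obtain ⟨C₁, hC₁, hC₁'⟩ := exists_neg_le_energyRate L hn h0' h1 (2 * K * (1 + c)) (by positivity)
  have hσ : 0 < σ * (1 - σ) := mul_pos h0' (by linarith)
  -- The first C₁ multiplies the top order form. The fraction comes from the ‖W‖² terms, of which
  -- there is one at top order and one for each of the n + 1 lower orders, through ‖W‖² ≤
  -- E/(σ(1−σ)).
  refine ⟨C₁ + (C₁ + (n + 1) * (4 + 4 * K₂)) / (σ * (1 - σ)), by positivity, fun W hW τ hτ hN => ?_⟩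
  obtain ⟨hWc, W', hWc', hd, he⟩ := hW
  have hIcc : Icc τ 1 ⊆ Ioc (0 : ℝ) 1 := fun t ht => ⟨hτ.1.trans_le ht.1, ht.2⟩
  have ha1 : ∀ t ∈ Icc τ 1, 1 ≤ t ^ (1 - 3 * σ) := fun t ht => one_le_rpow_of_mem h0 (hIcc ht)
  have hak : ∀ t ∈ Icc τ 1, t ^ (-((n + 1) * (3 * σ - 1))) = (t ^ (1 - 3 * σ)) ^ (n + 1) := by
    intro t ht
    rw [← Real.rpow_mul_natCast (hIcc ht).1.le]
    congr 1
    push_cast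
    ring
  choose! F R hF hR hb using fun t (ht : t ∈ Icc τ 1) => hK' (t ^ (1 - 3 * σ)) (W t) (ha1 t ht) (hN t ht)
  set a : ℝ → ℝ := fun t => t ^ (1 - 3 * σ) with ha
  set κ : ℝ → ℝ := fun t => (3 * σ - 1) / t with hκ
  set y : ℝ → CircleC L := fun t => a t • sobC (Nat.succ_pos n) 1 (W t) with hy
  set B : Fin 2 → Fin 2 → ℝ → CircleC L := fun i j t => coefC h0'.le h1 i j (y t) with hB
  set X : Fin 2 → Fin 2 → ℝ → CircleC L := fun i j t => compDx (contDiff_coeffB h0'.le h1 i j) (a t)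
    (sobC (Nat.succ_pos n) 1 (W t)) (sobC (Nat.succ_lt_succ hn) 1 (W t)) with hX
  set q : ℝ → CircleC L := fun t => leadC h0'.le h1 hn (κ t) (a t) (W t) with hq
  set s : ℝ → CircleC L := fun t => symC h0'.le h1 (y t) with hs
  set v : Fin 2 → ℝ → ScalarL2 L := fun j t => sobComp j (n + 1) (W t) with hv
  set z : Fin 2 → ℝ → ScalarL2 L := fun j t => sobComp j n (W t) with hz
  set D : ℝ → ℝ := fun t => ∑ ℓ ∈ Finset.range (n + 1),
    (2 * inner ℝ (sobComp 0 ℓ (W t)) (sobComp 0 ℓ (W' t)) +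
      2 * inner ℝ (sobComp 1 ℓ (W t)) (sobComp 1 ℓ (W' t))) with hD
  -- What remains after D_h is moved past the coefficients. The last term is the difference quotient
  -- of an H¹ function, so r stays bounded as h → 0 and tends to r', the commutator of ∂ₓ^{n+1} with
  -- the coefficients.
  set r : Fin 2 → ℝ → ℝ → ScalarL2 L := fun i h t =>
    cmul (diffQuotC h (B i 0 t)) (shiftLp h (v 0 t)) + cmul (diffQuotC h (B i 1 t)) (shiftLp h (v 1 t)) +
      diffQuot h ((F t i 0 - cmul (B i 0 t) (v 0 t)) + (F t i 1 - cmul (B i 1 t) (v 1 t))) with hr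
  set r' : Fin 2 → ℝ → ScalarL2 L := fun i t =>
    cmul (X i 0 t) (v 0 t) + cmul (X i 1 t) (v 1 t) + (R t i 0 + R t i 1) with hr'
  -- regularity in `x`
  have hw₁ : ∀ t, InH1 (toL2 (sobC (Nat.succ_pos n) 1 (W t)))
      (toL2 (sobC (Nat.succ_lt_succ hn) 1 (W t))) := fun t => by
    rw [toL2_sobC, toL2_sobC]
    exact inH1_sobComp (Nat.succ_pos n) 1 (W t)
  have hBX : ∀ i j t, InH1 (toL2 (B i j t)) (toL2 (X i j t)) := fun i j t =>
    inH1_comp_smul (contDiff_coeffB h0'.le h1 i j) (a t) (hw₁ t)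
  have hsB : ∀ t, InH1 (toL2 (s t * B 0 0 t)) (toL2 (compDx (contDiff_symmetrizer_mul h0'.le h1) (a t)
      (sobC (Nat.succ_pos n) 1 (W t)) (sobC (Nat.succ_lt_succ hn) 1 (W t)))) := fun t => by
    have h2 := inH1_comp_smul (contDiff_symmetrizer_mul h0'.le h1) (a t) (hw₁ t)
    have h3 : s t * B 0 0 t = compC (symmetrizer σ * coeffB σ 0 0)
      (contDiff_symmetrizer_mul h0'.le h1).continuous (a t • sobC (Nat.succ_pos n) 1 (W t)) := by
      ext x; rfl
    rw [h3]
    exact h2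
  have hzv : ∀ j t, InH1 (z j t) (v j t) := fun j t => inH1_sobComp (Nat.lt_succ_self n) j (W t)
  have hg : ∀ i, ∀ t ∈ Icc τ 1, InH1 ((F t i 0 - cmul (B i 0 t) (v 0 t)) +
      (F t i 1 - cmul (B i 1 t) (v 1 t))) (R t i 0 + R t i 1) := fun i t ht =>
    (hR t ht i 0).add (hR t ht i 1)
  -- continuity in `t`
  have hWc1 : ContinuousOn W (Icc τ 1) := hWc.mono hIcc
  have hac : ContinuousOn a (Icc τ 1) := fun t ht =>
    (Real.continuousAt_rpow_const _ _ (Or.inl (hIcc ht).1.ne')).continuousWithinAt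
  have hκc : ContinuousOn κ (Icc τ 1) := continuousOn_const.div continuousOn_id fun t ht => (hIcc ht).1.ne'
  have hsC : ∀ {ℓ : ℕ} (h : ℓ < n + 1), ContinuousOn (fun t => sobC h 1 (W t)) (Icc τ 1) := fun h =>
    (sobC h 1).continuous.comp_continuousOn hWc1
  have hqc : ContinuousOn q (Icc τ 1) := continuousOn_leadC h0'.le h1 hn hκc hac hWc1
  have hXc : ∀ i j, ContinuousOn (X i j) (Icc τ 1) := fun i j =>
    continuousOn_compDx _ hac (hsC _) (hsC _)
  have hsc : ContinuousOn s (Icc τ 1) := (continuous_compC _ _).comp_continuousOn (hac.smul (hsC _))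
  have hDc : ContinuousOn D (Icc τ 1) := by
    have h2 := hWc'.mono hIcc
    refine continuousOn_finsetSum _ fun ℓ _ => ContinuousOn.add ?_ ?_
    · exact (((sobComp 0 ℓ).continuous.comp_continuousOn hWc1).inner
        ((sobComp 0 ℓ).continuous.comp_continuousOn h2)).const_mul 2
    · exact (((sobComp 1 ℓ).continuous.comp_continuousOn hWc1).inner
        ((sobComp 1 ℓ).continuous.comp_continuousOn h2)).const_mul 2
  -- M depends on the solution and on τ. This is harmless, as it enters only as a dominating
  -- constant and not in the final inequality.
  obtain ⟨M, hM⟩ := isCompact_Icc.exists_bound_of_continuousOn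
    (f := fun t => ‖q t‖ + ‖s t‖ + (‖X 0 0 t‖ + ‖X 0 1 t‖ + ‖X 1 0 t‖ + ‖X 1 1 t‖) + |D t| + |a t ^ (n + 1)|)
    (((hqc.norm.add hsc.norm).add ((((hXc 0 0).norm.add (hXc 0 1).norm).add (hXc 1 0).norm).add
      (hXc 1 1).norm)).add hDc.abs |>.add (hac.pow (n + 1)).abs)
  have hM' : ∀ t ∈ Icc τ 1, ‖q t‖ ≤ M ∧ ‖s t‖ ≤ M ∧ (∀ i j, ‖X i j t‖ ≤ M) ∧ |D t| ≤ M ∧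
      |a t ^ (n + 1)| ≤ M := fun t ht => by
    have h2 := (le_abs_self _).trans (hM t ht)
    have g1 := norm_nonneg (q t)
    have g2 := norm_nonneg (s t)
    have g3 := norm_nonneg (X 0 0 t)
    have g4 := norm_nonneg (X 0 1 t)
    have g5 := norm_nonneg (X 1 0 t)
    have g6 := norm_nonneg (X 1 1 t)
    have g7 := abs_nonneg (D t)
    have g8 := abs_nonneg (a t ^ (n + 1))
    refine ⟨by linarith, by linarith, fun i j => ?_, by linarith, by linarith⟩
    fin_cases i <;> fin_cases j <;> simp only [Fin.mk_zero, Fin.mk_one] <;> linarith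
  have hM0 : 0 ≤ M := (norm_nonneg _).trans (hM' 1 ⟨hτ.2, le_rfl⟩).1
  have hv1 : ∀ j, ∀ t ∈ Icc τ 1, ‖v j t‖ ≤ 1 := fun j t ht => (norm_sobComp_le j _ _).trans (hN t ht)
  -- bounds for the commutators
  have hcm : ∀ i j, ∀ t ∈ Icc τ 1, ‖cmul (X i j t) (v j t) + R t i j‖ ≤ c * (K * a t ^ (n + 1) * ‖W t‖ ^ 2) :=
    fun i j t ht => (norm_le_mul_norm_cmul_weightC h0' h1 (y t) _).trans
      (mul_le_mul_of_nonneg_left (hb t ht i j) hc)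
  have hRb : ∀ i j, ∀ t ∈ Icc τ 1, ‖R t i j‖ ≤ c * (K * M) + M := fun i j t ht => by
    have e1 : R t i j = (cmul (X i j t) (v j t) + R t i j) - cmul (X i j t) (v j t) := by abel
    rw [e1]
    refine (norm_sub_le _ _).trans (add_le_add ((hcm i j t ht).trans ?_) ((norm_cmul_le _ _).trans ?_))
    · refine mul_le_mul_of_nonneg_left ?_ hc
      have e2 : ‖W t‖ ^ 2 ≤ 1 := pow_le_one₀ (norm_nonneg _) (hN t ht)
      have e3 : a t ^ (n + 1) ≤ M := (le_abs_self _).trans (hM' t ht).2.2.2.2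
      calc K * a t ^ (n + 1) * ‖W t‖ ^ 2 ≤ K * M * 1 := by gcongr
        _ = K * M := mul_one _
    · calc _ ≤ M * 1 := mul_le_mul ((hM' t ht).2.2.1 i j) (hv1 j t ht) (norm_nonneg _) hM0
        _ = M := mul_one M
  set M₁ := M + M + ((c * (K * M) + M) + (c * (K * M) + M))
  have hMM₁ : M ≤ M₁ := by simp only [M₁]; linarith [mul_nonneg hc (mul_nonneg hK hM0)]
  have hrb : ∀ i h, ∀ t ∈ Icc τ 1, ‖r i h t‖ ≤ M₁ := fun i h t ht => by
    refine (norm_add_le _ _).trans (add_le_add ((norm_add_le _ _).trans (add_le_add ?_ ?_)) ?_)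
    · refine (norm_cmul_diffQuotC_le (hBX i 0 t) _ h).trans ?_
      calc _ ≤ M * 1 := mul_le_mul ((hM' t ht).2.2.1 i 0) (hv1 0 t ht) (norm_nonneg _) hM0
        _ = M := mul_one M
    · refine (norm_cmul_diffQuotC_le (hBX i 1 t) _ h).trans ?_
      calc _ ≤ M * 1 := mul_le_mul ((hM' t ht).2.2.1 i 1) (hv1 1 t ht) (norm_nonneg _) hM0
        _ = M := mul_one M
    · exact ((hg i t ht).norm_diffQuot_le h).trans
        ((norm_add_le _ _).trans (add_le_add (hRb i 0 t ht) (hRb i 1 t ht)))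
  have hrl : ∀ i, ∀ t ∈ Icc τ 1, Tendsto (fun h => r i h t) (𝓝[≠] 0) (𝓝 (r' i t)) := fun i t ht =>
    ((tendsto_cmul_diffQuotC (hBX i 0 t) _).add (tendsto_cmul_diffQuotC (hBX i 1 t) _)).add
      (hg i t ht).tendsto_diffQuot
  have h3 := le_add_integral_of_tendsto_deriv (l := 𝓝[≠] (0 : ℝ)) (τ := τ) (M := (6 * M₁ + 2 * M₁ * M₁) + M)
    hτ.2
    (e := fun h t => energyForm (s t) (diffQuot h (z 0 t)) (diffQuot h (z 1 t)) +
      ∑ ℓ ∈ Finset.range (n + 1), (‖sobComp 0 ℓ (W t)‖ ^ 2 + ‖sobComp 1 ℓ (W t)‖ ^ 2))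
    (G := fun h t => energyRate (q t) (X 1 0 t) (X 1 1 t) (s t) (diffQuot h (z 0 t)) (diffQuot h (z 1 t))
      (r 0 h t) (r 1 h t) + D t)
    (E := fun t => sobEnergy h0'.le h1 (a t) (W t))
    (ψ := fun t => (C₁ + (C₁ + (n + 1) * (4 + 4 * K₂)) / (σ * (1 - σ))) *
      t ^ (-((n + 1) * (3 * σ - 1))) * sobEnergy h0'.le h1 (t ^ (1 - 3 * σ)) (W t))
    (H := fun t => energyRate (q t) (X 1 0 t) (X 1 1 t) (s t) (v 0 t) (v 1 t) (r' 0 t) (r' 1 t) + D t)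
    ?_ ?_ ?_ ?_ ?_ ?_
  · exact h3
  · intro h t ht
    have ht' := hIcc ht
    have hd' := (hd t ht').mono hIcc
    obtain ⟨e0, e1⟩ := sobComp_of_nonlinear_equation (Nat.le_add_left 1 n) h0'.le h1 (he t ht')
      (ℓ := n) le_rfl (hF t ht)
    refine HasDerivWithinAt.add ?_ ?_
    · refine hasDerivWithinAt_energyForm_diffQuot (b := fun i j => B i j t) (κ := κ t)
        (hasDerivWithinAt_symC h0'.le h1 hn ht'.1 hd' (he t ht')) ?_ ?_ (hzv 0 t) (hzv 1 t)
        (symC_mul_coefC h0'.le h1 (y t)) (hsB t) (hBX 1 0 t) (hBX 1 1 t) h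
      · refine (hasDerivWithinAt_sobComp hd' (ℓ := n) le_rfl 0).congr_deriv ?_
        rw [e0]
        simp only [hκ, hz, hB]
        abel
      · refine (hasDerivWithinAt_sobComp hd' (ℓ := n) le_rfl 1).congr_deriv ?_
        rw [e1]
        abel
    · refine HasDerivWithinAt.fun_sum fun ℓ hℓ => ?_
      have hℓ' : ℓ ≤ n := Nat.lt_succ_iff.1 (Finset.mem_range.1 hℓ)
      exact (hasDerivWithinAt_sobComp hd' hℓ' 0).norm_sq.add (hasDerivWithinAt_sobComp hd' hℓ' 1).norm_sq
  · intro h t ht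
    obtain ⟨m1, m2, m3, m4, -⟩ := hM' t ht
    refine (abs_add_le _ _).trans (add_le_add ?_ m4)
    exact abs_energyRate_le (m1.trans hMM₁) ((m3 1 0).trans hMM₁) ((m3 1 1).trans hMM₁)
      (m2.trans hMM₁) (((hzv 0 t).norm_diffQuot_le h).trans (hv1 0 t ht))
      (((hzv 1 t).norm_diffQuot_le h).trans (hv1 1 t ht)) (hrb 0 h t ht) (hrb 1 h t ht)
  · intro t ht
    refine Tendsto.add ?_ tendsto_const_nhds
    exact ((((cmul (s t)).continuous.tendsto _).comp (hzv 0 t).tendsto_diffQuot).inner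
      (hzv 0 t).tendsto_diffQuot).add ((hzv 1 t).tendsto_diffQuot.norm.pow 2)
  · intro t ht
    exact (tendsto_energyRate (hzv 0 t).tendsto_diffQuot (hzv 1 t).tendsto_diffQuot (hrl 0 t ht)
      (hrl 1 t ht)).add tendsto_const_nhds
  · refine ContinuousOn.mul (continuousOn_const.mul fun t ht => ?_) (continuousOn_sobEnergy _ _ hac hWc1)
    exact (Real.continuousAt_rpow_const _ _ (Or.inl (hIcc ht).1.ne')).continuousWithinAt
  · intro t ht
    have ht' := hIcc ht
    have hp : 0 ≤ κ t := div_nonneg (by linarith) ht'.1.le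
    have ha0 : 0 ≤ a t := zero_le_one.trans (ha1 t ht)
    have hap : 1 ≤ a t ^ (n + 1) := one_le_pow₀ (ha1 t ht)
    set N := ‖W t‖
    have hN1 : N ≤ 1 := hN t ht
    have hN0 : 0 ≤ N := norm_nonneg _
    have hr'e : ∀ i, r' i t = (cmul (X i 0 t) (v 0 t) + R t i 0) + (cmul (X i 1 t) (v 1 t) + R t i 1) :=
      fun i => by simp only [hr']; abel
    have hKN : 0 ≤ K * a t ^ (n + 1) * N ^ 2 := by positivity
    have g0 : ‖cmul (weightC h0'.le h1 (y t)) (r' 0 t)‖ ≤ 2 * K * (1 + c) * a t ^ (n + 1) * N ^ 2 := by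
      rw [hr'e, map_add]
      refine (norm_add_le _ _).trans ((add_le_add (hb t ht 0 0) (hb t ht 0 1)).trans ?_)
      have := mul_nonneg hc hKN
      linarith
    have g1 : ‖r' 1 t‖ ≤ 2 * K * (1 + c) * a t ^ (n + 1) * N ^ 2 := by
      rw [hr'e]
      refine (norm_add_le _ _).trans ((add_le_add (hcm 1 0 t ht) (hcm 1 1 t ht)).trans ?_)
      linarith
    have k1 := hC₁' (κ t) (a t) (W t) (r' 0 t) (r' 1 t) hp (ha1 t ht) hN1 g0 g1
    have k2 : -((n + 1) * ((4 + 4 * K₂) * (a t ^ (n + 1) * N ^ 2))) ≤ D t := by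
      have k3 : ∀ ℓ ∈ Finset.range (n + 1), -((4 + 4 * K₂) * (a t ^ (n + 1) * N ^ 2)) ≤
          2 * inner ℝ (sobComp 0 ℓ (W t)) (sobComp 0 ℓ (W' t)) +
          2 * inner ℝ (sobComp 1 ℓ (W t)) (sobComp 1 ℓ (W' t)) := by
        intro ℓ hℓ
        have hℓ' : ℓ ≤ n := Nat.lt_succ_iff.1 (Finset.mem_range.1 hℓ)
        obtain ⟨l0, l1⟩ := hK₂' t ht' (W' t) (W t) hN1 (he t ht') ℓ hℓ'
        have l2 : K₂ * a t ^ (ℓ + 1) * N ^ 2 ≤ K₂ * a t ^ (n + 1) * N := by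
          have l3 : a t ^ (ℓ + 1) ≤ a t ^ (n + 1) := pow_le_pow_right₀ (ha1 t ht) (by omega)
          have l4 : N ^ 2 ≤ N := by nlinarith
          gcongr
        have l5 := neg_le_inner_add_inner h0'.le h1.le hp (norm_sobComp_le 0 ℓ (W t))
          (norm_sobComp_le 1 ℓ (W t)) (norm_sobComp_le 0 (ℓ + 1) (W t))
          (norm_sobComp_le 1 (ℓ + 1) (W t)) (l0.trans l2) (l1.trans l2)
        refine le_trans ?_ l5
        have l6 := mul_le_mul_of_nonneg_right hap (sq_nonneg N)
        linarith
      have := Finset.card_nsmul_le_sum _ _ _ k3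
      rw [Finset.card_range, nsmul_eq_mul] at this
      push_cast at this
      linarith
    have k4 := le_sobEnergy h0' h1 (a t) (W t)
    have k5 : energyForm (s t) (v 0 t) (v 1 t) ≤ sobEnergy h0'.le h1 (a t) (W t) :=
      le_add_of_nonneg_right (Finset.sum_nonneg fun ℓ _ => by positivity)
    have k6 : N ^ 2 ≤ sobEnergy h0'.le h1 (a t) (W t) / (σ * (1 - σ)) := by
      rw [le_div_iff₀ hσ]; linarith
    rw [hak t ht]
    change -(_ * a t ^ (n + 1) * sobEnergy h0'.le h1 (a t) (W t)) ≤ _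
    set 𝓔 := sobEnergy h0'.le h1 (a t) (W t)
    have k7 : C₁ * a t ^ (n + 1) * (energyForm (s t) (v 0 t) (v 1 t) + N ^ 2) ≤
        C₁ * a t ^ (n + 1) * (𝓔 + 𝓔 / (σ * (1 - σ))) := by gcongr
    have k8 : (n + 1) * ((4 + 4 * K₂) * (a t ^ (n + 1) * N ^ 2)) ≤
        (n + 1) * ((4 + 4 * K₂) * (a t ^ (n + 1) * (𝓔 / (σ * (1 - σ))))) := by gcongr
    refine le_trans (le_of_eq ?_) (add_le_add ((neg_le_neg k7).trans k1) ((neg_le_neg k8).trans k2))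
    ring

end Nonlinear

end

/-! ### Smallness, convergence and comparison for the nonlinear equation. -/

noncomputable section

variable {L : ℝ} [Fact (0 < L)]

set_option linter.unusedSectionVars false

section Nonlinear

variable {σ : ℝ} {n : ℕ}

/-- The energy controls the norm from below at every time and from above at t = 1, so Grönwall
between these two bounds gives a constant independent of τ. It is here that (n+1)p < 1 is decisive.
-/
theorem exists_norm_le_of_norm_le_one (L : ℝ) [Fact (0 < L)] (hn : 1 ≤ n) (h0 : 1 / 3 < σ)
    (h1 : σ < 1) (hκ : (n + 1) * (3 * σ - 1) < 1) :
    ∃ C, 0 < C ∧ ∀ W : ℝ → sobolev L (n + 1), SolvesNonlinear (Nat.le_add_left 1 n) σ W →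
      ∀ τ ∈ Ioc (0 : ℝ) 1, (∀ t ∈ Icc τ 1, ‖W t‖ ≤ 1) → ‖W τ‖ ≤ C * ‖W 1‖ := by
  have h0' : 0 < σ := by linarith
  have hσ : 0 < σ * (1 - σ) := mul_pos h0' (by linarith)
  obtain ⟨A, hA, hA'⟩ := exists_sobEnergy_le_add_integral L hn h0 h0' h1
  obtain ⟨B, hB, hB'⟩ := exists_sobEnergy_one_le L n h0'.le h1
  set κ : ℝ := (n + 1) * (3 * σ - 1)
  -- The summand 1 only ensures positivity.
  set Q := Real.exp (A / (1 - κ)) * B / (σ * (1 - σ)) + 1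
  have hQ : 0 < Q := by positivity
  refine ⟨√Q, Real.sqrt_pos.2 hQ, fun W hW τ hτ hN => ?_⟩
  have hIcc : Icc τ 1 ⊆ Ioc (0 : ℝ) 1 := fun t ht => ⟨hτ.1.trans_le ht.1, ht.2⟩
  have hac : ContinuousOn (fun t : ℝ => t ^ (1 - 3 * σ)) (Icc τ 1) := fun t ht =>
    (Real.continuousAt_rpow_const _ _ (Or.inl (hIcc ht).1.ne')).continuousWithinAt
  have h2 := le_exp_mul_of_le_add_integral (κ := κ) hτ.1 hτ.2 hA hκ
    (continuousOn_sobEnergy h0'.le h1 hac (hW.1.mono hIcc)) (sobEnergy_nonneg h0' h1 _ _)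
    fun t ht => hA' W hW t (hIcc ht) fun s hs => hN s ⟨ht.1.trans hs.1, hs.2⟩
  have h3 := le_sobEnergy h0' h1 (τ ^ (1 - 3 * σ)) (W τ)
  have h4 := hB' (W 1) (hN 1 ⟨hτ.2, le_rfl⟩)
  rw [Real.one_rpow] at h2
  have h5 : ‖W τ‖ ^ 2 ≤ Q * ‖W 1‖ ^ 2 := by
    have h6 : σ * (1 - σ) * ‖W τ‖ ^ 2 ≤ Real.exp (A / (1 - κ)) * (B * ‖W 1‖ ^ 2) :=
      h3.trans (h2.trans (mul_le_mul_of_nonneg_left h4 (Real.exp_pos _).le))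
    have h7 : ‖W τ‖ ^ 2 ≤ Real.exp (A / (1 - κ)) * (B * ‖W 1‖ ^ 2) / (σ * (1 - σ)) := by
      rw [le_div_iff₀ hσ]; linarith
    refine h7.trans ?_
    have h8 : Q * ‖W 1‖ ^ 2 = Real.exp (A / (1 - κ)) * (B * ‖W 1‖ ^ 2) / (σ * (1 - σ)) + ‖W 1‖ ^ 2 := by
      simp only [Q]; ring
    rw [h8]
    linarith [sq_nonneg ‖W 1‖]
  refine (abs_le_of_sq_le_sq' ?_ (by positivity)).2
  rwa [mul_pow, Real.sq_sqrt hQ.le]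

/-- Small solutions remain small. -/
theorem exists_norm_le_of_nonlinear (L : ℝ) [Fact (0 < L)] (hn : 1 ≤ n) (h0 : 1 / 3 < σ)
    (h1 : σ < 1) (hκ : (n + 1) * (3 * σ - 1) < 1) :
    ∃ δ₀ > 0, ∃ C > 0, ∀ δ ∈ Ioo (0 : ℝ) δ₀, ∀ W : ℝ → sobolev L (n + 1),
      SolvesNonlinear (Nat.le_add_left 1 n) σ W → ‖W 1‖ ≤ δ →
      ∀ t ∈ Ioc (0 : ℝ) 1, ‖W t‖ ≤ 1 ∧ ‖W t‖ ≤ C * δ := by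
  obtain ⟨C, hC, hC'⟩ := exists_norm_le_of_norm_le_one L hn h0 h1 hκ
  -- With this threshold both δ and Cδ are strictly less than 1, as the continuity argument
  -- requires.
  refine ⟨min 1 C⁻¹, lt_min one_pos (inv_pos.2 hC), C, hC, fun δ hδ W hW hW1 => ?_⟩
  have hδ1 : δ < 1 := hδ.2.trans_le (min_le_left _ _)
  have hCδ : C * δ < 1 := by
    have := mul_lt_mul_of_pos_left (hδ.2.trans_le (min_le_right _ _)) hC
    rwa [mul_inv_cancel₀ hC.ne'] at this
  have key : ∀ t ∈ Ioc (0 : ℝ) 1, ‖W t‖ ≤ 1 := by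
    intro t ht
    by_contra! hlt
    have hIcc : ∀ {s}, s ∈ Icc t 1 → s ∈ Ioc (0 : ℝ) 1 := fun hs => ⟨ht.1.trans_le hs.1, hs.2⟩
    have hcont : ContinuousOn (fun s => ‖W s‖) (Icc t 1) := (hW.1.mono fun s hs => hIcc hs).norm
    have hcl : IsCompact {s ∈ Icc t 1 | 1 ≤ ‖W s‖} :=
      isCompact_Icc.of_isClosed_subset (hcont.preimage_isClosed_of_isClosed isClosed_Icc isClosed_Ici)
        (inter_subset_left)
    -- Take the last time s at which the norm is at least 1. After s it is at most 1, so the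
    -- conditional bound applies at s and yields ‖W s‖ ≤ Cδ < 1, a contradiction.
    obtain ⟨s, ⟨hs, hs1⟩, hmax⟩ := hcl.exists_isGreatest ⟨t, ⟨le_rfl, ht.2⟩, hlt.le⟩
    have hafter : ∀ r ∈ Icc s 1, ‖W r‖ ≤ 1 := by
      intro r hr
      by_contra! hr1
      obtain ⟨r', hr', he⟩ := intermediate_value_Icc' hr.2
        (hcont.mono (Icc_subset_Icc_left (hs.1.trans hr.1))) ⟨hW1.trans hδ1.le, hr1.le⟩
      have h3 : r' ≤ s := hmax ⟨⟨hs.1.trans (hr.1.trans hr'.1), hr'.2⟩, he.ge⟩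
      have h4 : r' = r := le_antisymm (h3.trans hr.1) hr'.1
      have he : ‖W r'‖ = 1 := he
      rw [h4] at he
      linarith
    have h5 := hC' W hW s (hIcc hs) hafter
    have h6 := mul_le_mul_of_nonneg_left hW1 hC.le
    linarith
  refine fun t ht => ⟨key t ht, ?_⟩
  exact (hC' W hW t ht fun s hs => key s ⟨ht.1.trans_le hs.1, hs.2⟩).trans
    (mul_le_mul_of_nonneg_left hW1 hC.le)

theorem rpow_pow_eq {t : ℝ} (ht : 0 < t) (ℓ : ℕ) :
    (t ^ (1 - 3 * σ)) ^ ℓ = t ^ (-(ℓ * (3 * σ - 1))) := by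
  rw [← Real.rpow_mul_natCast ht.le]
  congr 1
  ring

/-- Derivatives of the products with the coefficients. -/
theorem exists_norm_iterDx_coefC_le (L : ℝ) [Fact (0 < L)] (hn : 1 ≤ n) (h0 : 0 ≤ σ) (h1 : σ < 1)
    {ℓ : ℕ} (hℓ : ℓ ≤ n) :
    ∃ K, 0 ≤ K ∧ ∀ (a : ℝ) (u : sobolev L (n + 1)), 1 ≤ a → ‖u‖ ≤ 1 → ∀ i j, ∃ F,
      IterDx ℓ (cmul (coefC h0 h1 i j (a • sobC (Nat.succ_pos n) 1 u)) (sobComp j 1 u)) F ∧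
      ‖F‖ ≤ K * a ^ ℓ := by
  choose K hK hK' using fun i j =>
    (weightedSymbol_coeffB h0 h1 i j).exists_iterDx (L := L) continuous_const ℓ
  refine ⟨∑ i, ∑ j, K i j, Finset.sum_nonneg fun i _ => Finset.sum_nonneg fun j _ => hK i j,
    fun a u ha hu i j => ?_⟩
  have hw₁ : InH1 (toL2 (sobC (Nat.succ_pos n) 1 u)) (toL2 (sobC (Nat.succ_lt_succ hn) 1 u)) := by
    rw [toL2_sobC, toL2_sobC]
    exact inH1_sobComp (Nat.succ_pos n) 1 u
  have hN : SobLe ℓ (toL2 (sobC (Nat.succ_lt_succ hn) 1 u)) ‖u‖ := by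
    rw [toL2_sobC]
    exact sobLe_sobComp (by omega) 1 u
  obtain ⟨F, hF, hb⟩ := hK' i j a _ _ ‖u‖ (sobComp j 1 u) ‖u‖ ha hw₁ hN hu
    (sobLe_sobComp (by omega) j u)
  have hone : (compC (fun _ => (1 : ℝ)) continuous_const (a • sobC (Nat.succ_pos n) 1 u) :
    CircleC L) = 1 := rfl
  rw [hone, cmul_one] at hb
  refine ⟨F, hF, hb.trans ?_⟩
  have h2 : K i j ≤ ∑ i, ∑ j, K i j :=
    (Finset.single_le_sum (f := fun j => K i j) (fun j _ => hK i j) (Finset.mem_univ j)).trans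
      (Finset.single_le_sum (f := fun i => ∑ j, K i j)
        (fun i _ => Finset.sum_nonneg fun j _ => hK i j) (Finset.mem_univ i))
  have h3 : 0 ≤ a ^ ℓ := pow_nonneg (by linarith) _
  calc K i j * a ^ ℓ * ‖u‖ ≤ K i j * a ^ ℓ * 1 :=
        mul_le_mul_of_nonneg_left hu (mul_nonneg (hK i j) h3)
    _ ≤ _ := by rw [mul_one]; exact mul_le_mul_of_nonneg_right h2 h3

/-- The derivatives of a small solution solve the linearised equation with quadratic errors. -/
theorem exists_error_of_nonlinear (L : ℝ) [Fact (0 < L)] (hn : 1 ≤ n) (h0 : 1 / 3 < σ)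
    (h1 : σ < 1) (hκ : (n + 1) * (3 * σ - 1) < 1) :
    ∃ δ₀ > 0, ∃ C > 0, ∃ A ≥ 0, ∀ δ ∈ Ioo (0 : ℝ) δ₀, ∀ W : ℝ → sobolev L (n + 1),
      SolvesNonlinear (Nat.le_add_left 1 n) σ W → ‖W 1‖ ≤ δ →
      (∀ t ∈ Ioc (0 : ℝ) 1, ‖W t‖ ≤ C * δ) ∧ ∀ ℓ ≤ n, ∃ r₀ r₁ : ℝ → ScalarL2 L,
        ∀ t ∈ Ioc (0 : ℝ) 1,
        HasDerivWithinAt (fun s => sobComp 0 ℓ (W s))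
          (((3 * σ - 1) / t) • sobComp 0 ℓ (W t) + sobComp 1 (ℓ + 1) (W t) - r₀ t) (Ioc 0 1) t ∧
        HasDerivWithinAt (fun s => sobComp 1 ℓ (W s)) (σ • sobComp 0 (ℓ + 1) (W t) - r₁ t) (Ioc 0 1) t ∧
        ‖r₀ t‖ ≤ A * δ ^ 2 * t ^ (-((ℓ + 1) * (3 * σ - 1))) ∧
        ‖r₁ t‖ ≤ A * δ ^ 2 * t ^ (-((ℓ + 1) * (3 * σ - 1))) := by
  obtain ⟨δ₀, hδ₀, C, hC, hC'⟩ := exists_norm_le_of_nonlinear L hn h0 h1 hκ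
  obtain ⟨K, hK, hK'⟩ := exists_sobComp_eq_linear L hn h0 h1
  refine ⟨δ₀, hδ₀, C, hC, K * C ^ 2, by positivity, fun δ hδ W hW hW1 => ?_⟩
  have hb := hC' δ hδ W hW hW1
  refine ⟨fun t ht => (hb t ht).2, fun ℓ hℓ => ?_⟩
  obtain ⟨-, W', -, hd, he⟩ := hW
  refine ⟨fun t => ((3 * σ - 1) / t) • sobComp 0 ℓ (W t) + sobComp 1 (ℓ + 1) (W t) - sobComp 0 ℓ (W' t),
    fun t => σ • sobComp 0 (ℓ + 1) (W t) - sobComp 1 ℓ (W' t), fun t ht => ?_⟩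
  obtain ⟨e0, e1⟩ := hK' t ht (W' t) (W t) (hb t ht).1 (he t ht) ℓ hℓ
  have h2 : K * (t ^ (1 - 3 * σ)) ^ (ℓ + 1) * ‖W t‖ ^ 2 ≤
      K * C ^ 2 * δ ^ 2 * t ^ (-((ℓ + 1) * (3 * σ - 1))) := by
    have h5 := rpow_pow_eq (σ := σ) ht.1 (ℓ + 1)
    push_cast at h5
    rw [← h5]
    have h3 : 0 ≤ (t ^ (1 - 3 * σ)) ^ (ℓ + 1) := pow_nonneg (Real.rpow_nonneg ht.1.le _) _
    have h4 : ‖W t‖ ^ 2 ≤ (C * δ) ^ 2 := pow_le_pow_left₀ (norm_nonneg _) (hb t ht).2 2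
    calc _ ≤ K * (t ^ (1 - 3 * σ)) ^ (ℓ + 1) * (C * δ) ^ 2 := by gcongr
      _ = _ := by ring
  refine ⟨?_, ?_, e0.trans h2, e1.trans h2⟩
  · rw [sub_sub_cancel]
    exact hasDerivWithinAt_sobComp (hd t ht) hℓ 0
  · rw [sub_sub_cancel]
    exact hasDerivWithinAt_sobComp (hd t ht) hℓ 1

/-- Small solutions converge as `t ↘ 0`. -/
theorem exists_tendsto_of_nonlinear (hn : 1 ≤ n) (h0 : 1 / 3 < σ) (h1 : σ < 1)
    (hκ : (n + 1) * (3 * σ - 1) < 1) {W : ℝ → sobolev L (n + 1)}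
    (hW : SolvesNonlinear (Nat.le_add_left 1 n) σ W) (hN : ∀ t ∈ Ioc (0 : ℝ) 1, ‖W t‖ ≤ 1) :
    ∃ W₀, Tendsto (fun t => sobolevIncl (Nat.sub_le (n + 1) 1) (W t)) (𝓝[>] 0) (𝓝 W₀) := by
  have h0' : 0 ≤ σ := by linarith
  have hp : 0 < 3 * σ - 1 := by linarith
  obtain ⟨-, W', -, hd, he⟩ := hW
  refine exists_tendsto_sobolev fun ℓ hℓ i => ?_
  have hℓ' : ℓ ≤ n := hℓ
  have hℓn : (ℓ : ℝ) ≤ n := by exact_mod_cast hℓ'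
  simp only [sobComp_incl _ _ hℓ]
  obtain ⟨K, hK, hK'⟩ := exists_norm_iterDx_coefC_le L hn h0' h1 hℓ'
  choose! F hF hb using fun t (ht : t ∈ Ioc (0 : ℝ) 1) =>
    hK' (t ^ (1 - 3 * σ)) (W t) (one_le_rpow_of_mem h0 ht) (hN t ht)
  have hFb : ∀ i, ∀ t ∈ Ioc (0 : ℝ) 1, ‖-(F t i 0 + F t i 1)‖ ≤ 2 * K * t ^ (-(ℓ * (3 * σ - 1))) :=
    fun i t ht => by
      rw [norm_neg, ← rpow_pow_eq ht.1]
      refine (norm_add_le _ _).trans ((add_le_add (hb t ht i 0) (hb t ht i 1)).trans_eq (by ring))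
  have heq := fun t (ht : t ∈ Ioc (0 : ℝ) 1) =>
    sobComp_of_nonlinear_equation (Nat.le_add_left 1 n) h0' h1 (he t ht) hℓ' (hF t ht)
  fin_cases i
  -- The flux is O(t^{−ℓp}), and the integrating factor costs one more p, so (ℓ+1)p < 1 is needed; ℓ
  -- ≤ n provides it. For w, ℓp < 1 suffices.
  · refine ⟨0, tendsto_zero_of_singular_deriv (κ := ℓ * (3 * σ - 1)) hp (by nlinarith)
      (fun t ht => hasDerivWithinAt_sobComp (hd t ht) hℓ 0) (fun t ht => ?_) (hFb 0)⟩
    exact (heq t ht).1.trans (sub_eq_add_neg _ _)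
  · refine exists_tendsto_of_norm_deriv_le (κ := ℓ * (3 * σ - 1)) (by nlinarith)
      (fun t ht => ((heq t ht).2 ▸ hasDerivWithinAt_sobComp (hd t ht) hℓ 1)) (hFb 1)

/-- Comparison of small solutions with solutions of the linearised equation. -/
theorem exists_norm_sub_le_of_nonlinear (L : ℝ) [Fact (0 < L)] (hn : 1 ≤ n) (h0 : 1 / 3 < σ)
    (h1 : σ < 1) (hκ : (n + 1) * (3 * σ - 1) < 1) :
    ∃ δ₀ > 0, ∃ C > 0, ∀ δ ∈ Ioo (0 : ℝ) δ₀, ∀ W V : ℝ → sobolev L (n + 1),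
      SolvesNonlinear (Nat.le_add_left 1 n) σ W → ‖W 1‖ ≤ δ →
      SolvesLinearised (Nat.le_add_left 1 n) σ V →
      (∀ t ∈ Ioc (0 : ℝ) 1, ‖W t‖ ≤ 1) ∧
      ∀ t ∈ Ioc (0 : ℝ) 1, ‖sobolevIncl (Nat.sub_le (n + 1) 1) (W t - V t)‖ ≤
        C * (‖sobolevIncl (Nat.sub_le (n + 1) 1) (W 1 - V 1)‖ + δ ^ 2) := by
  obtain ⟨δ₀, hδ₀, C, hC, A, hA, hA'⟩ := exists_error_of_nonlinear L hn h0 h1 hκ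
  have h0' : 0 < σ := by linarith
  have hp : 0 ≤ 3 * σ - 1 := by linarith
  set κ : ℝ := (n + 1) * (3 * σ - 1)
  have hκ' : 0 < 1 - κ := by linarith
  -- At each order the energy of the difference at time 1 enters with factor 1 and the errors with
  -- 2A/(1−κ). Summing n + 1 orders and dividing by σ, the weight of z, gives √((n+1)/σ).
  set B := 1 + 2 * A / (1 - κ)
  have hB : 0 < B := by positivity
  refine ⟨min δ₀ C⁻¹, lt_min hδ₀ (inv_pos.2 hC), √((n + 1) / σ) * B, by positivity,
    fun δ hδ W V hW hW1 hV => ?_⟩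
  obtain ⟨hb, hr⟩ := hA' δ ⟨hδ.1, hδ.2.trans_le (min_le_left _ _)⟩ W hW hW1
  have hCδ : C * δ ≤ 1 := by
    have := mul_le_mul_of_nonneg_left (hδ.2.trans_le (min_le_right _ _)).le hC.le
    rwa [mul_inv_cancel₀ hC.ne'] at this
  refine ⟨fun t ht => (hb t ht).trans hCδ, fun t ht => ?_⟩
  set I : sobolev L (n + 1) →L[ℝ] sobolev L (n + 1 - 1) := sobolevIncl (Nat.sub_le (n + 1) 1)
  have hδ2 : 0 ≤ δ ^ 2 := sq_nonneg δ
  set Q := B * (‖I (W 1 - V 1)‖ + δ ^ 2)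
  have hQ : 0 ≤ Q := by positivity
  have hlevel : ∀ ℓ ≤ n, ‖sobComp 0 ℓ (I (W t - V t))‖ ^ 2 + ‖sobComp 1 ℓ (I (W t - V t))‖ ^ 2 ≤
      Q ^ 2 / σ := by
    intro ℓ hℓ
    obtain ⟨r₀, r₁, hrr⟩ := hr ℓ hℓ
    have hpow : ∀ s ∈ Ioc (0 : ℝ) 1, s ^ (-((ℓ + 1) * (3 * σ - 1))) ≤ s ^ (-κ) := fun s hs => by
      refine Real.rpow_le_rpow_of_exponent_ge hs.1 hs.2 ?_
      have : (ℓ : ℝ) ≤ n := by exact_mod_cast hℓ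
      simp only [κ]
      nlinarith
    have hAδ : 0 ≤ A * δ ^ 2 := mul_nonneg hA hδ2
    have h2 := constant_coeff_energy (σ := σ) (p := 3 * σ - 1) (A := A * δ ^ 2) (κ := κ) h0' h1 hp
      hAδ hκ (z := fun s => sobComp 0 ℓ (W s - V s)) (w := fun s => sobComp 1 ℓ (W s - V s))
      (zx := fun s => sobComp 0 (ℓ + 1) (W s - V s)) (wx := fun s => sobComp 1 (ℓ + 1) (W s - V s))
      (r₀ := r₀) (r₁ := r₁)
      (fun s hs => by
        have h3 := (hrr s hs).1.sub (hV.hasDerivWithinAt h0'.le h1 hs hℓ).1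
        simp only [map_sub]
        exact h3.congr_deriv (by rw [smul_sub]; abel))
      (fun s hs => by
        have h3 := (hrr s hs).2.1.sub (hV.hasDerivWithinAt h0'.le h1 hs hℓ).2
        simp only [map_sub]
        exact h3.congr_deriv (by rw [smul_sub]; abel))
      (fun s _ => inH1_sobComp (by omega) 0 _) (fun s _ => inH1_sobComp (by omega) 1 _)
      (fun s hs => (hrr s hs).2.2.1.trans (mul_le_mul_of_nonneg_left (hpow s hs) hAδ))
      (fun s hs => (hrr s hs).2.2.2.trans (mul_le_mul_of_nonneg_left (hpow s hs) hAδ)) ht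
    have hsum : ∀ s, ‖sobComp 0 ℓ (W s - V s)‖ ^ 2 + ‖sobComp 1 ℓ (W s - V s)‖ ^ 2 ≤
        ‖I (W s - V s)‖ ^ 2 := fun s => by
      rw [norm_sq_eq_sobComp (I (W s - V s)), ← sobComp_incl (Nat.sub_le (n + 1) 1) 0 hℓ,
        ← sobComp_incl (Nat.sub_le (n + 1) 1) 1 hℓ]
      exact Finset.single_le_sum (f := fun ℓ => ‖sobComp 0 ℓ (I (W s - V s))‖ ^ 2 +
        ‖sobComp 1 ℓ (I (W s - V s))‖ ^ 2) (fun ℓ _ => by positivity)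
        (Finset.mem_range.2 (Nat.lt_succ_of_le hℓ))
    have h3 : √(σ * ‖sobComp 0 ℓ (W 1 - V 1)‖ ^ 2 + ‖sobComp 1 ℓ (W 1 - V 1)‖ ^ 2) ≤
        ‖I (W 1 - V 1)‖ := by
      refine Real.sqrt_le_iff.2 ⟨norm_nonneg _, ?_⟩
      have := hsum 1
      nlinarith [sq_nonneg ‖sobComp 0 ℓ (W 1 - V 1)‖]
    have h4 : √(σ * ‖sobComp 0 ℓ (W t - V t)‖ ^ 2 + ‖sobComp 1 ℓ (W t - V t)‖ ^ 2) ≤ Q := by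
      refine h2.trans ((add_le_add_left h3 _).trans ?_)
      have h5 : 0 ≤ 2 * A / (1 - κ) * ‖I (W 1 - V 1)‖ := by positivity
      have h6 : 2 * (A * δ ^ 2) / (1 - κ) = 2 * A / (1 - κ) * δ ^ 2 := by ring
      simp only [Q, B]
      rw [h6]
      nlinarith
    have h5 := (Real.sqrt_le_left hQ).1 h4
    rw [sobComp_incl _ 0 hℓ, sobComp_incl _ 1 hℓ, le_div_iff₀ h0']
    nlinarith [sq_nonneg ‖sobComp 1 ℓ (W t - V t)‖]
  have hfin : ‖I (W t - V t)‖ ^ 2 ≤ (√((n + 1) / σ) * Q) ^ 2 := by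
    rw [norm_sq_eq_sobComp, mul_pow, Real.sq_sqrt (by positivity)]
    refine (Finset.sum_le_card_nsmul _ _ (Q ^ 2 / σ) fun ℓ hℓ => hlevel ℓ ?_).trans_eq ?_
    · exact Nat.lt_succ_iff.1 (Finset.mem_range.1 hℓ)
    · rw [Finset.card_range, nsmul_eq_mul]
      push_cast [Nat.add_sub_cancel]
      ring
  have := (abs_le_of_sq_le_sq' hfin (by positivity)).2
  simp only [Q] at this
  rwa [mul_assoc]

end Nonlinear

end

/-! ### Assembly of the proposition. -/

theorem proposition7p1 (L : ℝ) [Fact (0 < L)] (k : ℕ) (hk : 2 ≤ k) (σ : ℝ)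
    (hσ : 1 / 3 < σ) (hσk : σ < (k + 1) / (3 * k)) :
    ∃ Cs > (0 : ℝ), ∃ C₀ > (0 : ℝ), ∃ δ₀ > (0 : ℝ), ∃ C₁ > (0 : ℝ),
      ∀ Wt₁ : sobolev L k,
        -- existence, uniqueness on (0,1], bounds and convergence for the linearised problem
        ∃ Wt : ℝ → sobolev L k, ∃ Wt₀ : sobolev L (k - 1),
          (SolvesLinearised (one_le_two.trans hk) σ Wt ∧ Wt 1 = Wt₁) ∧
          (∀ V : ℝ → sobolev L k,
            SolvesLinearised (one_le_two.trans hk) σ V → V 1 = Wt₁ →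
              Set.EqOn V Wt (Set.Ioc 0 1)) ∧
          (∀ t ∈ Set.Ioc (0 : ℝ) 1,
            holderENorm (k - 1) (1 / 2) (sobolevFun (Wt t)) ≤ ENNReal.ofReal (Cs * ‖Wt t‖) ∧
            ‖Wt t‖ ≤ C₀ * ‖Wt₁‖) ∧
          Filter.Tendsto (fun t => sobolevIncl (Nat.sub_le k 1) (Wt t))
            (nhdsWithin 0 (Set.Ioi 0)) (nhds Wt₀) ∧
          -- comparison with a solution of the nonlinear problem with data of size at most δ
          ∀ δ ∈ Set.Ioo (0 : ℝ) δ₀, ∀ W : ℝ → sobolev L k,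
            SolvesNonlinear (one_le_two.trans hk) σ W → ‖W 1‖ ≤ δ →
            ∃ W₀ : sobolev L (k - 1),
              Filter.Tendsto (fun t => sobolevIncl (Nat.sub_le k 1) (W t))
                (nhdsWithin 0 (Set.Ioi 0)) (nhds W₀) ∧
              (∀ t ∈ Set.Ioc (0 : ℝ) 1,
                holderENorm (k - 2) (1 / 2)
                    (sobolevFun (sobolevIncl (Nat.sub_le k 1) (W t - Wt t))) ≤
                  ENNReal.ofReal (Cs * ‖sobolevIncl (Nat.sub_le k 1) (W t - Wt t)‖) ∧
                ‖sobolevIncl (Nat.sub_le k 1) (W t - Wt t)‖ ≤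
                  C₁ * (‖sobolevIncl (Nat.sub_le k 1) (W 1 - Wt₁)‖ + δ ^ 2)) ∧
              -- the case t = 0, for the limits of W(t) and of Wt(t)
              holderENorm (k - 2) (1 / 2) (sobolevFun (W₀ - Wt₀)) ≤
                ENNReal.ofReal (Cs * ‖W₀ - Wt₀‖) ∧
              ‖W₀ - Wt₀‖ ≤
                C₁ * (‖sobolevIncl (Nat.sub_le k 1) (W 1 - Wt₁)‖ + δ ^ 2) := by
  obtain ⟨n, rfl⟩ : ∃ n, k = n + 1 := ⟨k - 1, by omega⟩
  have hn : 1 ≤ n := by omega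
  -- The upper bound on σ is precisely k(3σ − 1) < 1.
  have hκ : ((n : ℝ) + 1) * (3 * σ - 1) < 1 := by
    push_cast at hσk
    rw [lt_div_iff₀ (by positivity)] at hσk
    linarith
  have hσ2 : σ < 2 / 3 := by
    have : (1 : ℝ) ≤ n := by exact_mod_cast hn
    nlinarith
  have hσ1 : σ < 1 := by linarith
  have hσ0 : 0 < σ := by linarith
  have hS := supConst_nonneg L
  obtain ⟨δ₀, hδ₀, C₁, hC₁, hC₁'⟩ := exists_norm_sub_le_of_nonlinear L hn hσ hσ1 hκ
  -- The embedding constant increases with m, so its value at m = n serves for both Hölder orders k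
  -- − 1 and k − 2.
  have hholder : ∀ (j m : ℕ) (u : sobolev L j), j = m + 1 → m ≤ n →
      holderENorm m (1 / 2) (sobolevFun u) ≤
        ENNReal.ofReal (((n + 1) * (4 * supConst L) + 2) * ‖u‖) := by
    intro j m u hj hm
    have hm' : (m : ℝ) ≤ n := by exact_mod_cast hm
    refine (holderENorm_le hj u).trans (ENNReal.ofReal_le_ofReal ?_)
    gcongr
  refine ⟨(n + 1) * (4 * supConst L) + 2, by positivity, σ⁻¹, by positivity, δ₀, hδ₀, C₁, hC₁,
    fun Wt₁ => ?_⟩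
  obtain ⟨Wt, hWt, hWt1⟩ := exists_solvesLinearised (one_le_two.trans hk) hσ0 hσ1 Wt₁
  obtain ⟨Wt₀, hWt₀⟩ := hWt.exists_tendsto hσ hσ2
  refine ⟨Wt, Wt₀, ⟨hWt, hWt1⟩, fun V hV hV1 => hV.eqOn hσ hσ1 hWt (hV1.trans hWt1.symm),
    fun t ht => ⟨hholder _ _ _ (by omega) (by omega), hWt1 ▸ hWt.norm_le hσ hσ1 ht⟩, hWt₀,
    fun δ hδ W hW hW1 => ?_⟩
  obtain ⟨hN, hdiff⟩ := hC₁' δ hδ W Wt hW hW1 hWt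
  rw [hWt1] at hdiff
  obtain ⟨W₀, hW₀⟩ := exists_tendsto_of_nonlinear hn hσ hσ1 hκ hW hN
  refine ⟨W₀, hW₀, fun t ht => ⟨hholder _ _ _ (by omega) (by omega), hdiff t ht⟩,
    hholder _ _ _ (by omega) (by omega), ?_⟩
  -- The bound for t > 0 is uniform, so it survives the limit t ↘ 0 in H^{k−1}.
  have hlim := (hW₀.sub hWt₀).norm
  simp only [← map_sub] at hlim
  refine le_of_tendsto hlim ?_
  filter_upwards [Ioc_mem_nhdsGT (zero_lt_one (α := ℝ))] with t ht
  exact hdiff t ht
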